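/- A long virtual knot diagram $D$ (an immersed oriented line in $\mathbb{R}^2$ that coincides with the $x$-axis outside a disk, with real and virtual crossings) is considered up to its Gauss diagram on the oriented line; a long virtual knot $K$ is an equivalence class of such diagrams under Reidemeister moves. A surface realization $(\Sigma_g,D)$ of $K$ is a diagram $D$ of $K$ drawn without virtual crossings as a closed curve, with a basepoint corresponding to $\pm\infty$, on a closed connected oriented surface $\Sigma_g$ of genus $g$; the $1$-supporting genus $sg_1(K)$ is the minimal $g$ that occurs. Let $c_1,\dots,c_n$ be the real crossings of $D$, with signs $\varepsilon_i\in\{\pm1\}$. The crossing $c_i$ has type $0$ if, starting from the basepoint, one passes it first over and then under, and type $1$ otherwise; $I_a(D)$ is the set of $i$ such that $c_i$ has type $a$. Smoothing $D$ at $c_i$ gives two cycles on $\Sigma_g$: $\alpha_i$, which does not contain the basepoint, and $\beta_i$, which does. Let $\cdot$ be the intersection number of cycles on $\Sigma_g$. For $a,b\in\{0,1\}$ put $\omega_a(D)=\sum_{i\in I_a(D)}\varepsilon_i$, $W_a(D;t)=\sum_{i\in I_a(D)}\varepsilon_i(t^{\alpha_i\cdot\beta_i}-1)$, and $$F_{ab}(D;t)=\sum_{i\in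 I_a(D),\,j\in I_b(D)}\varepsilon_i\varepsilon_j(t^{\alpha_i\cdot\alpha_j}-1),$$ $$G_{ab}(D;t)=\sum_{i\in I_a(D),\,j\in I_b(D)}\varepsilon_i\varepsilon_j(t^{\alpha_i\cdot\beta_j}-1)-\omega_b(D)\,W_a(D;t),$$ $$H_{ab}(D;t)=\sum_{i\in I_a(D),\,j\in I_b(D)}\varepsilon_i\varepsilon_j(t^{\beta_i\cdot\beta_j}-1)-\omega_a(D)\,W_b(D;t)-\omega_b(D)\,W_a(D;t^{-1}).$$ These Laurent polynomials do not depend on the diagram $D$ of $K$ and are written $F_{ab}(K;t)$, $G_{ab}(K;t)$, $H_{ab}(K;t)$; for $P$ any of them, the equation $P(K;t)=f(t)$ means that $P(D;t)=f(t)$ for every diagram $D$ of $K$. **Theorem 7.4.** Let $f(t)\in\mathbb{Z}[t,t^{-1}]$ be a Laurent polynomial, and let $P$ be one of $F_{01},F_{10},G_{01},G_{10},H_{01},H_{10}$. Then the following are equivalent. 1. There exists a long virtual knot $K$ with $P(K;t)=f(t)$. 2. There exists a long virtual knot $K'$ with $P(K';t)=f(t)$ and $sg_1(K')\leq 1$.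 3. $f(1)=0$. -/

import Mathlib

open scoped LaurentPolynomial

/-! ## Long virtual knot diagrams as signed Gauss codes

A long virtual knot diagram is recorded by its Gauss diagram on an oriented line: going along the
diagram from `-∞` to `∞`, one writes down the real crossings in the order in which they are met,
each time with the information "over or under" and with the sign of the crossing.  Virtual
crossings are not recorded, and the detour (virtual and mixed) moves do not change the code. -/

/-- One passage of a long virtual knot diagram through a real crossing: the name of the crossing,
whether the passage is the over-passage, and the sign of the crossing. -/
@[ext]
structure GaussLetter where
  label : ℕ
  isOver : Bool
  sign : ℤˣ
deriving DecidableEq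

namespace GaussLetter

/-- The other passage through the same crossing. -/
def partner (x : GaussLetter) : GaussLetter := ⟨x.label, !x.isOver, x.sign⟩

/-- Renaming of crossings. -/
def relabel (f : Equiv.Perm ℕ) (x : GaussLetter) : GaussLetter := ⟨f x.label, x.isOver, x.sign⟩

end GaussLetter

/-- A diagram of a long virtual knot: a word in which every crossing that occurs is passed exactly
twice, once over and once under, with the same sign. -/
@[ext]
structure GaussDiagram where
  word : List GaussLetter
  nodup : (word.map fun x => (x.label, x.isOver)).Nodup
  partner_mem : ∀ x ∈ word, x.partner ∈ word

/-! ### Reidemeister moves -/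

/-- The two-letter word `xy` if `k = 1`, and `yx` if `k = -1`. -/
def orderedPair (k : ℤˣ) (x y : GaussLetter) : List GaussLetter :=
  if k = 1 then [x, y] else [y, x]

/-- The three strands of a third Reidemeister move, `0` the top one, `1` the middle one and `2` the
bottom one.  The crossings are `i` (top over middle, sign `a`), `j` (top over bottom, sign `b`) and
`l` (middle over bottom, sign `c`).  For three oriented straight lines in the plane forming a
triangle, the signs `a`, `b`, `c` are arbitrary, and they determine the three orders along the
lines up to one common reversal, recorded by `k`, which tells on which side of the crossing `i`
the bottom line passes. -/
def r3Strand (k a b c : ℤˣ) (i j l : ℕ) : Fin 3 → List GaussLetter :=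
  ![orderedPair (k * b) ⟨i, true, a⟩ ⟨j, true, b⟩,
    orderedPair (k * c) ⟨i, false, a⟩ ⟨l, true, c⟩,
    orderedPair (k * a * b * c) ⟨j, false, b⟩ ⟨l, false, c⟩]

/-- The Reidemeister moves on Gauss codes, with all orientations and all orders of the strands. -/
inductive ReidemeisterMove : List GaussLetter → List GaussLetter → Prop
  /-- renaming the crossings -/
  | relabel (w : List GaussLetter) (f : Equiv.Perm ℕ) :
      ReidemeisterMove w (w.map (GaussLetter.relabel f))
  /-- first move: a kink is inserted -/
  | r1 (A B : List GaussLetter) (x : GaussLetter) :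
      ReidemeisterMove (A ++ B) (A ++ [x, x.partner] ++ B)
  /-- second move, strands with parallel or antiparallel directions, over-strand met first -/
  | r2_over_first (A B C : List GaussLetter) (i j : ℕ) (s k : ℤˣ) :
      ReidemeisterMove (A ++ B ++ C)
        (A ++ [⟨i, true, s⟩, ⟨j, true, -s⟩] ++ B ++
          orderedPair k ⟨i, false, s⟩ ⟨j, false, -s⟩ ++ C)
  /-- second move, strands with parallel or antiparallel directions, under-strand met first -/
  | r2_under_first (A B C : List GaussLetter) (i j : ℕ) (s k : ℤˣ) :
      ReidemeisterMove (A ++ B ++ C)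
        (A ++ orderedPair k ⟨i, false, s⟩ ⟨j, false, -s⟩ ++ B ++
          [⟨i, true, s⟩, ⟨j, true, -s⟩] ++ C)
  /-- third move; `π` is the order in which the three strands are met -/
  | r3 (A B C D : List GaussLetter) (i j l : ℕ) (k a b c : ℤˣ) (π : Equiv.Perm (Fin 3)) :
      ReidemeisterMove
        (A ++ r3Strand k a b c i j l (π 0) ++ B ++ r3Strand k a b c i j l (π 1) ++ C ++
          r3Strand k a b c i j l (π 2) ++ D)
        (A ++ r3Strand (-k) a b c i j l (π 0) ++ B ++ r3Strand (-k) a b c i j l (π 1) ++ C ++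
          r3Strand (-k) a b c i j l (π 2) ++ D)

/-- Two diagrams present the same long virtual knot if they are related by a finite sequence of
Reidemeister moves (through diagrams) and their inverses. -/
instance GaussDiagram.setoid : Setoid GaussDiagram :=
  Relation.EqvGen.setoid fun D D' => ReidemeisterMove D.word D'.word

/-- A long virtual knot. -/
def LongVirtualKnot : Type := Quotient GaussDiagram.setoid

namespace GaussDiagram

/-- `D` is a diagram of the long virtual knot `K`. -/
def Presents (D : GaussDiagram) (K : LongVirtualKnot) : Prop :=
  (Quotient.mk GaussDiagram.setoid D : LongVirtualKnot) = K

/-! ### Crossings, cycles and intersection numbers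

The passages of `D` have the positions `0, …, m - 1`, where `m` is the length of the word.  The
edge number `e`, for `0 ≤ e ≤ m`, leads from position `e - 1` to position `e`; on a closed surface
the edges `m` and `0` meet at the basepoint `±∞`.  So the passage at position `p` enters its
crossing along the edge `p` and leaves it along the edge `p + 1`. -/

/-- The real crossings of `D`, each represented by its over-passage. -/
def crossings (D : GaussDiagram) : Finset GaussLetter :=
  (D.word.filter fun x => x.isOver).toFinset

/-- The position of a passage. -/
def pos (D : GaussDiagram) (x : GaussLetter) : ℕ := D.word.idxOf x

/-- The set `I_a(D)` of crossings of type `a`: type `0` if passed first over and then under,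
type `1` otherwise. -/
def crossingsOfType (D : GaussDiagram) (a : Fin 2) : Finset GaussLetter :=
  D.crossings.filter fun x => (if D.pos x < D.pos x.partner then (0 : Fin 2) else 1) = a

/-- The cycle `α` of a crossing, which does not contain the basepoint, as a `1`-chain (a
multiplicity for every edge): the edges between the two passages of the crossing. -/
def alpha (D : GaussDiagram) (x : GaussLetter) (e : ℕ) : ℤ :=
  if min (D.pos x) (D.pos x.partner) < e ∧ e ≤ max (D.pos x) (D.pos x.partner) then 1 else 0

/-- The cycle `β` of a crossing, which contains the basepoint: the remaining edges. -/
def beta (D : GaussDiagram) (x : GaussLetter) (e : ℕ) : ℤ := 1 - D.alpha x e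

/-- The multiplicity of a cycle at the passage `x`, doubled: the sum of its multiplicities on the
two edges at `x`. -/
def strandMult (D : GaussDiagram) (u : ℕ → ℤ) (x : GaussLetter) : ℤ :=
  u (D.pos x) + u (D.pos x + 1)

/-- The intersection number `u · v`, on an oriented surface carrying `D`, of two cycles `u`, `v`
that run along `D`.  It is a sum of local contributions of the crossings.  At a crossing of sign
`ε` (where the over-strand followed by the under-strand is an `ε`-oriented frame), two cycles that
pass straight through, `u` with multiplicities `p, q` and `v` with multiplicities `p', q'` on the
over- and under-strand, contribute `ε (p q' - p' q)`.  A cycle that turns at the crossing counts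
with the mean of its incoming and outgoing multiplicities on each strand: this is the mean of the
contributions for the two ways of pushing one of the cycles off the other.  The factors `1 / 2` of
the means are collected in the division by `4`, which is exact for cycles. -/
def intersectionNumber (D : GaussDiagram) (u v : ℕ → ℤ) : ℤ :=
  (∑ x ∈ D.crossings, (x.sign : ℤ) *
    (D.strandMult u x * D.strandMult v x.partner -
      D.strandMult v x * D.strandMult u x.partner)) / 4

/-! ### The writhe polynomials and the intersection polynomials -/

/-- The `a`-writhe `ω_a(D)`. -/
def writhe (D : GaussDiagram) (a : Fin 2) : ℤ := ∑ x ∈ D.crossingsOfType a, (x.sign : ℤ)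

open LaurentPolynomial in
/-- The `a`-writhe polynomial `W_a(D; t)`. -/
noncomputable def W (D : GaussDiagram) (a : Fin 2) : ℤ[T;T⁻¹] :=
  ∑ x ∈ D.crossingsOfType a,
    (x.sign : ℤ) • (T (D.intersectionNumber (D.alpha x) (D.beta x)) - 1)

open LaurentPolynomial in
/-- The intersection polynomial `F_{ab}(D; t)`. -/
noncomputable def F (a b : Fin 2) (D : GaussDiagram) : ℤ[T;T⁻¹] :=
  ∑ x ∈ D.crossingsOfType a, ∑ y ∈ D.crossingsOfType b,
    ((x.sign : ℤ) * (y.sign : ℤ)) • (T (D.intersectionNumber (D.alpha x) (D.alpha y)) - 1)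

open LaurentPolynomial in
/-- The intersection polynomial `G_{ab}(D; t)`. -/
noncomputable def G (a b : Fin 2) (D : GaussDiagram) : ℤ[T;T⁻¹] :=
  (∑ x ∈ D.crossingsOfType a, ∑ y ∈ D.crossingsOfType b,
    ((x.sign : ℤ) * (y.sign : ℤ)) • (T (D.intersectionNumber (D.alpha x) (D.beta y)) - 1))
  - D.writhe b • D.W a

open LaurentPolynomial in
/-- The intersection polynomial `H_{ab}(D; t)`. -/
noncomputable def H (a b : Fin 2) (D : GaussDiagram) : ℤ[T;T⁻¹] :=
  (∑ x ∈ D.crossingsOfType a, ∑ y ∈ D.crossingsOfType b,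
    ((x.sign : ℤ) * (y.sign : ℤ)) • (T (D.intersectionNumber (D.beta x) (D.beta y)) - 1))
  - D.writhe a • D.W b - D.writhe b • invert (D.W a)

/-! ### Surface realizations -/

/-- Leaving the crossing of the passage `x`, with the surface on the left-hand side, when one
arrives there along the strand of `x`, forwards (`dir = true`) or backwards (`dir = false`): turn
left into the other strand.  The result is an edge together with a direction. -/
def turnLeft (D : GaussDiagram) (x : GaussLetter) (dir : Bool) : ℕ × Bool :=
  if (if x.isOver = decide (x.sign = 1) then dir else !dir) = true then (D.pos x.partner + 1, true)
  else (D.pos x.partner, false)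

/-- The edge that follows a directed edge along the boundary of the region on its left.  Forwards,
the edge `e` ends at the passage number `e`, backwards at the passage number `e - 1`; if there is
no such passage, it ends at the basepoint, where one goes straight on. -/
def nextEdge (D : GaussDiagram) : ℕ × Bool → ℕ × Bool
  | (e, true) => (D.word[e]?).elim (0, true) fun x => D.turnLeft x true
  | (0, false) => (D.word.length, false)
  | (e + 1, false) => (D.word[e]?).elim (0, false) fun x => D.turnLeft x false

/-- The boundary circles of the regular neighbourhood of the closed curve `D ∪ {±∞}` in an
oriented surface carrying `D`: orbits of directed edges under `nextEdge`. -/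
def BoundaryCircle (D : GaussDiagram) : Type :=
  Quot fun d d' : Fin (D.word.length + 1) × Bool =>
    D.nextEdge (d.1.val, d.2) = (d'.1.val, d'.2)

/-- A surface realization of `D`: a closed connected oriented surface containing the closed curve
`D ∪ {±∞}`.  Up to orientation preserving homeomorphism it is given by its regions, the components
of the complement of a regular neighbourhood of the curve.  Each region is a compact connected
oriented surface with non-empty boundary, hence described by its genus and by the circles which
bound it.  The regions need not be disks. -/
structure SurfaceRealization (D : GaussDiagram) where
  numRegions : ℕ
  region : D.BoundaryCircle → Fin numRegions
  region_surjective : Function.Surjective region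
  regionGenus : Fin numRegions → ℕ

/-- The Euler characteristic of the surface: the curve is a graph with one vertex for each crossing
and one at the basepoint, and with `m + 1` edges; a region of genus `h` with `r` boundary circles
has Euler characteristic `2 - 2 h - r`. -/
noncomputable def SurfaceRealization.eulerChar {D : GaussDiagram} (S : D.SurfaceRealization) : ℤ :=
  ((D.crossings.card : ℤ) + 1) - ((D.word.length : ℤ) + 1) +
    ∑ R : Fin S.numRegions,
      (2 - 2 * (S.regionGenus R : ℤ) - (Nat.card {C : D.BoundaryCircle // S.region C = R} : ℤ))

/-- The surface has genus `g`. -/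
def SurfaceRealization.HasGenus {D : GaussDiagram} (S : D.SurfaceRealization) (g : ℕ) : Prop :=
  S.eulerChar = 2 - 2 * (g : ℤ)

end GaussDiagram

namespace LongVirtualKnot

/-- For `P` one of the intersection polynomials: the long virtual knot `K` satisfies
`P(K; t) = f(t)`, that is, `P(D; t) = f(t)` for every diagram `D` of `K`. -/
def HasPolynomial (K : LongVirtualKnot) (P : GaussDiagram → ℤ[T;T⁻¹]) (f : ℤ[T;T⁻¹]) : Prop :=
  ∀ D : GaussDiagram, D.Presents K → P D = f

/-- The `1`-supporting genus: the minimal genus of a surface realization of (a diagram of) `K`.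
(A minimum over natural numbers, taken in `ℕ∞` so that no junk value can occur.) -/
noncomputable def sg1 (K : LongVirtualKnot) : ℕ∞ :=
  sInf {n : ℕ∞ | ∃ (g : ℕ) (D : GaussDiagram) (S : D.SurfaceRealization),
    D.Presents K ∧ S.HasGenus g ∧ n = g}

end LongVirtualKnot

/-! Setting `t = 1` kills every summand of the polynomials, so `f(1) = 0` is necessary. The content
lies in two other facts: a value computed on one diagram must hold for every diagram of the knot,
and every `f` with `f(1) = 0` must occur in genus 1.

Invariance. Since `β = D - α` and `D · D = 0`, all exponents are combinations of `α_i · D` (`rot`)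
and `α_i · α_j` (`link`), both kept multiplied by four. After the correction terms are absorbed,
`F`, `G`, `H` become sums `pairSum φ a b` over pairs of crossings of types `a` and `b`. For `a ≠ b`
such a sum is invariant if `φ` vanishes on pairs containing a kink (`pairSum_of_equiv`). The
diagonal term of a kink is absent because its types would have to agree. The two crossings of a
bigon have equal type and equal cycles up to terms that pair to zero, and opposite signs. A triangle
move changes no `rot` and no `link`.

Realization. Take a curve with one strand going up an annulus and two strands coming down. Each
crossing exchanges the first strand with a neighbour and so reverses the cyclic order of the three
strands; hence the flat signs alternate, with opposite conventions for the second and the third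
strand. The cycle `α` of a crossing with the second strand goes up and back inside the annulus, and
these cycles have zero intersection with one another. Consequently `link` is determined by the
levels `α_i · D` and the kinds (`link_first`), and `F`, `G` become minus a product of two single
sums over crossings, `H` a sum of two such terms (`pairSum_termF`, `pairSum_termG`,
`pairSum_termH`).

The single sums are read off a walk on states (sign, two levels) whose steps are involutions.
Walking to a level, making two crossings of equal kind and different types, and walking back
produces one term `±(T k - 1)` and restores the state. These terms generate all `f` with `f(1) = 0`.
A fixed frame around such a list makes one factor equal to `-1` (`total_frame`) and forces the
number of boundary circles to equal the number of crossings (`card_boundaryCircle`), so that filling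
the circles with disks gives a torus. -/

namespace GaussLetter

@[simp] theorem partner_label (x : GaussLetter) : x.partner.label = x.label := rfl
@[simp] theorem partner_isOver (x : GaussLetter) : x.partner.isOver = !x.isOver := rfl
@[simp] theorem partner_sign (x : GaussLetter) : x.partner.sign = x.sign := rfl

@[simp] theorem partner_partner (x : GaussLetter) : x.partner.partner = x := by
  ext <;> simp [partner]

theorem partner_ne (x : GaussLetter) : x.partner ≠ x := by
  intro h
  simpa using congrArg isOver h

theorem partner_injective : Function.Injective partner :=
  Function.LeftInverse.injective partner_partner

/-- The sign of the crossing of `x`, as seen from the strand of `x`, in the underlying flat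
diagram. -/
def flatSign (x : GaussLetter) : ℤ := if x.isOver then (x.sign : ℤ) else -(x.sign : ℤ)

@[simp] theorem flatSign_partner (x : GaussLetter) : x.partner.flatSign = -x.flatSign := by
  cases h : x.isOver <;> simp [flatSign, h]

end GaussLetter

/-! ### The intersection form as an antisymmetric pairing on letters -/

/-- The order of two letters in a word: `1` if `x` comes before `y`, `-1` if it comes after `y`. -/
def wordOrder (w : List GaussLetter) (x y : GaussLetter) : ℤ :=
  if w.idxOf x < w.idxOf y then 1 else if w.idxOf y < w.idxOf x then -1 else 0

@[simp] theorem wordOrder_self (w : List GaussLetter) (x : GaussLetter) : wordOrder w x x = 0 := by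
  simp [wordOrder]

theorem wordOrder_swap (w : List GaussLetter) (x y : GaussLetter) :
    wordOrder w x y = -wordOrder w y x := by
  unfold wordOrder
  split_ifs <;> first | rfl | omega

/-- The multiplicity at `z` of the cycle from `x` to its partner, doubled and signed. -/
def chordMult (w : List GaussLetter) (x z : GaussLetter) : ℤ :=
  wordOrder w x z - wordOrder w x.partner z

/-- The sum over all letters that computes intersection numbers (multiplied by four). -/
def wordPairing (w : List GaussLetter) (u v : GaussLetter → ℤ) : ℤ :=
  ∑ z ∈ w.toFinset, z.flatSign * (u z * v z.partner)

theorem wordPairing_congr {w : List GaussLetter} {u u' v v' : GaussLetter → ℤ}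
    (hw : ∀ z ∈ w, z.partner ∈ w) (hu : ∀ z ∈ w, u z = u' z) (hv : ∀ z ∈ w, v z = v' z) :
    wordPairing w u v = wordPairing w u' v' := by
  refine Finset.sum_congr rfl fun z hz => ?_
  rw [List.mem_toFinset] at hz
  rw [hu z hz, hv _ (hw z hz)]

/-- Reindexing the sum by `partner` flips every flat sign and exchanges the two arguments. -/
theorem wordPairing_swap {w : List GaussLetter} (hw : ∀ z ∈ w, z.partner ∈ w)
    (u v : GaussLetter → ℤ) : wordPairing w u v = -wordPairing w v u := by
  unfold wordPairing
  rw [← Finset.sum_neg_distrib]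
  refine Finset.sum_nbij' GaussLetter.partner GaussLetter.partner ?_ ?_ ?_ ?_ ?_
  · intro z hz; simpa using hw z (by simpa using hz)
  · intro z hz; simpa using hw z (by simpa using hz)
  · simp
  · simp
  · intro z _
    simp only [GaussLetter.flatSign_partner, GaussLetter.partner_partner]
    ring

theorem wordPairing_self {w : List GaussLetter} (hw : ∀ z ∈ w, z.partner ∈ w)
    (u : GaussLetter → ℤ) : wordPairing w u u = 0 := by
  have := wordPairing_swap hw u u
  omega

theorem wordPairing_add_left (w : List GaussLetter) (u u' v : GaussLetter → ℤ) :
    wordPairing w (fun z => u z + u' z) v = wordPairing w u v + wordPairing w u' v := by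
  unfold wordPairing
  rw [← Finset.sum_add_distrib]
  exact Finset.sum_congr rfl fun z _ => by ring

theorem wordPairing_add_right (w : List GaussLetter) (u v v' : GaussLetter → ℤ) :
    wordPairing w u (fun z => v z + v' z) = wordPairing w u v + wordPairing w u v' := by
  unfold wordPairing
  rw [← Finset.sum_add_distrib]
  exact Finset.sum_congr rfl fun z _ => by ring

theorem wordPairing_sub_left (w : List GaussLetter) (u u' v : GaussLetter → ℤ) :
    wordPairing w (fun z => u z - u' z) v = wordPairing w u v - wordPairing w u' v := by
  unfold wordPairing
  rw [← Finset.sum_sub_distrib]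
  exact Finset.sum_congr rfl fun z _ => by ring

theorem wordPairing_sub_right (w : List GaussLetter) (u v v' : GaussLetter → ℤ) :
    wordPairing w u (fun z => v z - v' z) = wordPairing w u v - wordPairing w u v' := by
  unfold wordPairing
  rw [← Finset.sum_sub_distrib]
  exact Finset.sum_congr rfl fun z _ => by ring

theorem wordPairing_mul (w : List GaussLetter) (a b : ℤ) (u v : GaussLetter → ℤ) :
    wordPairing w (fun z => a * u z) (fun z => b * v z) = a * b * wordPairing w u v := by
  unfold wordPairing
  rw [Finset.mul_sum]
  exact Finset.sum_congr rfl fun z _ => by ring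

/-! ### Intersection numbers of the cycles of a diagram -/

namespace GaussDiagram

variable (D : GaussDiagram)

theorem word_nodup : D.word.Nodup := D.nodup.of_map

variable {D}

theorem mem_crossings {x : GaussLetter} : x ∈ D.crossings ↔ x ∈ D.word ∧ x.isOver = true := by
  simp [crossings]

theorem pos_eq_iff {x y : GaussLetter} (hx : x ∈ D.word) : D.pos x = D.pos y ↔ x = y :=
  List.idxOf_inj hx

theorem pos_partner_ne {x : GaussLetter} (hx : x ∈ D.word) : D.pos x ≠ D.pos x.partner := by
  rw [Ne, pos_eq_iff hx]
  exact (x.partner_ne).symm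

variable (D)

/-- `1` for crossings of type `0`, `-1` for crossings of type `1`. -/
def turnSign (x : GaussLetter) : ℤ := wordOrder D.word x x.partner

/-- `chordMult` follows the chord from `x` to its partner, backwards if the partner comes first;
`turnSign` restores the direction of the diagram. -/
theorem strandMult_alpha {x : GaussLetter} (hx : x ∈ D.word) (z : GaussLetter) :
    D.strandMult (D.alpha x) z = D.turnSign x * chordMult D.word x z := by
  have h := D.pos_partner_ne hx
  simp only [strandMult, alpha, turnSign, chordMult, wordOrder]
  change _ = (if D.pos x < D.pos x.partner then (1 : ℤ) else
    if D.pos x.partner < D.pos x then -1 else 0) *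
    ((if D.pos x < D.pos z then (1 : ℤ) else if D.pos z < D.pos x then -1 else 0) -
      if D.pos x.partner < D.pos z then (1 : ℤ) else if D.pos z < D.pos x.partner then -1 else 0)
  generalize D.pos x = a at *
  generalize D.pos x.partner = b at *
  generalize D.pos z = c
  rcases lt_or_gt_of_ne h with h1 | h1
  · rw [min_eq_left h1.le, max_eq_right h1.le]
    split_ifs <;> first | rfl | omega
  · rw [min_eq_right h1.le, max_eq_left h1.le]
    split_ifs <;> first | rfl | omega

theorem strandMult_beta (x z : GaussLetter) :
    D.strandMult (D.beta x) z = 2 - D.strandMult (D.alpha x) z := by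
  simp only [strandMult, beta]
  ring

/-- The second half of each local contribution is the term of the under-passage, whose flat sign is
opposite. One sum over all letters thus replaces the antisymmetrized sum over crossings. -/
theorem intersectionNumber_eq (u v : ℕ → ℤ) :
    D.intersectionNumber u v = wordPairing D.word (D.strandMult u) (D.strandMult v) / 4 := by
  unfold intersectionNumber wordPairing
  congr 1
  rw [← Finset.sum_filter_add_sum_filter_not D.word.toFinset (fun x => x.isOver = true)]
  have h1 : D.crossings = D.word.toFinset.filter (fun x => x.isOver = true) := by
    ext x; simp [mem_crossings]
  have h2 : ∑ z ∈ D.word.toFinset.filter (fun x => ¬ x.isOver = true),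
      z.flatSign * (D.strandMult u z * D.strandMult v z.partner) =
      ∑ z ∈ D.word.toFinset.filter (fun x => x.isOver = true),
      -((z.sign : ℤ) * (D.strandMult v z * D.strandMult u z.partner)) := by
    refine Finset.sum_nbij' GaussLetter.partner GaussLetter.partner ?_ ?_ ?_ ?_ ?_
    · intro z hz
      simp only [Finset.mem_filter, List.mem_toFinset] at hz ⊢
      exact ⟨D.partner_mem _ hz.1, by simpa using hz.2⟩
    · intro z hz
      simp only [Finset.mem_filter, List.mem_toFinset] at hz ⊢
      exact ⟨D.partner_mem _ hz.1, by simpa using hz.2⟩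
    · simp
    · simp
    · intro z hz
      simp only [Finset.mem_filter, List.mem_toFinset] at hz
      simp only [GaussLetter.flatSign, hz.2, GaussLetter.partner_sign,
        GaussLetter.partner_partner]
      simp only [Bool.false_eq_true, if_false]
      ring
  rw [h2, ← Finset.sum_add_distrib, h1]
  refine Finset.sum_congr rfl fun z hz => ?_
  simp only [Finset.mem_filter] at hz
  simp only [GaussLetter.flatSign, hz.2, if_true]
  ring

/-- Four times the intersection number of the cycles `α` of two crossings. -/
def link (x y : GaussLetter) : ℤ :=
  D.turnSign x * D.turnSign y * wordPairing D.word (chordMult D.word x) (chordMult D.word y)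

/-- Four times the intersection number of the cycle `α` of a crossing with the diagram. -/
def rot (x : GaussLetter) : ℤ :=
  D.turnSign x * wordPairing D.word (chordMult D.word x) (fun _ => 2)

theorem wordPairing_alpha {x y : GaussLetter} (hx : x ∈ D.word) (hy : y ∈ D.word) :
    wordPairing D.word (D.strandMult (D.alpha x)) (D.strandMult (D.alpha y)) = D.link x y := by
  rw [link, ← wordPairing_mul]
  exact wordPairing_congr D.partner_mem (fun z _ => D.strandMult_alpha hx z)
    (fun z _ => D.strandMult_alpha hy z)

theorem wordPairing_alpha_two {x : GaussLetter} (hx : x ∈ D.word) :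
    wordPairing D.word (D.strandMult (D.alpha x)) (fun _ => 2) = D.rot x := by
  have := wordPairing_mul D.word (D.turnSign x) 1 (chordMult D.word x) (fun _ => 2)
  rw [mul_one] at this
  rw [rot, ← this]
  exact wordPairing_congr D.partner_mem (fun z _ => D.strandMult_alpha hx z)
    (fun z _ => by simp)

theorem intersectionNumber_alpha_alpha {x y : GaussLetter} (hx : x ∈ D.word) (hy : y ∈ D.word) :
    D.intersectionNumber (D.alpha x) (D.alpha y) = D.link x y / 4 := by
  rw [intersectionNumber_eq, wordPairing_alpha D hx hy]

theorem intersectionNumber_alpha_beta {x y : GaussLetter} (hx : x ∈ D.word) (hy : y ∈ D.word) :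
    D.intersectionNumber (D.alpha x) (D.beta y) = (D.rot x - D.link x y) / 4 := by
  rw [intersectionNumber_eq, ← wordPairing_alpha D hx hy, ← wordPairing_alpha_two D hx,
    ← wordPairing_sub_right]
  simp only [← strandMult_beta]

theorem link_self (x : GaussLetter) : D.link x x = 0 := by
  rw [link, wordPairing_self D.partner_mem, mul_zero]

theorem link_swap (x y : GaussLetter) : D.link x y = -D.link y x := by
  rw [link, link, wordPairing_swap D.partner_mem]
  ring

/-- Expand `(D - α_x) · (D - α_y)`, where the multiplicity of `D` is the constant 2 and `D · D = 0`.
The expansion is made before the division by four, so rounding plays no role. -/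
theorem intersectionNumber_beta_beta {x y : GaussLetter} (hx : x ∈ D.word) (hy : y ∈ D.word) :
    D.intersectionNumber (D.beta x) (D.beta y) = (D.rot y - D.rot x + D.link x y) / 4 := by
  rw [intersectionNumber_eq]
  congr 1
  have h1 := wordPairing_sub_left D.word (fun _ => 2) (D.strandMult (D.alpha x))
    (D.strandMult (D.beta y))
  have h2 := wordPairing_sub_right D.word (fun _ => 2) (fun _ => 2) (D.strandMult (D.alpha y))
  have h3 := wordPairing_sub_right D.word (D.strandMult (D.alpha x)) (fun _ => 2)
    (D.strandMult (D.alpha y))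
  simp only [← strandMult_beta] at h1 h2 h3
  have h4 := wordPairing_swap D.partner_mem (fun _ => 2) (D.strandMult (D.alpha y))
  rw [wordPairing_self D.partner_mem] at h2
  rw [wordPairing_alpha_two D hx, wordPairing_alpha D hx hy] at h3
  rw [wordPairing_alpha_two D hy] at h4
  have h5 : wordPairing D.word (D.strandMult (D.beta x)) (D.strandMult (D.beta y)) =
    wordPairing D.word (fun _ => 2) (D.strandMult (D.beta y)) -
      wordPairing D.word (D.strandMult (D.alpha x)) (D.strandMult (D.beta y)) := h1
  have h6 : wordPairing D.word (fun _ => 2) (D.strandMult (D.beta y)) =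
    0 - wordPairing D.word (fun _ => 2) (D.strandMult (D.alpha y)) := h2
  have h7 : wordPairing D.word (D.strandMult (D.alpha x)) (D.strandMult (D.beta y)) =
    D.rot x - D.link x y := h3
  rw [h5, h6, h7, h4]
  ring

theorem mem_word_of_mem_crossingsOfType {D : GaussDiagram} {a : Fin 2} {x : GaussLetter}
    (hx : x ∈ D.crossingsOfType a) : x ∈ D.word :=
  (mem_crossings.1 (Finset.mem_filter.1 hx).1).1

/-! ### The intersection polynomials as sums over pairs -/

open LaurentPolynomial

/-- A sum over pairs of crossings of two types, in which each term depends on the intersection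
numbers of the two crossings. -/
noncomputable def pairSum (φ : ℤ → ℤ → ℤ → ℤ[T;T⁻¹]) (a b : Fin 2) : ℤ[T;T⁻¹] :=
  ∑ x ∈ D.crossingsOfType a, ∑ y ∈ D.crossingsOfType b,
    ((x.sign : ℤ) * (y.sign : ℤ)) • φ (D.rot x) (D.rot y) (D.link x y)

/-- The term of `F`. -/
noncomputable def termF (_ _ m : ℤ) : ℤ[T;T⁻¹] := T (m / 4) - 1

/-- The term of `G`. -/
noncomputable def termG (r _ m : ℤ) : ℤ[T;T⁻¹] := T ((r - m) / 4) - T (r / 4)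

/-- The term of `H`. -/
noncomputable def termH (r s m : ℤ) : ℤ[T;T⁻¹] :=
  T ((s - r + m) / 4) - T (s / 4) - T (-(r / 4)) + 1

theorem F_eq_pairSum (a b : Fin 2) : F a b D = D.pairSum termF a b := by
  refine Finset.sum_congr rfl fun x hx => Finset.sum_congr rfl fun y hy => ?_
  rw [intersectionNumber_alpha_alpha D (mem_word_of_mem_crossingsOfType hx)
    (mem_word_of_mem_crossingsOfType hy)]
  rfl

theorem W_eq (a : Fin 2) : D.W a = ∑ x ∈ D.crossingsOfType a, (x.sign : ℤ) • (T (D.rot x / 4) - 1) := by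
  refine Finset.sum_congr rfl fun x hx => ?_
  have hx := mem_word_of_mem_crossingsOfType hx
  rw [intersectionNumber_alpha_beta D hx hx, link_self, sub_zero]

/-- The product `ω_b W_a` is itself a sum over the same pairs, and its constants `-1` cancel those
of the main sum. -/
theorem G_eq_pairSum (a b : Fin 2) : G a b D = D.pairSum termG a b := by
  rw [G, W_eq, writhe, Finset.sum_smul]
  simp only [Finset.smul_sum]
  rw [Finset.sum_comm (s := D.crossingsOfType b), ← Finset.sum_sub_distrib]
  refine Finset.sum_congr rfl fun x hx => ?_
  rw [← Finset.sum_sub_distrib]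
  refine Finset.sum_congr rfl fun y hy => ?_
  rw [intersectionNumber_alpha_beta D (mem_word_of_mem_crossingsOfType hx)
    (mem_word_of_mem_crossingsOfType hy), smul_smul, mul_comm (y.sign : ℤ), ← smul_sub, termG]
  congr 1
  ring

theorem H_eq_pairSum (a b : Fin 2) : H a b D = D.pairSum termH a b := by
  have h : invert (D.W a) =
      ∑ x ∈ D.crossingsOfType a, (x.sign : ℤ) • (T (-(D.rot x / 4)) - 1) := by
    rw [W_eq, map_sum]
    refine Finset.sum_congr rfl fun x _ => ?_
    rw [map_zsmul, map_sub, map_one, invert_T]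
  rw [H, h, W_eq, writhe, writhe, Finset.sum_smul, Finset.sum_smul]
  simp only [Finset.smul_sum]
  rw [Finset.sum_comm (s := D.crossingsOfType b), ← Finset.sum_sub_distrib,
    ← Finset.sum_sub_distrib]
  refine Finset.sum_congr rfl fun x hx => ?_
  rw [← Finset.sum_sub_distrib, ← Finset.sum_sub_distrib]
  refine Finset.sum_congr rfl fun y hy => ?_
  rw [intersectionNumber_beta_beta D (mem_word_of_mem_crossingsOfType hx)
    (mem_word_of_mem_crossingsOfType hy), smul_smul, smul_smul, mul_comm (y.sign : ℤ), ← smul_sub,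
    ← smul_sub, termH]
  congr 1
  ring

end GaussDiagram

/-! ### Words with inserted letters -/

theorem idxOf_lt_idxOf_iff_of_sublist {w w' : List GaussLetter} (h : w.Sublist w')
    (hn : w'.Nodup) {x y : GaussLetter} (hx : x ∈ w) (hy : y ∈ w) :
    w.idxOf x < w.idxOf y ↔ w'.idxOf x < w'.idxOf y := by
  induction h with
  | slnil => simp at hx
  | cons a h ih =>
    have hn' := List.nodup_cons.1 hn
    have hxa : x ≠ a := fun e => hn'.1 (e ▸ h.subset hx)
    have hya : y ≠ a := fun e => hn'.1 (e ▸ h.subset hy)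
    rw [List.idxOf_cons_ne _ hxa.symm, List.idxOf_cons_ne _ hya.symm, ih hn'.2 hx hy]
    omega
  | cons_cons a h ih =>
    have hn' := List.nodup_cons.1 hn
    by_cases hxa : x = a
    · subst hxa
      by_cases hya : y = x
      · simp [hya]
      · rw [List.idxOf_cons_ne _ (Ne.symm hya), List.idxOf_cons_ne _ (Ne.symm hya)]
        simp
    · by_cases hya : y = a
      · subst hya
        simp
      · rw [List.idxOf_cons_ne _ (Ne.symm hya), List.idxOf_cons_ne _ (Ne.symm hya),
          List.idxOf_cons_ne _ (Ne.symm hxa), List.idxOf_cons_ne _ (Ne.symm hxa)]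
        have := ih hn'.2 (by simpa [hxa] using hx) (by simpa [hya] using hy)
        omega

theorem wordOrder_of_sublist {w w' : List GaussLetter} (h : w.Sublist w')
    (hn : w'.Nodup) {x y : GaussLetter} (hx : x ∈ w) (hy : y ∈ w) :
    wordOrder w' x y = wordOrder w x y := by
  simp only [wordOrder, idxOf_lt_idxOf_iff_of_sublist h hn hx hy,
    idxOf_lt_idxOf_iff_of_sublist h hn hy hx]

/-- The letters `x` and `y` are neighbours in the word, in one of the two orders. -/
def Neighbours (w : List GaussLetter) (x y : GaussLetter) : Prop :=
  ∃ A B, w = A ++ [x, y] ++ B ∨ w = A ++ [y, x] ++ B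

theorem Neighbours.symm {w : List GaussLetter} {x y : GaussLetter} (h : Neighbours w x y) :
    Neighbours w y x := by
  obtain ⟨A, B, h⟩ := h
  exact ⟨A, B, h.symm⟩

theorem idxOf_pair {A B : List GaussLetter} {x y : GaussLetter}
    (hn : (A ++ [x, y] ++ B).Nodup) :
    (A ++ [x, y] ++ B).idxOf x = A.length ∧ (A ++ [x, y] ++ B).idxOf y = A.length + 1 := by
  have hx : x ∉ A := by
    intro h
    simp [List.nodup_append] at hn
    exact (hn.2.2 x h).1 rfl
  have hy : y ∉ A := by
    intro h
    simp [List.nodup_append] at hn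
    exact (hn.2.2 y h).2.1 rfl
  have hxy : x ≠ y := by
    intro h
    simp [List.nodup_append, h] at hn
  rw [List.append_assoc]
  constructor
  · rw [List.idxOf_append_of_notMem hx]
    simp
  · rw [List.idxOf_append_of_notMem hy]
    simp [List.idxOf_cons_ne _ hxy]

theorem Neighbours.wordOrder_eq {w : List GaussLetter} {x y u : GaussLetter}
    (h : Neighbours w x y) (hn : w.Nodup) (hx : u ≠ x) (hy : u ≠ y) :
    wordOrder w u x = wordOrder w u y := by
  have key : ∀ {A B : List GaussLetter} {x y : GaussLetter}, w = A ++ [x, y] ++ B → u ≠ x → u ≠ y →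
      wordOrder w u x = wordOrder w u y := by
    intro A B x y hw hx hy
    obtain ⟨h1, h2⟩ := idxOf_pair (hw ▸ hn)
    rw [← hw] at h1 h2
    have h3 : w.idxOf x ≠ w.idxOf u := fun e => hx ((List.idxOf_inj (by simp [hw])).1 e).symm
    have h4 : w.idxOf y ≠ w.idxOf u := fun e => hy ((List.idxOf_inj (by simp [hw])).1 e).symm
    unfold wordOrder
    split_ifs <;> first | rfl | omega
  obtain ⟨A, B, h | h⟩ := h
  · exact key h hx hy
  · exact (key h hy hx).symm

theorem chordMult_eq_of_neighbours {w : List GaussLetter} {x y u : GaussLetter}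
    (h : Neighbours w x y) (hn : w.Nodup) (h1 : u ≠ x) (h2 : u ≠ y) (h3 : u.partner ≠ x)
    (h4 : u.partner ≠ y) : chordMult w u x = chordMult w u y := by
  rw [chordMult, chordMult, h.wordOrder_eq hn h1 h2, h.wordOrder_eq hn h3 h4]

/-! ### Invariance under insertion of kinks and bigons -/

namespace GaussDiagram

/-- The value of `turnSign` on crossings of a given type. -/
def typeSign (a : Fin 2) : ℤ := if a = 0 then 1 else -1

theorem mem_crossingsOfType {D : GaussDiagram} {a : Fin 2} {x : GaussLetter} :
    x ∈ D.crossingsOfType a ↔ x ∈ D.crossings ∧ D.turnSign x = typeSign a := by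
  rw [crossingsOfType, Finset.mem_filter]
  refine and_congr_right fun hx => ?_
  have h := D.pos_partner_ne (mem_crossings.1 hx).1
  have h' : D.turnSign x = if D.pos x < D.pos x.partner then 1 else
    if D.pos x.partner < D.pos x then -1 else 0 := rfl
  rw [h']
  unfold typeSign
  fin_cases a <;> simp <;> omega

variable (D : GaussDiagram)

/-- The sign of a crossing if it has the given type, otherwise `0`. -/
def signOfType (a : Fin 2) (x : GaussLetter) : ℤ :=
  if D.turnSign x = typeSign a then (x.sign : ℤ) else 0

/-- This is where `a ≠ b` enters the invariance: a crossing is never paired with itself, nor with a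
crossing of the same type. -/
theorem signOfType_mul {a b : Fin 2} (hab : a ≠ b) (x : GaussLetter) :
    D.signOfType a x * D.signOfType b x = 0 := by
  unfold signOfType typeSign
  split_ifs <;> omega

theorem pairSum_eq (φ : ℤ → ℤ → ℤ → ℤ[T;T⁻¹]) (a b : Fin 2) :
    D.pairSum φ a b = ∑ x ∈ D.crossings, ∑ y ∈ D.crossings,
      (D.signOfType a x * D.signOfType b y) • φ (D.rot x) (D.rot y) (D.link x y) := by
  have h : ∀ a, D.crossingsOfType a = D.crossings.filter (fun x => D.turnSign x = typeSign a) := by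
    intro a; ext x; simp [mem_crossingsOfType]
  rw [pairSum, h, h, Finset.sum_filter]
  refine Finset.sum_congr rfl fun x _ => ?_
  split_ifs with hx
  · rw [Finset.sum_filter]
    refine Finset.sum_congr rfl fun y _ => ?_
    split_ifs with hy <;> simp [signOfType, hx, hy]
  · simp [signOfType, hx]

/-- Doubled multiplicities are even except at the two ends of the chord, and the ends carry opposite
flat signs. The divisibility is needed for `H`, where `(-r) / 4` must equal `-(r / 4)`. -/
theorem four_dvd_rot {x : GaussLetter} (hx : x ∈ D.word) : (4 : ℤ) ∣ D.rot x := by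
  have hx' := D.partner_mem x hx
  have hn := x.partner_ne
  have h : (2 : ℤ) ∣ ∑ z ∈ D.word.toFinset, z.flatSign * chordMult D.word x z := by
    -- Adding 1 at both ends of the chord leaves the sum unchanged and makes every factor even.
    have h1 : ∑ z ∈ D.word.toFinset, z.flatSign * chordMult D.word x z =
        ∑ z ∈ D.word.toFinset, z.flatSign * (chordMult D.word x z +
          ((if z = x then 1 else 0) + if z = x.partner then 1 else 0)) := by
      simp only [mul_add, Finset.sum_add_distrib, mul_ite, mul_one, mul_zero,
        Finset.sum_ite_eq', List.mem_toFinset, hx, hx', if_true, GaussLetter.flatSign_partner]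
      ring
    rw [h1]
    refine Finset.dvd_sum fun z hz => Dvd.dvd.mul_left ?_ _
    rw [List.mem_toFinset] at hz
    have h2 : z = x ↔ D.word.idxOf z = D.word.idxOf x := (List.idxOf_inj hz).symm
    have h3 : z = x.partner ↔ D.word.idxOf z = D.word.idxOf x.partner := (List.idxOf_inj hz).symm
    have h4 := D.pos_partner_ne hx
    unfold pos at h4
    simp only [h2, h3, chordMult, wordOrder]
    generalize D.word.idxOf z = c at *
    generalize D.word.idxOf x = a at *
    generalize D.word.idxOf x.partner = b at *
    split_ifs <;> omega
  unfold rot wordPairing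
  obtain ⟨c, hc⟩ := h
  have : ∑ z ∈ D.word.toFinset, z.flatSign * (chordMult D.word x z * 2) = 4 * c := by
    calc _ = 2 * ∑ z ∈ D.word.toFinset, z.flatSign * chordMult D.word x z := by
          rw [Finset.mul_sum]; exact Finset.sum_congr rfl fun z _ => by ring
      _ = _ := by rw [hc]; ring
  rw [this]
  exact ⟨D.turnSign x * c, by ring⟩

variable {D}

section Insertion

variable {D' : GaussDiagram} (hs : D.word.Sublist D'.word)
include hs

theorem chordMult_insertion {x z : GaussLetter} (hx : x ∈ D.word) (hz : z ∈ D.word) :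
    chordMult D'.word x z = chordMult D.word x z := by
  rw [chordMult, chordMult, wordOrder_of_sublist hs D'.word_nodup hx hz,
    wordOrder_of_sublist hs D'.word_nodup (D.partner_mem x hx) hz]

theorem turnSign_insertion {x : GaussLetter} (hx : x ∈ D.word) :
    D'.turnSign x = D.turnSign x :=
  wordOrder_of_sublist hs D'.word_nodup hx (D.partner_mem x hx)

theorem signOfType_insertion {x : GaussLetter} (hx : x ∈ D.word) (a : Fin 2) :
    D'.signOfType a x = D.signOfType a x := by
  rw [signOfType, signOfType, turnSign_insertion hs hx]

theorem rot_insertion {x : GaussLetter} (hx : x ∈ D.word)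
    (h : wordPairing D'.word (chordMult D'.word x) (fun _ => 2) =
      wordPairing D.word (chordMult D'.word x) (fun _ => 2)) :
    D'.rot x = D.rot x := by
  rw [rot, rot, turnSign_insertion hs hx, h]
  congr 1
  exact wordPairing_congr D.partner_mem (fun z hz => chordMult_insertion hs hx hz)
    (fun _ _ => rfl)

theorem link_insertion {x y : GaussLetter} (hx : x ∈ D.word) (hy : y ∈ D.word)
    (h : wordPairing D'.word (chordMult D'.word x) (chordMult D'.word y) =
      wordPairing D.word (chordMult D'.word x) (chordMult D'.word y)) :
    D'.link x y = D.link x y := by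
  rw [link, link, turnSign_insertion hs hx, turnSign_insertion hs hy, h]
  congr 1
  exact wordPairing_congr D.partner_mem (fun z hz => chordMult_insertion hs hx hz)
    (fun z hz => chordMult_insertion hs hy hz)

end Insertion

/-- Invariance under insertion of a kink. -/
theorem pairSum_kink {D' : GaussDiagram} (hs : D.word.Sublist D'.word) {c : GaussLetter}
    (hc : c.isOver = true) (hp : D'.word.Perm (c :: c.partner :: D.word))
    (hnb : Neighbours D'.word c c.partner) {φ : ℤ → ℤ → ℤ → ℤ[T;T⁻¹]} {a b : Fin 2} (hab : a ≠ b)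
    (h1 : ∀ s, φ 0 s 0 = 0) (h2 : ∀ r, (4 : ℤ) ∣ r → φ r 0 0 = 0) :
    D'.pairSum φ a b = D.pairSum φ a b := by
  have hn := hp.nodup_iff.1 D'.word_nodup
  obtain ⟨hn1, hn2⟩ := List.nodup_cons.1 hn
  obtain ⟨hn3, hn4⟩ := List.nodup_cons.1 hn2
  simp only [List.mem_cons, not_or] at hn1
  -- The new crossing is invisible to functions that agree on its two passages.
  have hpair : ∀ u v : GaussLetter → ℤ, u c = u c.partner → v c = v c.partner →
      wordPairing D'.word u v = wordPairing D.word u v := by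
    intro u v hu hv
    unfold wordPairing
    rw [List.toFinset_eq_of_perm _ _ hp, List.toFinset_cons, List.toFinset_cons,
      Finset.sum_insert (by simp [hn1]), Finset.sum_insert (by simp [hn3])]
    simp only [GaussLetter.flatSign_partner, GaussLetter.partner_partner, hu, hv]
    ring
  have hne : ∀ x ∈ D.word, x ≠ c ∧ x ≠ c.partner := by
    intro x hx
    exact ⟨fun e => hn1.2 (e ▸ hx), fun e => hn3 (e ▸ hx)⟩
  have hold : ∀ x ∈ D.word, chordMult D'.word x c = chordMult D'.word x c.partner := by
    intro x hx
    have hx' := hne _ (D.partner_mem x hx)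
    exact chordMult_eq_of_neighbours hnb D'.word_nodup (hne x hx).1 (hne x hx).2 hx'.1 hx'.2
  have hnew : chordMult D'.word c c = chordMult D'.word c c.partner := by
    rw [chordMult, chordMult, wordOrder_self, wordOrder_self, wordOrder_swap _ c.partner c]
    ring
  have hnew0 : ∀ z ∈ D.word, chordMult D'.word c z = 0 := by
    intro z hz
    rw [chordMult, wordOrder_swap, wordOrder_swap _ c.partner,
      hnb.wordOrder_eq D'.word_nodup (hne z hz).1 (hne z hz).2]
    ring
  -- The small loop of the kink meets nothing: its multiplicity vanishes on old letters, and its two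
  -- ends cancel.
  have hz : ∀ v, v c = v c.partner → wordPairing D'.word (chordMult D'.word c) v = 0 := by
    intro v hv
    rw [hpair _ _ hnew hv]
    refine Finset.sum_eq_zero fun z hz => ?_
    rw [hnew0 z (by simpa using hz)]
    ring
  have hrotc : D'.rot c = 0 := by rw [rot, hz _ rfl, mul_zero]
  have hlinkc : ∀ y ∈ D.word, D'.link c y = 0 := by
    intro y hy
    rw [link, hz _ (hold y hy), mul_zero]
  have hcr : D'.crossings = insert c D.crossings := by
    ext x
    simp only [mem_crossings, hp.mem_iff, List.mem_cons, Finset.mem_insert]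
    constructor
    · rintro ⟨rfl | rfl | h, h'⟩
      · exact Or.inl rfl
      · simp [hc] at h'
      · exact Or.inr ⟨h, h'⟩
    · rintro (rfl | ⟨h, h'⟩)
      · exact ⟨Or.inl rfl, hc⟩
      · exact ⟨Or.inr (Or.inr h), h'⟩
  have hcn : c ∉ D.crossings := fun h => hn1.2 (mem_crossings.1 h).1
  -- The pair `(c, c)` drops out because the types differ; the row and the column of `c` vanish by
  -- the two hypotheses on `φ`.
  rw [pairSum_eq, pairSum_eq, hcr, Finset.sum_insert hcn, Finset.sum_insert hcn, signOfType_mul _ hab,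
    zero_smul, zero_add, Finset.sum_eq_zero, zero_add]
  · refine Finset.sum_congr rfl fun x hx => ?_
    have hx := (mem_crossings.1 hx).1
    rw [Finset.sum_insert hcn, hrotc, link_swap, hlinkc x hx, neg_zero,
      h2 _ (D'.four_dvd_rot (hs.subset hx)), smul_zero, zero_add]
    refine Finset.sum_congr rfl fun y hy => ?_
    have hy := (mem_crossings.1 hy).1
    rw [signOfType_insertion hs hx, signOfType_insertion hs hy,
      rot_insertion hs hx (hpair _ _ (hold x hx) rfl),
      rot_insertion hs hy (hpair _ _ (hold y hy) rfl),
      link_insertion hs hx hy (hpair _ _ (hold x hx) (hold y hy))]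
  · intro y hy
    have hy := (mem_crossings.1 hy).1
    rw [hrotc, hlinkc y hy, h1, smul_zero]

/-- Invariance under insertion of a bigon. -/
theorem pairSum_bigon {D' : GaussDiagram} (hs : D.word.Sublist D'.word) {x₁ x₂ : GaussLetter}
    (ho₁ : x₁.isOver = true) (ho₂ : x₂.isOver = true) (hsgn : x₂.sign = -x₁.sign)
    (hp : D'.word.Perm (x₁ :: x₂ :: x₁.partner :: x₂.partner :: D.word))
    (hnb : Neighbours D'.word x₁ x₂) (hnb' : Neighbours D'.word x₁.partner x₂.partner)
    {φ : ℤ → ℤ → ℤ → ℤ[T;T⁻¹]} {a b : Fin 2} (hab : a ≠ b) :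
    D'.pairSum φ a b = D.pairSum φ a b := by
  have hN := D'.word_nodup
  have hn := hp.nodup_iff.1 hN
  simp only [List.nodup_cons, List.mem_cons, not_or] at hn
  obtain ⟨⟨h12, h11', h12', h1D⟩, ⟨h21', h22', h2D⟩, ⟨h1'2', h1'D⟩, h2'D, -⟩ := hn
  have hfl : x₂.flatSign = -x₁.flatSign := by
    simp [GaussLetter.flatSign, ho₁, ho₂, hsgn]
  have hpair : ∀ u v : GaussLetter → ℤ, wordPairing D'.word u v = wordPairing D.word u v +
      x₁.flatSign * (u x₁ * v x₁.partner - u x₁.partner * v x₁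
        - u x₂ * v x₂.partner + u x₂.partner * v x₂) := by
    intro u v
    unfold wordPairing
    rw [List.toFinset_eq_of_perm _ _ hp, List.toFinset_cons, List.toFinset_cons,
      List.toFinset_cons, List.toFinset_cons, Finset.sum_insert (by simp [*]),
      Finset.sum_insert (by simp [*]), Finset.sum_insert (by simp [*]),
      Finset.sum_insert (by simp [*])]
    simp only [GaussLetter.flatSign_partner, GaussLetter.partner_partner, hfl]
    ring
  have hpair0 : ∀ u v : GaussLetter → ℤ, u x₁ = u x₂ → u x₁.partner = u x₂.partner →
      v x₁ = v x₂ → v x₁.partner = v x₂.partner →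
      wordPairing D'.word u v = wordPairing D.word u v := by
    intro u v h1 h2 h3 h4
    rw [hpair, h1, h2, h3, h4]
    ring
  have hne : ∀ x ∈ D.word, x ≠ x₁ ∧ x ≠ x₂ ∧ x ≠ x₁.partner ∧ x ≠ x₂.partner := by
    intro x hx
    exact ⟨fun e => h1D (e ▸ hx), fun e => h2D (e ▸ hx), fun e => h1'D (e ▸ hx),
      fun e => h2'D (e ▸ hx)⟩
  have hold : ∀ x ∈ D.word, chordMult D'.word x x₁ = chordMult D'.word x x₂ := by
    intro x hx
    have h := hne x hx
    have h' := hne _ (D.partner_mem x hx)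
    exact chordMult_eq_of_neighbours hnb hN h.1 h.2.1 h'.1 h'.2.1
  have hold' : ∀ x ∈ D.word,
      chordMult D'.word x x₁.partner = chordMult D'.word x x₂.partner := by
    intro x hx
    have h := hne x hx
    have h' := hne _ (D.partner_mem x hx)
    exact chordMult_eq_of_neighbours hnb' hN h.2.2.1 h.2.2.2 h'.2.2.1 h'.2.2.2
  have e1 : wordOrder D'.word x₁ x₁.partner = wordOrder D'.word x₁ x₂.partner :=
    hnb'.wordOrder_eq hN h11' h12'
  have e2 : wordOrder D'.word x₂ x₁.partner = wordOrder D'.word x₂ x₂.partner :=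
    hnb'.wordOrder_eq hN h21' h22'
  have e3 : wordOrder D'.word x₁.partner x₁ = wordOrder D'.word x₁.partner x₂ :=
    hnb.wordOrder_eq hN (Ne.symm h11') (Ne.symm h21')
  have e4 : wordOrder D'.word x₂.partner x₁ = wordOrder D'.word x₂.partner x₂ :=
    hnb.wordOrder_eq hN (Ne.symm h12') (Ne.symm h22')
  -- No letter lies between two neighbours, so both crossings are passed in the same over-under
  -- order.
  have hts : D'.turnSign x₂ = D'.turnSign x₁ := by
    rw [turnSign, turnSign, e1, wordOrder_swap, ← e4, wordOrder_swap _ x₂.partner, neg_neg]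
  have hsig : ∀ a, D'.signOfType a x₂ = -D'.signOfType a x₁ := by
    intro a
    rw [signOfType, signOfType, hts, hsgn]
    split_ifs <;> simp
  have s1 := wordOrder_swap D'.word x₁ x₁.partner
  have s2 := wordOrder_swap D'.word x₁ x₂.partner
  have s3 := wordOrder_swap D'.word x₂ x₁.partner
  have s4 := wordOrder_swap D'.word x₂ x₂.partner
  have s5 := wordOrder_swap D'.word x₁ x₂
  have s6 := wordOrder_swap D'.word x₁.partner x₂.partner
  -- The two cycles differ only along the sides of the bigon. The difference vanishes on old letters
  -- and agrees on each pair of neighbours, so the opposite signs of the crossings cancel its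
  -- pairing with `v`.
  have hdiff : ∀ v : GaussLetter → ℤ, v x₁ = v x₂ → v x₁.partner = v x₂.partner →
      wordPairing D'.word (chordMult D'.word x₂) v =
        wordPairing D'.word (chordMult D'.word x₁) v := by
    intro v hv hv'
    rw [← sub_eq_zero, ← wordPairing_sub_left, hpair]
    have h0 : wordPairing D.word
        (fun z => chordMult D'.word x₂ z - chordMult D'.word x₁ z) v = 0 := by
      refine Finset.sum_eq_zero fun z hz => ?_
      have hz := hne z (by simpa using hz)
      have t1 := hnb.wordOrder_eq hN hz.1 hz.2.1
      have t2 := hnb'.wordOrder_eq hN hz.2.2.1 hz.2.2.2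
      have t3 : chordMult D'.word x₂ z - chordMult D'.word x₁ z = 0 := by
        rw [chordMult, chordMult, wordOrder_swap _ x₂ z, wordOrder_swap _ x₁ z,
          wordOrder_swap _ x₁.partner z, wordOrder_swap _ x₂.partner z]
        omega
      simp only [t3]
      ring
    have d1 : chordMult D'.word x₂ x₁ - chordMult D'.word x₁ x₁ =
        chordMult D'.word x₂ x₂ - chordMult D'.word x₁ x₂ := by
      simp only [chordMult, wordOrder_self]
      omega
    have d2 : chordMult D'.word x₂ x₁.partner - chordMult D'.word x₁ x₁.partner =
        chordMult D'.word x₂ x₂.partner - chordMult D'.word x₁ x₂.partner := by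
      simp only [chordMult, wordOrder_self]
      omega
    rw [h0, d1, d2, hv, hv']
    ring
  have hrot : D'.rot x₂ = D'.rot x₁ := by
    rw [rot, rot, hts, hdiff _ rfl rfl]
  have hlink : ∀ y ∈ D.word, D'.link x₂ y = D'.link x₁ y := by
    intro y hy
    rw [link, link, hts, hdiff _ (hold y hy) (hold' y hy)]
  have hcr : D'.crossings = insert x₁ (insert x₂ D.crossings) := by
    ext x
    simp only [mem_crossings, hp.mem_iff, List.mem_cons, Finset.mem_insert]
    constructor
    · rintro ⟨rfl | rfl | rfl | rfl | h, h'⟩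
      · exact Or.inl rfl
      · exact Or.inr (Or.inl rfl)
      · simp [ho₁] at h'
      · simp [ho₂] at h'
      · exact Or.inr (Or.inr ⟨h, h'⟩)
    · rintro (rfl | rfl | ⟨h, h'⟩)
      · exact ⟨Or.inl rfl, ho₁⟩
      · exact ⟨Or.inr (Or.inl rfl), ho₂⟩
      · exact ⟨Or.inr (Or.inr (Or.inr (Or.inr h))), h'⟩
  have hc2 : x₂ ∉ D.crossings := fun h => h2D (mem_crossings.1 h).1
  have hc1 : x₁ ∉ insert x₂ D.crossings := by
    simp only [Finset.mem_insert, not_or]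
    exact ⟨h12, fun h => h1D (mem_crossings.1 h).1⟩
  have h0 := D'.signOfType_mul hab x₁
  -- The rows of the two new crossings cancel; the four pairs of new crossings vanish because `a ≠
  -- b`.
  have hrow : ∑ y ∈ D.crossings, (D'.signOfType a x₂ * D'.signOfType b y) •
      φ (D'.rot x₂) (D'.rot y) (D'.link x₂ y) = -∑ y ∈ D.crossings,
      (D'.signOfType a x₁ * D'.signOfType b y) • φ (D'.rot x₁) (D'.rot y) (D'.link x₁ y) := by
    rw [← Finset.sum_neg_distrib]
    refine Finset.sum_congr rfl fun y hy => ?_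
    rw [hsig, hrot, hlink y (mem_crossings.1 hy).1, neg_mul, neg_smul]
  rw [pairSum_eq, pairSum_eq, hcr]
  simp only [Finset.sum_insert hc1, Finset.sum_insert hc2]
  rw [hrow]
  simp only [hsig, mul_neg, neg_mul, h0, zero_smul, neg_zero, zero_add]
  rw [← add_assoc, add_neg_cancel, zero_add]
  refine Finset.sum_congr rfl fun x hx => ?_
  have hx := (mem_crossings.1 hx).1
  rw [hrot, link_swap D' x x₂, hlink x hx, ← link_swap D' x x₁, neg_smul, ← add_assoc,
    add_neg_cancel, zero_add]
  refine Finset.sum_congr rfl fun y hy => ?_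
  have hy := (mem_crossings.1 hy).1
  rw [signOfType_insertion hs hx, signOfType_insertion hs hy,
    rot_insertion hs hx (hpair0 _ _ (hold x hx) (hold' x hx) rfl rfl),
    rot_insertion hs hy (hpair0 _ _ (hold y hy) (hold' y hy) rfl rfl),
    link_insertion hs hx hy (hpair0 _ _ (hold x hx) (hold' x hx) (hold y hy) (hold' y hy))]

end GaussDiagram

/-! ### Renaming -/

theorem idxOf_map_of_injective {g : GaussLetter → GaussLetter} (hg : Function.Injective g)
    (w : List GaussLetter) (x : GaussLetter) : (w.map g).idxOf (g x) = w.idxOf x := by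
  induction w with
  | nil => rfl
  | cons a w ih =>
    by_cases h : a = x
    · simp [h]
    · rw [List.map_cons, List.idxOf_cons_ne _ h, List.idxOf_cons_ne _ (fun e => h (hg e)), ih]

/-! ### Exchange of neighbouring letters -/

/-- The change of `wordOrder` under exchange of two neighbouring letters `x`, `y`, whose order
is `e`. -/
def swapTerm (e : ℤ) (x y u v : GaussLetter) : ℤ :=
  if u = x ∧ v = y then -2 * e else if u = y ∧ v = x then 2 * e else 0

theorem idxOf_exchange {A B : List GaussLetter} {x y u : GaussLetter} (hx : u ≠ x) (hy : u ≠ y) :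
    (A ++ [x, y] ++ B).idxOf u = (A ++ [y, x] ++ B).idxOf u := by
  rw [List.append_assoc, List.append_assoc]
  by_cases h : u ∈ A
  · rw [List.idxOf_append_of_mem h, List.idxOf_append_of_mem h]
  · rw [List.idxOf_append_of_notMem h, List.idxOf_append_of_notMem h]
    simp [List.idxOf_cons_ne _ hx.symm, List.idxOf_cons_ne _ hy.symm]

theorem wordOrder_exchange {A B : List GaussLetter} {x y : GaussLetter}
    (hn : (A ++ [x, y] ++ B).Nodup) (u v : GaussLetter) :
    wordOrder (A ++ [y, x] ++ B) u v =
      wordOrder (A ++ [x, y] ++ B) u v + swapTerm 1 x y u v := by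
  have hn' : (A ++ [y, x] ++ B).Nodup := by
    refine (List.Perm.nodup_iff ?_).1 hn
    exact ((List.Perm.swap y x []).append_left A).append_right B
  obtain ⟨h1, h2⟩ := idxOf_pair hn
  obtain ⟨h3, h4⟩ := idxOf_pair hn'
  have hxy : x ≠ y := by rintro rfl; omega
  have key : ∀ u, u ≠ x → u ≠ y → (A ++ [x, y] ++ B).idxOf u = (A ++ [y, x] ++ B).idxOf u ∧
      (A ++ [x, y] ++ B).idxOf u ≠ A.length ∧ (A ++ [x, y] ++ B).idxOf u ≠ A.length + 1 := by
    intro u hx hy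
    refine ⟨idxOf_exchange hx hy, ?_, ?_⟩
    · rw [← h1]; exact fun e => hx ((List.idxOf_inj (by simp)).1 e.symm).symm
    · rw [← h2]; exact fun e => hy ((List.idxOf_inj (by simp)).1 e.symm).symm
  unfold wordOrder swapTerm
  by_cases hux : u = x
  · subst hux
    by_cases hvy : v = y
    · subst hvy
      rw [h1, h2, h3, h4]
      simp
    · by_cases hvu : v = u
      · subst hvu; simp [hxy]
      · obtain ⟨k1, k2, k3⟩ := key v hvu hvy
        rw [h1, h4, ← k1]
        simp only [hvy, hxy, and_false, false_and, if_false, add_zero]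
        split_ifs <;> first | rfl | omega
  · by_cases huy : u = y
    · subst huy
      by_cases hvx : v = x
      · subst hvx
        rw [h1, h2, h3, h4]
        simp [hux]
      · by_cases hvu : v = u
        · subst hvu; simp [hux]
        · obtain ⟨k1, k2, k3⟩ := key v hvx hvu
          rw [h2, h3, ← k1]
          simp only [hvx, hux, and_false, false_and, if_false, add_zero]
          split_ifs <;> first | rfl | omega
    · obtain ⟨k1, k2, k3⟩ := key u hux huy
      simp only [hux, huy, false_and, if_false, add_zero]
      rw [← k1]
      by_cases hvx : v = x
      · subst hvx
        rw [h1, h4]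
        split_ifs <;> first | rfl | omega
      · by_cases hvy : v = y
        · subst hvy
          rw [h2, h3]
          split_ifs <;> first | rfl | omega
        · rw [(key v hvx hvy).1]

theorem wordOrder_orderedPair_neg {A B : List GaussLetter} {x y : GaussLetter} {e : ℤˣ}
    (hn : (A ++ orderedPair e x y ++ B).Nodup) (u v : GaussLetter) :
    wordOrder (A ++ orderedPair (-e) x y ++ B) u v =
      wordOrder (A ++ orderedPair e x y ++ B) u v + swapTerm e x y u v := by
  rcases Int.units_eq_one_or e with rfl | rfl
  · exact wordOrder_exchange hn u v
  · have h := wordOrder_exchange (A := A) (B := B) (x := y) (y := x) hn u v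
    refine h.trans ?_
    congr 1
    have hxy : x ≠ y := by
      rintro rfl
      simp [orderedPair, List.nodup_append] at hn
    unfold swapTerm
    split_ifs with h1 h2 h2
    · exact absurd (h1.1.symm.trans h2.1) (Ne.symm hxy)
    · simp
    · simp
    · rfl

theorem orderedPair_perm (e : ℤˣ) (x y : GaussLetter) : (orderedPair e x y).Perm [x, y] := by
  unfold orderedPair
  split_ifs
  · exact List.Perm.refl _
  · exact List.Perm.swap x y []

theorem orderedPair_perm_neg (e : ℤˣ) (x y : GaussLetter) :
    (orderedPair (-e) x y).Perm (orderedPair e x y) :=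
  (orderedPair_perm _ _ _).trans (orderedPair_perm _ _ _).symm

theorem neighbours_orderedPair (A B : List GaussLetter) (e : ℤˣ) (x y : GaussLetter) :
    Neighbours (A ++ orderedPair e x y ++ B) x y := by
  refine ⟨A, B, ?_⟩
  unfold orderedPair
  split_ifs <;> simp

theorem wordOrder_orderedPair {A B : List GaussLetter} {e : ℤˣ} {x y : GaussLetter}
    (hn : (A ++ orderedPair e x y ++ B).Nodup) :
    wordOrder (A ++ orderedPair e x y ++ B) x y = e := by
  rcases Int.units_eq_one_or e with rfl | rfl
  · obtain ⟨h1, h2⟩ := idxOf_pair (x := x) (y := y) hn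
    simp only [orderedPair, if_true] at *
    simp [wordOrder, h1, h2, -List.append_assoc]
  · obtain ⟨h1, h2⟩ := idxOf_pair (x := y) (y := x) hn
    have e0 : orderedPair (-1) x y = [y, x] := rfl
    rw [e0]
    unfold wordOrder
    rw [h1, h2]
    simp

theorem wordPairing_single {w : List GaussLetter} {p : GaussLetter} (hp : p ∈ w) (c : ℤ)
    (v : GaussLetter → ℤ) : wordPairing w (fun z => if z = p then c else 0) v =
      p.flatSign * (c * v p.partner) := by
  unfold wordPairing
  simp only [ite_mul, zero_mul, mul_ite, mul_zero]
  rw [Finset.sum_ite_eq', if_pos (by simpa using hp)]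

/-! ### Invariance under renaming and under the third move -/

namespace GaussDiagram

variable {D D' : GaussDiagram}

theorem pairSum_relabel {f : Equiv.Perm ℕ} (h : D'.word = D.word.map (GaussLetter.relabel f))
    (φ : ℤ → ℤ → ℤ → ℤ[T;T⁻¹]) (a b : Fin 2) : D'.pairSum φ a b = D.pairSum φ a b := by
  set g := GaussLetter.relabel f with hg
  have hgi : Function.Injective g := by
    intro x y hxy
    have h1 := congrArg GaussLetter.label hxy
    have h2 := congrArg GaussLetter.isOver hxy
    have h3 := congrArg GaussLetter.sign hxy
    simp only [hg, GaussLetter.relabel, EmbeddingLike.apply_eq_iff_eq] at h1 h2 h3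
    ext1 <;> assumption
  have hgp : ∀ x, (g x).partner = g x.partner := fun x => rfl
  have hgf : ∀ x, (g x).flatSign = x.flatSign := fun x => rfl
  have ho : ∀ x y, wordOrder D'.word (g x) (g y) = wordOrder D.word x y := by
    intro x y
    simp only [wordOrder, h, idxOf_map_of_injective hgi]
  have hc : ∀ x y, chordMult D'.word (g x) (g y) = chordMult D.word x y := by
    intro x y
    simp only [chordMult, hgp, ho]
  have hp : ∀ u v, wordPairing D'.word u v = wordPairing D.word (u ∘ g) (v ∘ g) := by
    intro u v
    unfold wordPairing
    have : D'.word.toFinset = D.word.toFinset.image g := by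
      ext x; simp [h]
    rw [this, Finset.sum_image (fun x _ y _ e => hgi e)]
    rfl
  have hcr : D'.crossings = D.crossings.image g := by
    ext x
    simp only [mem_crossings, Finset.mem_image, h, List.mem_map]
    constructor
    · rintro ⟨⟨y, hy, rfl⟩, hx⟩
      exact ⟨y, ⟨hy, hx⟩, rfl⟩
    · rintro ⟨y, ⟨hy, hx⟩, rfl⟩
      exact ⟨⟨y, hy, rfl⟩, hx⟩
  have ht : ∀ x, D'.turnSign (g x) = D.turnSign x := fun x => ho x x.partner
  rw [pairSum_eq, pairSum_eq, hcr, Finset.sum_image (fun x _ y _ e => hgi e)]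
  refine Finset.sum_congr rfl fun x _ => ?_
  rw [Finset.sum_image (fun x _ y _ e => hgi e)]
  refine Finset.sum_congr rfl fun y _ => ?_
  have hcc : ∀ x, chordMult D'.word (g x) ∘ g = chordMult D.word x := by
    intro x; funext z; exact hc x z
  simp only [signOfType, rot, link, ht, hp, hcc]
  rfl

/-- Invariance under the third Reidemeister move. -/
theorem pairSum_triangle {x₁ x₂ x₃ : GaussLetter} (hperm : D'.word.Perm D.word)
    (ho₁ : x₁.isOver = true) (ho₂ : x₂.isOver = true) (ho₃ : x₃.isOver = true)
    (h12 : x₁ ≠ x₂) (h13 : x₁ ≠ x₃) (h23 : x₂ ≠ x₃)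
    (hm₁ : x₁ ∈ D.word) (hm₂ : x₂ ∈ D.word) (hm₃ : x₃ ∈ D.word)
    {k s₁ s₂ s₃ : ℤ} (hs₂ : s₂ * s₂ = 1) (hs₃ : s₃ * s₃ = 1)
    (hf₁ : x₁.flatSign = s₁) (hf₂ : x₂.flatSign = s₂) (hf₃ : x₃.flatSign = s₃)
    (hn₀ : Neighbours D.word x₁ x₂) (hn₁ : Neighbours D.word x₁.partner x₃)
    (hn₂ : Neighbours D.word x₂.partner x₃.partner)
    (he₀ : wordOrder D.word x₁ x₂ = k * s₂) (he₁ : wordOrder D.word x₁.partner x₃ = k * s₃)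
    (he₂ : wordOrder D.word x₂.partner x₃.partner = k * s₁ * s₂ * s₃)
    (hord : ∀ u v, wordOrder D'.word u v = wordOrder D.word u v +
      (swapTerm (k * s₂) x₁ x₂ u v + swapTerm (k * s₃) x₁.partner x₃ u v +
        swapTerm (k * s₁ * s₂ * s₃) x₂.partner x₃.partner u v))
    (φ : ℤ → ℤ → ℤ → ℤ[T;T⁻¹]) (a b : Fin 2) :
    D'.pairSum φ a b = D.pairSum φ a b := by
  have hN := D.word_nodup
  have hop : ∀ {x y : GaussLetter}, x.isOver = true → y.isOver = true → x ≠ y.partner := by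
    rintro x y hx hy rfl
    simp [hy] at hx
  have q11 := hop ho₁ ho₁
  have q12 := hop ho₁ ho₂
  have q13 := hop ho₁ ho₃
  have q21 := hop ho₂ ho₁
  have q22 := hop ho₂ ho₂
  have q23 := hop ho₂ ho₃
  have q31 := hop ho₃ ho₁
  have q32 := hop ho₃ ho₂
  have q33 := hop ho₃ ho₃
  have hpp : ∀ {x y : GaussLetter}, x.partner = y.partner ↔ x = y :=
    GaussLetter.partner_injective.eq_iff
  -- The change of the chord multiplicity under the move; it lives on the six passages of the
  -- triangle.
  set δ : GaussLetter → GaussLetter → ℤ := fun x z =>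
    (swapTerm (k * s₂) x₁ x₂ x z + swapTerm (k * s₃) x₁.partner x₃ x z +
        swapTerm (k * s₁ * s₂ * s₃) x₂.partner x₃.partner x z) -
    (swapTerm (k * s₂) x₁ x₂ x.partner z + swapTerm (k * s₃) x₁.partner x₃ x.partner z +
        swapTerm (k * s₁ * s₂ * s₃) x₂.partner x₃.partner x.partner z) with hδ
  have hchord : ∀ x, chordMult D'.word x = fun z => chordMult D.word x z + δ x z := by
    intro x
    funext z
    simp only [chordMult, hord, hδ]
    ring
  have hpair : ∀ u v, wordPairing D'.word u v = wordPairing D.word u v := by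
    intro u v
    unfold wordPairing
    rw [List.toFinset_eq_of_perm _ _ hperm]
  have hδ0 : ∀ x, x.isOver = true → x ≠ x₁ → x ≠ x₂ → x ≠ x₃ → δ x = fun _ => 0 := by
    intro x hx h1 h2 h3
    funext z
    have r1 := hop hx ho₁
    have r2 := hop hx ho₂
    have r3 := hop hx ho₃
    have r1' := (hop ho₁ hx).symm
    have r2' := (hop ho₂ hx).symm
    have r3' := (hop ho₃ hx).symm
    simp [hδ, swapTerm, h1, h2, h3, r1, r2, r3, r1', r2', r3', hpp]
  have hδ1 : δ x₁ = fun z => (if z = x₂ then -2 * (k * s₂) else 0) +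
      (if z = x₃ then 2 * (k * s₃) else 0) := by
    funext z
    simp only [hδ, swapTerm, hpp, h12, h13, q11, q12, q13,
      q21.symm, q31.symm, q11.symm, true_and, false_and, if_false]
    split_ifs <;> simp
  have hδ2 : δ x₂ = fun z => (if z = x₁ then 2 * (k * s₂) else 0) +
      (if z = x₃.partner then 2 * (k * s₁ * s₂ * s₃) else 0) := by
    funext z
    simp only [hδ, swapTerm, hpp, h12.symm, h23, q21, q22, q23,
      q12.symm, q32.symm, q22.symm, true_and, false_and, if_false]
    split_ifs <;> simp
  have hδ3 : δ x₃ = fun z => (if z = x₁.partner then 2 * (k * s₃) else 0) +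
      (if z = x₂.partner then -2 * (k * s₁ * s₂ * s₃) else 0) := by
    funext z
    simp only [hδ, swapTerm, hpp, h13.symm, h23.symm, q31, q32, q33,
      q13.symm, q23.symm, q33.symm, true_and, false_and, if_false]
    split_ifs <;> (simp; try ring)
  have hm₁' := D.partner_mem _ hm₁
  have hm₂' := D.partner_mem _ hm₂
  have hm₃' := D.partner_mem _ hm₃
  -- Pairing with a change sees only the difference of `v` at two neighbouring passages. The signs
  -- in the orders of the strands are what makes the two terms combine into such a difference.
  have hP1 : ∀ v, wordPairing D.word (δ x₁) v = 2 * k * (v x₃.partner - v x₂.partner) := by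
    intro v
    rw [hδ1, wordPairing_add_left, wordPairing_single hm₂, wordPairing_single hm₃, hf₂, hf₃]
    linear_combination (-2 * k * v x₂.partner) * hs₂ + (2 * k * v x₃.partner) * hs₃
  have hP2 : ∀ v, wordPairing D.word (δ x₂) v =
      2 * k * s₁ * s₂ * (v x₁.partner - v x₃) := by
    intro v
    rw [hδ2, wordPairing_add_left, wordPairing_single hm₁, wordPairing_single hm₃', hf₁,
      GaussLetter.flatSign_partner, hf₃, GaussLetter.partner_partner]
    linear_combination (-2 * k * s₁ * s₂ * v x₃) * hs₃
  have hP3 : ∀ v, wordPairing D.word (δ x₃) v = 2 * k * s₁ * s₃ * (v x₂ - v x₁) := by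
    intro v
    rw [hδ3, wordPairing_add_left, wordPairing_single hm₁', wordPairing_single hm₂',
      GaussLetter.flatSign_partner, hf₁, GaussLetter.flatSign_partner, hf₂,
      GaussLetter.partner_partner, GaussLetter.partner_partner]
    linear_combination (2 * k * s₁ * s₃ * v x₂) * hs₂
  have hturn : ∀ x, x.isOver = true → D'.turnSign x = D.turnSign x := by
    intro x hx
    have r : ∀ y : GaussLetter, y.isOver = true → x.partner ≠ y :=
      fun y hy => (hop hy hx).symm
    have r' : ∀ y : GaussLetter, y.isOver = true → x ≠ y.partner := fun y hy => hop hx hy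
    have r3 : ¬(x = x₃ ∧ x = x₁) := fun h => h13 (h.2.symm.trans h.1)
    rw [turnSign, hord, turnSign]
    simp [hpp, r3, r' _ ho₃, swapTerm, r _ ho₁, r _ ho₂, r _ ho₃, r' _ ho₁, r' _ ho₂]
  have hsplit : ∀ x y, wordPairing D'.word (chordMult D'.word x) (chordMult D'.word y) =
      wordPairing D.word (chordMult D.word x) (chordMult D.word y) +
      (wordPairing D.word (δ x) (chordMult D.word y) -
        wordPairing D.word (δ y) (chordMult D.word x) + wordPairing D.word (δ x) (δ y)) := by
    intro x y
    rw [hpair, hchord, hchord, wordPairing_add_left, wordPairing_add_right, wordPairing_add_right,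
      wordPairing_swap D.partner_mem (δ y)]
    ring
  have hlink_of : ∀ x y, x.isOver = true → y.isOver = true →
      wordPairing D.word (δ x) (chordMult D.word y) -
        wordPairing D.word (δ y) (chordMult D.word x) + wordPairing D.word (δ x) (δ y) = 0 →
      D'.link x y = D.link x y := by
    intro x y hx hy h
    rw [link, link, hturn x hx, hturn y hy, hsplit, h, add_zero]
  have hzl : ∀ v, wordPairing D.word (fun _ => 0) v = 0 := by
    intro v; simp [wordPairing]
  have hzr : ∀ v, wordPairing D.word v (fun _ => 0) = 0 := by
    intro v; simp [wordPairing]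
  -- A chord with no end in the triangle has equal multiplicities at neighbouring passages.
  have hout : ∀ y, y.isOver = true → y ≠ x₁ → y ≠ x₂ → y ≠ x₃ →
      wordPairing D.word (δ x₁) (chordMult D.word y) = 0 ∧
      wordPairing D.word (δ x₂) (chordMult D.word y) = 0 ∧
      wordPairing D.word (δ x₃) (chordMult D.word y) = 0 := by
    intro y hy h1 h2 h3
    have r : ∀ z : GaussLetter, z.isOver = true → y.partner ≠ z :=
      fun z hz => (hop hz hy).symm
    have r' : ∀ z : GaussLetter, z.isOver = true → y ≠ z.partner := fun z hz => hop hy hz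
    rw [hP1, hP2, hP3,
      chordMult_eq_of_neighbours hn₀ hN h1 h2 (r _ ho₁) (r _ ho₂),
      chordMult_eq_of_neighbours hn₁ hN (r' _ ho₁) h3 (hpp.not.2 h1) (r _ ho₃),
      chordMult_eq_of_neighbours hn₂ hN (r' _ ho₂) (r' _ ho₃) (hpp.not.2 h2) (hpp.not.2 h3)]
    simp
  have hlink_out : ∀ x y, x.isOver = true → y.isOver = true → y ≠ x₁ → y ≠ x₂ → y ≠ x₃ →
      D'.link x y = D.link x y := by
    intro x y hx hy h1 h2 h3
    refine hlink_of x y hx hy ?_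
    rw [hδ0 y hy h1 h2 h3, hzl, hzr]
    obtain ⟨o1, o2, o3⟩ := hout y hy h1 h2 h3
    by_cases e1 : x = x₁
    · rw [e1, o1]; rfl
    by_cases e2 : x = x₂
    · rw [e2, o2]; rfl
    by_cases e3 : x = x₃
    · rw [e3, o3]; rfl
    rw [hδ0 x hx e1 e2 e3, hzl]; rfl
  have f0 : ∀ u, u ≠ x₁ → u ≠ x₂ → wordOrder D.word u x₁ = wordOrder D.word u x₂ :=
    fun u => hn₀.wordOrder_eq hN
  have f1 : ∀ u, u ≠ x₁.partner → u ≠ x₃ → wordOrder D.word u x₁.partner = wordOrder D.word u x₃ :=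
    fun u => hn₁.wordOrder_eq hN
  have f2 : ∀ u, u ≠ x₂.partner → u ≠ x₃.partner →
      wordOrder D.word u x₂.partner = wordOrder D.word u x₃.partner :=
    fun u => hn₂.wordOrder_eq hN
  have g0 := wordOrder_swap D.word x₁ x₂
  have g1 := wordOrder_swap D.word x₁.partner x₃
  have g2 := wordOrder_swap D.word x₂.partner x₃.partner
  -- For two crossings of the triangle, the two first-order terms are `-2 k² s₁ s₂ s₃` each and the
  -- second-order term is `4 k² s₁ s₂ s₃`. The same cancellation occurs for the other two pairs.
  have hl12 : D'.link x₁ x₂ = D.link x₁ x₂ := by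
    refine hlink_of _ _ ho₁ ho₂ ?_
    have c1 : chordMult D.word x₂ x₃.partner - chordMult D.word x₂ x₂.partner =
        -(k * s₁ * s₂ * s₃) := by
      simp only [chordMult, wordOrder_self]
      rw [f2 x₂ q22 q23, he₂]; ring
    have c2 : chordMult D.word x₁ x₁.partner - chordMult D.word x₁ x₃ = k * s₃ := by
      simp only [chordMult, wordOrder_self]
      rw [f1 x₁ q11 h13, he₁]; ring
    rw [hP1, hP2, hP1, c1, c2, hδ2]
    simp only [q13.symm, q12.symm, hpp, h23, if_true, if_false]
    ring
  have hl13 : D'.link x₁ x₃ = D.link x₁ x₃ := by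
    refine hlink_of _ _ ho₁ ho₃ ?_
    have c1 : chordMult D.word x₃ x₃.partner - chordMult D.word x₃ x₂.partner =
        -(k * s₁ * s₂ * s₃) := by
      simp only [chordMult, wordOrder_self]
      rw [f2 x₃ q32 q33]
      rw [he₂] at g2
      linear_combination g2
    have c2 : chordMult D.word x₁ x₂ - chordMult D.word x₁ x₁ = k * s₂ := by
      simp only [chordMult, wordOrder_self]
      rw [f0 x₁.partner q11.symm q21.symm, he₀]; ring
    rw [hP1, hP3, hP1, c1, c2, hδ3]
    simp only [hpp, h13.symm, h23.symm, h12.symm, if_true, if_false]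
    ring
  have hl23 : D'.link x₂ x₃ = D.link x₂ x₃ := by
    refine hlink_of _ _ ho₂ ho₃ ?_
    have c1 : chordMult D.word x₃ x₁.partner - chordMult D.word x₃ x₃ = -(k * s₃) := by
      simp only [chordMult, wordOrder_self]
      rw [f1 x₃.partner (hpp.not.2 h13.symm) q33.symm]
      rw [he₁] at g1
      linear_combination g1
    have c2 : chordMult D.word x₂ x₂ - chordMult D.word x₂ x₁ = k * s₂ := by
      simp only [chordMult, wordOrder_self]
      rw [f0 x₂.partner q12.symm q22.symm]
      rw [he₀] at g0
      linear_combination -g0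
    rw [hP2, hP3, hP2, c1, c2, hδ3]
    simp only [hpp, h12, q31, q32, if_true, if_false]
    ring
  have hlink : ∀ x y, x.isOver = true → y.isOver = true → D'.link x y = D.link x y := by
    intro x y hx hy
    by_cases hy' : y ≠ x₁ ∧ y ≠ x₂ ∧ y ≠ x₃
    · exact hlink_out x y hx hy hy'.1 hy'.2.1 hy'.2.2
    by_cases hx' : x ≠ x₁ ∧ x ≠ x₂ ∧ x ≠ x₃
    · rw [link_swap, hlink_out y x hy hx hx'.1 hx'.2.1 hx'.2.2, ← link_swap]
    have hx'' : x = x₁ ∨ x = x₂ ∨ x = x₃ := by tauto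
    have hy'' : y = x₁ ∨ y = x₂ ∨ y = x₃ := by tauto
    rcases hx'' with rfl | rfl | rfl <;> rcases hy'' with rfl | rfl | rfl <;>
      first
        | rw [link_self, link_self]
        | assumption
        | (rw [link_swap, link_swap D]; simpa)
  have hrot : ∀ x, x.isOver = true → D'.rot x = D.rot x := by
    intro x hx
    rw [rot, rot, hturn x hx, hpair, hchord, wordPairing_add_left]
    -- A constant function has no differences, so intersections with the whole diagram do not
    -- change.
    have : wordPairing D.word (δ x) (fun _ => 2) = 0 := by
      by_cases e1 : x = x₁
      · rw [e1, hP1]; ring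
      by_cases e2 : x = x₂
      · rw [e2, hP2]; ring
      by_cases e3 : x = x₃
      · rw [e3, hP3]; ring
      rw [hδ0 x hx e1 e2 e3, hzl]
    rw [this, add_zero]
  have hcr : D'.crossings = D.crossings := by
    ext x
    simp only [mem_crossings, hperm.mem_iff]
  rw [pairSum_eq, pairSum_eq, hcr]
  refine Finset.sum_congr rfl fun x hx => Finset.sum_congr rfl fun y hy => ?_
  have hx := (mem_crossings.1 hx).2
  have hy := (mem_crossings.1 hy).2
  rw [signOfType, signOfType, hturn x hx, hturn y hy, hrot x hx, hrot y hy, hlink x y hx hy]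
  rfl

end GaussDiagram

/-- The exchanges are performed one at a time, from left to right; each keeps the word
duplicate-free, and the corrections add up. -/
theorem wordOrder_three_exchanges {A B C E : List GaussLetter} {e₀ e₁ e₂ : ℤˣ}
    {x₀ y₀ x₁ y₁ x₂ y₂ : GaussLetter}
    (hn : (A ++ orderedPair e₀ x₀ y₀ ++ B ++ orderedPair e₁ x₁ y₁ ++ C ++
      orderedPair e₂ x₂ y₂ ++ E).Nodup) (u v : GaussLetter) :
    wordOrder (A ++ orderedPair (-e₀) x₀ y₀ ++ B ++ orderedPair (-e₁) x₁ y₁ ++ C ++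
      orderedPair (-e₂) x₂ y₂ ++ E) u v =
    wordOrder (A ++ orderedPair e₀ x₀ y₀ ++ B ++ orderedPair e₁ x₁ y₁ ++ C ++
      orderedPair e₂ x₂ y₂ ++ E) u v +
      (swapTerm e₀ x₀ y₀ u v + swapTerm e₁ x₁ y₁ u v + swapTerm e₂ x₂ y₂ u v) := by
  have a0 : ∀ X Y Z : List GaussLetter, A ++ X ++ B ++ Y ++ C ++ Z ++ E =
      A ++ X ++ (B ++ Y ++ C ++ Z ++ E) := by intros; simp
  have a1 : ∀ X Y Z : List GaussLetter, A ++ X ++ B ++ Y ++ C ++ Z ++ E =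
      (A ++ X ++ B) ++ Y ++ (C ++ Z ++ E) := by intros; simp
  have p0 := orderedPair_perm_neg e₀ x₀ y₀
  have p1 := orderedPair_perm_neg e₁ x₁ y₁
  have hn1 : (A ++ orderedPair (-e₀) x₀ y₀ ++ B ++ orderedPair e₁ x₁ y₁ ++ C ++
      orderedPair e₂ x₂ y₂ ++ E).Nodup := by
    rw [a0] at hn ⊢
    exact (((p0.append_left A).append_right _).nodup_iff).2 hn
  have hn2 : (A ++ orderedPair (-e₀) x₀ y₀ ++ B ++ orderedPair (-e₁) x₁ y₁ ++ C ++
      orderedPair e₂ x₂ y₂ ++ E).Nodup := by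
    rw [a1] at hn1 ⊢
    exact (((p1.append_left _).append_right _).nodup_iff).2 hn1
  rw [wordOrder_orderedPair_neg hn2]
  rw [a1] at hn1
  rw [a1, wordOrder_orderedPair_neg hn1, ← a1]
  rw [a0] at hn
  rw [a0, wordOrder_orderedPair_neg hn, ← a0]
  ring

/-! ### Invariance under the moves on Gauss codes -/

namespace GaussDiagram

variable {D D' : GaussDiagram}

theorem pairSum_r3 {A B C E : List GaussLetter} {i j l : ℕ} {k a b c : ℤˣ}
    {π : Equiv.Perm (Fin 3)}
    (hw : D.word = A ++ r3Strand k a b c i j l (π 0) ++ B ++ r3Strand k a b c i j l (π 1) ++ C ++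
          r3Strand k a b c i j l (π 2) ++ E)
    (hw' : D'.word = A ++ r3Strand (-k) a b c i j l (π 0) ++ B ++
      r3Strand (-k) a b c i j l (π 1) ++ C ++ r3Strand (-k) a b c i j l (π 2) ++ E)
    (φ : ℤ → ℤ → ℤ → ℤ[T;T⁻¹]) (s t : Fin 2) :
    D'.pairSum φ s t = D.pairSum φ s t := by
  set e : Fin 3 → ℤˣ := ![k * b, k * c, k * a * b * c] with he
  set p : Fin 3 → GaussLetter := ![⟨i, true, a⟩, ⟨i, false, a⟩, ⟨j, false, b⟩] with hp
  set q : Fin 3 → GaussLetter := ![⟨j, true, b⟩, ⟨l, true, c⟩, ⟨l, false, c⟩] with hq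
  have hs : ∀ s, r3Strand k a b c i j l s = orderedPair (e s) (p s) (q s) := by
    intro s; fin_cases s <;> rfl
  have hs' : ∀ s, r3Strand (-k) a b c i j l s = orderedPair (-(e s)) (p s) (q s) := by
    intro s; fin_cases s <;> simp [r3Strand, he, hp, hq]
  simp only [hs] at hw
  simp only [hs'] at hw'
  have hN := hw ▸ D.word_nodup
  have a0 : ∀ X Y Z : List GaussLetter, A ++ X ++ B ++ Y ++ C ++ Z ++ E =
      A ++ X ++ (B ++ Y ++ C ++ Z ++ E) := by intros; simp
  have a1 : ∀ X Y Z : List GaussLetter, A ++ X ++ B ++ Y ++ C ++ Z ++ E =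
      (A ++ X ++ B) ++ Y ++ (C ++ Z ++ E) := by intros; simp
  have hform : ∀ t, ∃ X Y, D.word = X ++ orderedPair (e t) (p t) (q t) ++ Y := by
    intro t
    obtain ⟨r, rfl⟩ := π.surjective t
    fin_cases r
    · exact ⟨_, _, hw.trans (a0 _ _ _)⟩
    · exact ⟨_, _, hw.trans (a1 _ _ _)⟩
    · exact ⟨_, _, hw⟩
  have hnb : ∀ t, Neighbours D.word (p t) (q t) := by
    intro t
    obtain ⟨X, Y, h⟩ := hform t
    rw [h]; exact neighbours_orderedPair X Y _ _ _
  have hor : ∀ t, wordOrder D.word (p t) (q t) = e t := by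
    intro t
    obtain ⟨X, Y, h⟩ := hform t
    rw [h]
    exact wordOrder_orderedPair (h ▸ D.word_nodup)
  have hmem : ∀ t, p t ∈ D.word ∧ q t ∈ D.word := by
    intro t
    obtain ⟨X, Y, h⟩ := hform t
    have hm := fun z => (orderedPair_perm (e t) (p t) (q t)).mem_iff (a := z)
    rw [h]
    simp only [List.mem_append, hm]
    simp
  have hne : ∀ t, (p t) ≠ (q t) := by
    intro t h
    have := hor t
    rw [h, wordOrder_self] at this
    exact (e t).ne_zero this.symm
  have hord : ∀ u v, wordOrder D'.word u v = wordOrder D.word u v +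
      (swapTerm (e 0) (p 0) (q 0) u v + swapTerm (e 1) (p 1) (q 1) u v +
        swapTerm (e 2) (p 2) (q 2) u v) := by
    intro u v
    rw [hw', hw, wordOrder_three_exchanges hN]
    congr 1
    -- The order in which the strands are met only permutes the three corrections.
    have := Equiv.sum_comp π (fun r => swapTerm (e r) (p r) (q r) u v)
    simpa only [Fin.sum_univ_three] using this
  have hperm : D'.word.Perm D.word := by
    rw [hw, hw']
    exact ((((((((List.Perm.refl A).append (orderedPair_perm_neg _ _ _)).append_right B).append
      (orderedPair_perm_neg _ _ _)).append_right C).append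
      (orderedPair_perm_neg _ _ _)).append_right E))
  have hij : (⟨i, true, a⟩ : GaussLetter) ≠ ⟨j, true, b⟩ := hne 0
  have hjl : (⟨j, true, b⟩ : GaussLetter) ≠ ⟨l, true, c⟩ := by
    intro h
    exact hne 2 (by simpa [hp, hq] using h)
  have m0 : (⟨i, true, a⟩ : GaussLetter) ∈ D.word := (hmem 0).1
  have m1 : (⟨j, true, b⟩ : GaussLetter) ∈ D.word := (hmem 0).2
  have m2 : (⟨l, true, c⟩ : GaussLetter) ∈ D.word := (hmem 1).2
  -- These two letters never share a strand, so their order is unavailable. If they were equal, the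
  -- letter would occur on two strands and hence twice in the word.
  have hil : (⟨i, true, a⟩ : GaussLetter) ≠ ⟨l, true, c⟩ := by
    intro h
    have hcount := List.nodup_iff_count_le_one.1 D.word_nodup ⟨i, true, a⟩
    have hsum := Equiv.sum_comp π
      (fun r => List.count ⟨i, true, a⟩ (orderedPair (e r) (p r) (q r)))
    simp only [Fin.sum_univ_three] at hsum
    have hpos : ∀ r, (⟨i, true, a⟩ : GaussLetter) = p r ∨ (⟨i, true, a⟩ : GaussLetter) = q r →
        0 < List.count ⟨i, true, a⟩ (orderedPair (e r) (p r) (q r)) := by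
      intro r hr
      rw [List.count_pos_iff, (orderedPair_perm _ _ _).mem_iff]
      simpa using hr
    have h0 := hpos 0 (Or.inl rfl)
    have h1 := hpos 1 (Or.inr h)
    rw [hw] at hcount
    simp only [List.count_append] at hcount
    omega
  have sq : ∀ r : ℤˣ, (r : ℤ) * r = 1 := fun r => by
    rcases Int.units_eq_one_or r with rfl | rfl <;> rfl
  refine pairSum_triangle (x₁ := ⟨i, true, a⟩) (x₂ := ⟨j, true, b⟩) (x₃ := ⟨l, true, c⟩)
    (k := k) (s₁ := a) (s₂ := b) (s₃ := c) hperm rfl rfl rfl hij hil hjl m0 m1 m2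
    (sq b) (sq c) rfl rfl rfl (hnb 0) (hnb 1) (hnb 2) ?_ ?_ ?_ ?_ φ s t
  · simpa [he, hp, hq] using hor 0
  · simpa [he, hp, hq, GaussLetter.partner] using hor 1
  · simpa [he, hp, hq, GaussLetter.partner] using hor 2
  · simpa [he, hp, hq, GaussLetter.partner] using hord

theorem pairSum_r2 {A B C : List GaussLetter} {i j : ℕ} {s k : ℤˣ} {P Q : List GaussLetter}
    (hw : D.word = A ++ B ++ C) (hw' : D'.word = A ++ P ++ B ++ Q ++ C)
    (hPQ : P = [⟨i, true, s⟩, ⟨j, true, -s⟩] ∧ Q = orderedPair k ⟨i, false, s⟩ ⟨j, false, -s⟩ ∨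
      P = orderedPair k ⟨i, false, s⟩ ⟨j, false, -s⟩ ∧ Q = [⟨i, true, s⟩, ⟨j, true, -s⟩])
    {φ : ℤ → ℤ → ℤ → ℤ[T;T⁻¹]} {a b : Fin 2} (hab : a ≠ b) :
    D'.pairSum φ a b = D.pairSum φ a b := by
  have hs : D.word.Sublist D'.word := by
    rw [hw, hw', List.append_assoc A, List.append_assoc _ Q, List.append_assoc (A ++ P),
      List.append_assoc A P]
    refine (List.Sublist.refl A).append (List.Sublist.trans ?_ (List.sublist_append_right _ _))
    exact (List.Sublist.refl B).append (List.sublist_append_right _ _)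
  have hnP : ∀ {x y : GaussLetter}, Neighbours P x y → Neighbours D'.word x y := by
    rintro x y ⟨X, Y, h⟩
    refine ⟨A ++ X, Y ++ B ++ Q ++ C, ?_⟩
    rcases h with h | h <;> simp [hw', h]
  have hnQ : ∀ {x y : GaussLetter}, Neighbours Q x y → Neighbours D'.word x y := by
    rintro x y ⟨X, Y, h⟩
    refine ⟨A ++ P ++ B ++ X, Y ++ C, ?_⟩
    rcases h with h | h <;> simp [hw', h]
  have ho : ∀ x y : GaussLetter, Neighbours (orderedPair k x y) x y := by
    intro x y
    simpa using neighbours_orderedPair [] [] k x y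
  have ho' : ∀ x y : GaussLetter, Neighbours [x, y] x y := fun x y => ⟨[], [], Or.inl rfl⟩
  have hperm : D'.word.Perm (P ++ Q ++ D.word) := by
    rw [hw, hw', List.perm_iff_count]
    intro z
    simp only [List.count_append]
    ring
  have hq := orderedPair_perm k ⟨i, false, s⟩ ⟨j, false, -s⟩
  rcases hPQ with ⟨hP, hQ⟩ | ⟨hP, hQ⟩
  · refine pairSum_bigon (x₁ := ⟨i, true, s⟩) (x₂ := ⟨j, true, -s⟩) hs rfl rfl rfl ?_
      (hnP (hP ▸ ho' _ _)) (hnQ (hQ ▸ ho _ _)) hab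
    refine hperm.trans (List.Perm.append_right D.word (l₂ := [_, _, _, _]) ?_)
    rw [hP, hQ]
    exact hq.append_left _
  · refine pairSum_bigon (x₁ := ⟨i, true, s⟩) (x₂ := ⟨j, true, -s⟩) hs rfl rfl rfl ?_
      (hnQ (hQ ▸ ho' _ _)) (hnP (hP ▸ ho _ _)) hab
    refine hperm.trans (List.Perm.append_right D.word (l₂ := [_, _, _, _]) ?_)
    rw [hP, hQ]
    exact List.perm_append_comm.trans (hq.append_left _)

theorem pairSum_r1 {A B : List GaussLetter} {x : GaussLetter} (hw : D.word = A ++ B)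
    (hw' : D'.word = A ++ [x, x.partner] ++ B)
    {φ : ℤ → ℤ → ℤ → ℤ[T;T⁻¹]} {a b : Fin 2} (hab : a ≠ b)
    (h1 : ∀ s, φ 0 s 0 = 0) (h2 : ∀ r, (4 : ℤ) ∣ r → φ r 0 0 = 0) :
    D'.pairSum φ a b = D.pairSum φ a b := by
  have hs : D.word.Sublist D'.word := by
    rw [hw, hw', List.append_assoc]
    exact (List.Sublist.refl A).append (List.sublist_append_right _ _)
  have hperm : D'.word.Perm (x :: x.partner :: D.word) := by
    rw [hw, hw', List.perm_iff_count]
    intro z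
    simp only [List.count_append, List.count_cons, List.count_nil]
    ring
  have hnb : Neighbours D'.word x x.partner := ⟨A, B, Or.inl hw'⟩
  -- The kink lemma is phrased for the over-passage, whichever of the two passages comes first.
  cases hx : x.isOver
  · refine pairSum_kink (c := x.partner) hs (by simp [hx]) ?_ ?_ hab h1 h2
    · rw [GaussLetter.partner_partner]
      exact hperm.trans (List.Perm.swap _ _ _)
    · rw [GaussLetter.partner_partner]
      exact hnb.symm
  · exact pairSum_kink (c := x) hs hx hperm hnb hab h1 h2

/-- A sum over pairs of crossings of different types is an invariant of long virtual knots, if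
its terms vanish for the crossings of kinks. -/
theorem pairSum_of_equiv (h : D ≈ D')
    {φ : ℤ → ℤ → ℤ → ℤ[T;T⁻¹]} {a b : Fin 2} (hab : a ≠ b)
    (h1 : ∀ s, φ 0 s 0 = 0) (h2 : ∀ r, (4 : ℤ) ∣ r → φ r 0 0 = 0) :
    D.pairSum φ a b = D'.pairSum φ a b := by
  replace h : Relation.EqvGen (fun D D' => ReidemeisterMove D.word D'.word) D D' := h
  induction h with
  | rel D D' hm =>
    symm
    generalize hw : D.word = w at hm
    generalize hw' : D'.word = w' at hm
    cases hm with
    | relabel f => exact pairSum_relabel (hw'.trans (by rw [hw])) φ a b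
    | r1 A B x => exact pairSum_r1 hw hw' hab h1 h2
    | r2_over_first A B C i j s k => exact pairSum_r2 hw hw' (Or.inl ⟨rfl, rfl⟩) hab
    | r2_under_first A B C i j s k => exact pairSum_r2 hw hw' (Or.inr ⟨rfl, rfl⟩) hab
    | r3 A B C E i j l k a b c π => exact pairSum_r3 hw hw' φ _ _
  | refl => rfl
  | symm _ _ _ ih => exact ih.symm
  | trans _ _ _ _ _ ih ih' => exact ih.trans ih'

open LaurentPolynomial

theorem termF_kink : (∀ s, termF 0 s 0 = 0) ∧ ∀ r, (4 : ℤ) ∣ r → termF r 0 0 = 0 := by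
  simp [termF]

theorem termG_kink : (∀ s, termG 0 s 0 = 0) ∧ ∀ r, (4 : ℤ) ∣ r → termG r 0 0 = 0 := by
  simp [termG]

theorem termH_kink : (∀ s, termH 0 s 0 = 0) ∧ ∀ r, (4 : ℤ) ∣ r → termH r 0 0 = 0 := by
  refine ⟨fun s => by simp [termH], ?_⟩
  rintro _ ⟨r, rfl⟩
  have h1 : (0 - 4 * r + 0) / 4 = -r := by omega
  have h2 : 4 * r / 4 = r := by omega
  rw [termH, h1, h2]
  simp

end GaussDiagram

/-! ### Gauss codes of curves with three strands -/

/-- A closed curve on a torus that runs along three strands around an annulus: the first strand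
crosses the other two, which are parallel, and the crossings are numbered along the first strand.
The crossing `i` is one with the second strand if `kind i = true`, and one with the third strand
if `kind i = false`. -/
structure ThreeStrandCode where
  size : ℕ
  kind : ℕ → Bool
  type : ℕ → Fin 2

namespace ThreeStrandCode

variable (C : ThreeStrandCode)

/-- The sign of a crossing, seen from the first strand, in the flat diagram. -/
def flat (i : ℕ) : ℤˣ := if C.kind i then (-1) ^ i else -(-1) ^ i

/-- The passage of the first strand through a crossing. -/
def first (i : ℕ) : GaussLetter :=
  ⟨i, decide (C.type i = 0), if C.type i = 0 then C.flat i else -C.flat i⟩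

/-- The passages of the second or the third strand, through crossings with number below `n`. -/
def returns (b : Bool) : ℕ → List GaussLetter
  | 0 => []
  | n + 1 => if C.kind n = b then (C.first n).partner :: returns b n else returns b n

/-- The Gauss code of the curve. -/
def code : List GaussLetter :=
  (List.range C.size).map C.first ++ C.returns true C.size ++ C.returns false C.size

/-- The number of crossings below `n` of a given kind. -/
def cnt (b : Bool) (n : ℕ) : ℕ := Nat.count (fun i => C.kind i = b) n

theorem cnt_zero (b : Bool) : C.cnt b 0 = 0 := rfl

theorem cnt_succ (b : Bool) (n : ℕ) : C.cnt b (n + 1) = C.cnt b n + if C.kind n = b then 1 else 0 :=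
  Nat.count_succ _ _

theorem cnt_mono (b : Bool) {m n : ℕ} (h : m ≤ n) : C.cnt b m ≤ C.cnt b n :=
  Nat.count_monotone _ h

theorem cnt_lt (b : Bool) {m n : ℕ} (h : m < n) (hm : C.kind m = b) : C.cnt b m < C.cnt b n :=
  Nat.count_strict_mono hm h

theorem cnt_add (n : ℕ) : C.cnt true n + C.cnt false n = n := by
  induction n with
  | zero => rfl
  | succ n ih =>
    rw [cnt_succ, cnt_succ]
    cases C.kind n <;> simp <;> omega

@[simp] theorem first_label (i : ℕ) : (C.first i).label = i := rfl

theorem first_injective : Function.Injective C.first :=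
  fun _ _ h => congrArg GaussLetter.label h

theorem first_ne_partner (i j : ℕ) : C.first i ≠ (C.first j).partner := by
  intro h
  have h1 : i = j := congrArg GaussLetter.label h
  subst h1
  exact (C.first i).partner_ne h.symm

theorem flatSign_first (i : ℕ) : (C.first i).flatSign = C.flat i := by
  unfold GaussLetter.flatSign first
  by_cases h : C.type i = 0 <;> simp [h]

theorem mem_returns {b : Bool} {n : ℕ} {z : GaussLetter} :
    z ∈ C.returns b n ↔ ∃ i < n, C.kind i = b ∧ z = (C.first i).partner := by
  induction n with
  | zero => simp [returns]
  | succ n ih =>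
    unfold returns
    split_ifs with h
    · rw [List.mem_cons, ih]
      constructor
      · rintro (rfl | ⟨i, hi, h'⟩)
        · exact ⟨n, by omega, h, rfl⟩
        · exact ⟨i, by omega, h'⟩
      · rintro ⟨i, hi, hk, rfl⟩
        rcases Nat.lt_succ_iff_lt_or_eq.1 hi with hi | rfl
        · exact Or.inr ⟨i, hi, hk, rfl⟩
        · exact Or.inl rfl
    · rw [ih]
      constructor
      · rintro ⟨i, hi, h'⟩
        exact ⟨i, by omega, h'⟩
      · rintro ⟨i, hi, hk, rfl⟩
        rcases Nat.lt_succ_iff_lt_or_eq.1 hi with hi | rfl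
        · exact ⟨i, hi, hk, rfl⟩
        · exact absurd hk h

theorem length_returns (b : Bool) (n : ℕ) : (C.returns b n).length = C.cnt b n := by
  induction n with
  | zero => rfl
  | succ n ih =>
    rw [returns, cnt_succ]
    split_ifs <;> simp [ih]

theorem mem_code {z : GaussLetter} :
    z ∈ C.code ↔ ∃ i < C.size, z = C.first i ∨ z = (C.first i).partner := by
  simp only [code, List.mem_append, List.mem_map, List.mem_range, mem_returns]
  constructor
  · rintro ((⟨i, hi, rfl⟩ | ⟨i, hi, -, rfl⟩) | ⟨i, hi, -, rfl⟩)
    · exact ⟨i, hi, Or.inl rfl⟩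
    · exact ⟨i, hi, Or.inr rfl⟩
    · exact ⟨i, hi, Or.inr rfl⟩
  · rintro ⟨i, hi, rfl | rfl⟩
    · exact Or.inl (Or.inl ⟨i, hi, rfl⟩)
    · cases h : C.kind i
      · exact Or.inr ⟨i, hi, h, rfl⟩
      · exact Or.inl (Or.inr ⟨i, hi, h, rfl⟩)

theorem nodup_returns (b : Bool) (n : ℕ) :
    ((C.returns b n).map fun x => (x.label, x.isOver)).Nodup := by
  induction n with
  | zero => simp [returns]
  | succ n ih =>
    unfold returns
    split_ifs with h
    · rw [List.map_cons, List.nodup_cons]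
      refine ⟨?_, ih⟩
      rw [List.mem_map]
      rintro ⟨z, hz, h⟩
      obtain ⟨i, hi, -, rfl⟩ := C.mem_returns.1 hz
      have : i = n := congrArg Prod.fst h
      omega
    · exact ih

/-- The diagram of the curve. -/
def diagram : GaussDiagram where
  word := C.code
  nodup := by
    have hc : ∀ i j, ((C.first i).label, (C.first i).isOver) ≠
        ((C.first j).partner.label, (C.first j).partner.isOver) := by
      intro i j h
      have h1 : i = j := congrArg Prod.fst h
      subst h1
      simpa using congrArg Prod.snd h
    have hk : ∀ x ∈ C.returns true C.size, ∀ y ∈ C.returns false C.size, x.label ≠ y.label := by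
      intro x hx y hy h
      obtain ⟨i, -, hi, rfl⟩ := C.mem_returns.1 hx
      obtain ⟨j, -, hj, rfl⟩ := C.mem_returns.1 hy
      have h1 : i = j := h
      subst h1
      simp [hi] at hj
    rw [code, List.map_append, List.map_append, List.nodup_append, List.nodup_append]
    refine ⟨⟨?_, C.nodup_returns _ _, ?_⟩, C.nodup_returns _ _, ?_⟩
    · rw [List.map_map]
      refine List.Nodup.map ?_ List.nodup_range
      intro i j h
      exact congrArg Prod.fst h
    · simp only [List.mem_map]
      rintro _ ⟨_, ⟨i, -, rfl⟩, rfl⟩ _ ⟨z, hz, rfl⟩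
      obtain ⟨j, -, -, rfl⟩ := C.mem_returns.1 hz
      exact hc i j
    · simp only [List.mem_append, List.mem_map]
      rintro _ (⟨_, ⟨i, -, rfl⟩, rfl⟩ | ⟨x, hx, rfl⟩) _ ⟨z, hz, rfl⟩
      · obtain ⟨j, -, -, rfl⟩ := C.mem_returns.1 hz
        exact hc i j
      · exact fun h => hk x hx z hz (congrArg Prod.fst h)
  partner_mem := by
    intro x hx
    obtain ⟨i, hi, rfl | rfl⟩ := C.mem_code.1 hx
    · exact C.mem_code.2 ⟨i, hi, Or.inr rfl⟩
    · exact C.mem_code.2 ⟨i, hi, Or.inl (GaussLetter.partner_partner _)⟩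

theorem first_mem {i : ℕ} (hi : i < C.size) : C.first i ∈ C.diagram.word :=
  C.mem_code.2 ⟨i, hi, Or.inl rfl⟩

/-- The list runs downwards, so the position of a crossing counts those of its kind above it. The
additive form avoids truncated subtraction. -/
theorem idxOf_returns {b : Bool} {i n : ℕ} (hi : i < n) (hb : C.kind i = b) :
    (C.returns b n).idxOf (C.first i).partner + C.cnt b (i + 1) = C.cnt b n := by
  induction n with
  | zero => omega
  | succ n ih =>
    rw [C.cnt_succ b n]
    unfold returns
    rcases Nat.lt_succ_iff_lt_or_eq.1 hi with h | h
    · have hne : (C.first n).partner ≠ (C.first i).partner := by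
        intro e
        have : n = i := congrArg GaussLetter.label e
        omega
      have := ih h
      split_ifs
      · rw [List.idxOf_cons_ne _ hne]
        omega
      · omega
    · subst h
      rw [if_pos hb, if_pos hb, List.idxOf_cons_self, C.cnt_succ, if_pos hb]
      omega

theorem idxOf_map_range {i n : ℕ} (hi : i < n) :
    ((List.range n).map C.first).idxOf (C.first i) = i := by
  induction n with
  | zero => omega
  | succ n ih =>
    rw [List.range_succ, List.map_append]
    rcases Nat.lt_succ_iff_lt_or_eq.1 hi with h | rfl
    · rw [List.idxOf_append_of_mem (List.mem_map.2 ⟨i, List.mem_range.2 h, rfl⟩), ih h]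
    · rw [List.idxOf_append_of_notMem]
      · simp
      · rw [List.mem_map]
        rintro ⟨j, hj, h⟩
        have := C.first_injective h
        rw [List.mem_range] at hj
        omega

theorem pos_first {i : ℕ} (hi : i < C.size) : C.diagram.pos (C.first i) = i := by
  change List.idxOf _ C.code = i
  rw [code, List.append_assoc, List.idxOf_append_of_mem (List.mem_map.2 ⟨i, List.mem_range.2 hi, rfl⟩),
    C.idxOf_map_range hi]

theorem pos_partner_true {i : ℕ} (hi : i < C.size) (hb : C.kind i = true) :
    C.diagram.pos (C.first i).partner + C.cnt true (i + 1) = C.size + C.cnt true C.size := by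
  have hn : (C.first i).partner ∉ (List.range C.size).map C.first := by
    rw [List.mem_map]
    rintro ⟨j, -, h⟩
    exact C.first_ne_partner j i h
  change List.idxOf _ C.code + _ = _
  rw [code, List.append_assoc, List.idxOf_append_of_notMem hn,
    List.idxOf_append_of_mem (C.mem_returns.2 ⟨i, hi, hb, rfl⟩)]
  have := C.idxOf_returns hi hb
  simp
  omega

theorem pos_partner_false {i : ℕ} (hi : i < C.size) (hb : C.kind i = false) :
    C.diagram.pos (C.first i).partner + C.cnt false (i + 1) = C.size + C.size := by
  have hn : (C.first i).partner ∉ (List.range C.size).map C.first ++ C.returns true C.size := by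
    rw [List.mem_append, List.mem_map]
    rintro (⟨j, -, h⟩ | h)
    · exact C.first_ne_partner j i h
    · obtain ⟨j, -, hj, h⟩ := C.mem_returns.1 h
      have : i = j := congrArg GaussLetter.label h
      subst this
      simp [hb] at hj
  change List.idxOf _ C.code + _ = _
  rw [code, List.idxOf_append_of_notMem hn]
  have := C.idxOf_returns hi hb
  have h' := C.cnt_add C.size
  simp [length_returns]
  omega

theorem length_code : C.diagram.word.length = C.size + C.size := by
  change C.code.length = _
  have h' := C.cnt_add C.size
  simp [code, length_returns]
  omega

/-- The multiplicity at the passage `l` of the part of the first strand after the passage `i`,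
doubled. -/
def after (i l : ℕ) : ℤ := if i < l then 2 else if l = i then 1 else 0

theorem turnSign_first {i : ℕ} (hi : i < C.size) : C.diagram.turnSign (C.first i) = 1 := by
  have h1 := C.pos_first hi
  have h2 : C.size ≤ C.diagram.pos (C.first i).partner := by
    cases hb : C.kind i
    · have := C.pos_partner_false hi hb
      have := C.cnt_mono false (show i + 1 ≤ C.size by omega)
      have := C.cnt_add C.size
      omega
    · have := C.pos_partner_true hi hb
      have := C.cnt_mono true (show i + 1 ≤ C.size by omega)
      omega
  exact if_pos (show C.diagram.pos (C.first i) < C.diagram.pos (C.first i).partner by omega)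

theorem wordOrder_eq_pos (D : GaussDiagram) (x y : GaussLetter) : wordOrder D.word x y =
    if D.pos x < D.pos y then 1 else if D.pos y < D.pos x then -1 else 0 := rfl

theorem chordMult_first_first {i l : ℕ} (hi : i < C.size) (hl : l < C.size) :
    chordMult C.diagram.word (C.first i) (C.first l) = after i l := by
  have h1 := C.pos_first hi
  have h2 : C.size ≤ C.diagram.pos (C.first i).partner := by
    cases hb : C.kind i
    · have := C.pos_partner_false hi hb
      have := C.cnt_mono false (show i + 1 ≤ C.size by omega)
      have := C.cnt_add C.size
      omega
    · have := C.pos_partner_true hi hb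
      have := C.cnt_mono true (show i + 1 ≤ C.size by omega)
      omega
  have h3 := C.pos_first hl
  simp only [chordMult, wordOrder_eq_pos, after]
  split_ifs <;> omega

/-- The cycle `α` runs up the first strand, down the second and then down the third. It stops on the
second strand if the crossing lies there; otherwise it covers the whole second strand, which gives
the value 2. -/
theorem chordMult_first_partner {i l : ℕ} (hi : i < C.size) (hl : l < C.size) :
    chordMult C.diagram.word (C.first i) (C.first l).partner =
      if C.kind l = C.kind i then after i l else if C.kind l then 2 else 0 := by
  have h1 := C.pos_first hi
  have c0 := C.cnt_add C.size
  have k1 := fun b => C.cnt_mono b (show i + 1 ≤ C.size by omega)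
  have k2 := fun b => C.cnt_mono b (show l + 1 ≤ C.size by omega)
  have k1t := k1 true
  have k1f := k1 false
  have k2t := k2 true
  have k2f := k2 false
  have s1 := fun b => C.cnt_succ b i
  have s2 := fun b => C.cnt_succ b l
  have lt1 : ∀ b, C.kind i = b → C.kind l = b → l < i → C.cnt b (l + 1) < C.cnt b (i + 1) :=
    fun b h h' hli => lt_of_le_of_lt (C.cnt_mono b hli) (C.cnt_lt b (Nat.lt_succ_self i) h)
  have lt2 : ∀ b, C.kind i = b → C.kind l = b → i < l → C.cnt b (i + 1) < C.cnt b (l + 1) :=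
    fun b h h' hli => lt_of_le_of_lt (C.cnt_mono b hli) (C.cnt_lt b (Nat.lt_succ_self l) h')
  simp only [chordMult, wordOrder_eq_pos, after]
  cases hb : C.kind i <;> cases hb' : C.kind l
  · have p1 := C.pos_partner_false hi hb
    have p2 := C.pos_partner_false hl hb'
    have l1 := lt1 _ hb hb'
    have l2 := lt2 _ hb hb'
    have l3 : l = i → C.cnt false (l + 1) = C.cnt false (i + 1) := by rintro rfl; rfl
    simp only [if_true]
    split_ifs <;> omega
  · have p1 := C.pos_partner_false hi hb
    have p2 := C.pos_partner_true hl hb'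
    have l1 : 0 < C.cnt true (l + 1) :=
      lt_of_le_of_lt (Nat.zero_le _) (C.cnt_lt true (Nat.lt_succ_self l) hb')
    simp
    split_ifs <;> omega
  · have p1 := C.pos_partner_true hi hb
    have p2 := C.pos_partner_false hl hb'
    have l1 : 0 < C.cnt true (i + 1) :=
      lt_of_le_of_lt (Nat.zero_le _) (C.cnt_lt true (Nat.lt_succ_self i) hb)
    simp
    split_ifs <;> omega
  · have p1 := C.pos_partner_true hi hb
    have p2 := C.pos_partner_true hl hb'
    have l1 := lt1 _ hb hb'
    have l2 := lt2 _ hb hb'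
    have l3 : l = i → C.cnt true (l + 1) = C.cnt true (i + 1) := by rintro rfl; rfl
    simp only [if_true]
    split_ifs <;> omega

theorem sum_code {M : Type*} [AddCommMonoid M] (g : GaussLetter → M) :
    ∑ z ∈ C.diagram.word.toFinset, g z =
      ∑ l ∈ Finset.range C.size, (g (C.first l) + g (C.first l).partner) := by
  have h : C.diagram.word.toFinset = (Finset.range C.size).image C.first ∪
      (Finset.range C.size).image (fun l => (C.first l).partner) := by
    ext z
    rw [List.mem_toFinset]
    refine C.mem_code.trans ?_
    simp only [Finset.mem_union, Finset.mem_image, Finset.mem_range]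
    constructor
    · rintro ⟨i, hi, rfl | rfl⟩
      · exact Or.inl ⟨i, hi, rfl⟩
      · exact Or.inr ⟨i, hi, rfl⟩
    · rintro (⟨i, hi, rfl⟩ | ⟨i, hi, rfl⟩)
      · exact ⟨i, hi, Or.inl rfl⟩
      · exact ⟨i, hi, Or.inr rfl⟩
  rw [h, Finset.sum_union, Finset.sum_image (fun _ _ _ _ e => C.first_injective e),
    Finset.sum_image (fun _ _ _ _ e => C.first_injective (GaussLetter.partner_injective e)),
    Finset.sum_add_distrib]
  rw [Finset.disjoint_left]
  intro z hz hz'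
  obtain ⟨i, -, rfl⟩ := Finset.mem_image.1 hz
  obtain ⟨j, -, h⟩ := Finset.mem_image.1 hz'
  exact C.first_ne_partner i j h.symm

theorem wordPairing_code (u v : GaussLetter → ℤ) : wordPairing C.diagram.word u v =
    ∑ l ∈ Finset.range C.size, (C.flat l : ℤ) * (u (C.first l) * v (C.first l).partner -
      u (C.first l).partner * v (C.first l)) := by
  rw [wordPairing, sum_code]
  refine Finset.sum_congr rfl fun l _ => ?_
  rw [GaussLetter.flatSign_partner, flatSign_first, GaussLetter.partner_partner]
  ring

end ThreeStrandCode

/-! ### Levels, intersection numbers and factorization of the pair sums -/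

namespace ThreeStrandCode

theorem sum_mul_after (g : ℕ → ℤ) {i n : ℕ} (hi : i < n) :
    ∑ l ∈ Finset.range n, g l * after i l =
      2 * (∑ l ∈ Finset.range n, g l - ∑ l ∈ Finset.range i, g l) - g i := by
  induction n, hi using Nat.le_induction with
  | base =>
    rw [Finset.sum_range_succ, Finset.sum_range_succ, Finset.sum_eq_zero]
    · simp [after]; ring
    · intro l hl
      have := Finset.mem_range.1 hl
      rw [after, if_neg (by omega), if_neg (by omega), mul_zero]
  | succ n hn ih =>
    rw [Finset.sum_range_succ, Finset.sum_range_succ, ih, after, if_pos (by omega)]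
    ring

/-- The sum telescopes: partial sums are nonzero only between `i` and `j`. It expresses that `α_i`
does not meet `β_j` when `i` is on the second and `j` on the third strand, since both cycles go up
and back inside the annulus. -/
theorem sum_alternating {i j : ℕ} (hij : i ≠ j) {n : ℕ} (hj : j < n) :
    ∑ l ∈ Finset.range n, (-1 : ℤ) ^ l * (after i l * (2 - after j l)) = 0 := by
  have key : ∀ m, ∑ l ∈ Finset.range m, (-1 : ℤ) ^ l * (after i l * (2 - after j l)) =
      if i < m ∧ m ≤ j then -2 * (-1 : ℤ) ^ m else 0 := by
    intro m
    induction m with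
    | zero => simp
    | succ m ih =>
      rw [Finset.sum_range_succ, ih, pow_succ]
      unfold after
      split_ifs <;> omega
  rw [key, if_neg (by omega)]

variable (C : ThreeStrandCode)

/-- The signed number of crossings below `n` of a given kind. -/
def flatSum (b : Bool) (n : ℕ) : ℤ :=
  ∑ l ∈ Finset.range n, if C.kind l = b then (C.flat l : ℤ) else 0

/-- The intersection number of the cycle `α` of a crossing with the whole curve. -/
def level (i : ℕ) : ℤ :=
  if C.kind i then C.flatSum false C.size - C.flatSum false i else -C.flatSum true i

/-- At a crossing `l` of the same kind as `i`, the cycle has equal multiplicities on both passages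
and contributes nothing, so only crossings of the other kind count. -/
theorem rot_first {i : ℕ} (hi : i < C.size) : C.diagram.rot (C.first i) = 4 * C.level i := by
  rw [GaussDiagram.rot, C.turnSign_first hi, one_mul, wordPairing_code]
  unfold level
  cases hk : C.kind i
  · have h := sum_mul_after (fun l => if C.kind l = true then (C.flat l : ℤ) else 0) hi
    simp only [hk] at h
    calc _ = ∑ l ∈ Finset.range C.size, (2 * ((if C.kind l = true then (C.flat l : ℤ) else 0) *
            after i l) - 4 * if C.kind l = true then (C.flat l : ℤ) else 0) := by
          refine Finset.sum_congr rfl fun l hl => ?_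
          have hl := Finset.mem_range.1 hl
          rw [C.chordMult_first_first hi hl, C.chordMult_first_partner hi hl, hk]
          cases C.kind l <;> simp; ring
      _ = _ := by
          rw [Finset.sum_sub_distrib, ← Finset.mul_sum, ← Finset.mul_sum, h]
          simp [flatSum]
          ring
  · have h := sum_mul_after (fun l => if C.kind l = false then (C.flat l : ℤ) else 0) hi
    simp only [hk] at h
    calc _ = ∑ l ∈ Finset.range C.size, 2 * ((if C.kind l = false then (C.flat l : ℤ) else 0) *
            after i l) := by
          refine Finset.sum_congr rfl fun l hl => ?_
          have hl := Finset.mem_range.1 hl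
          rw [C.chordMult_first_first hi hl, C.chordMult_first_partner hi hl, hk]
          cases C.kind l <;> simp; ring
      _ = _ := by
          rw [← Finset.mul_sum, h]
          simp [flatSum]
          ring

/-- Call a cycle short if it goes up the first strand and back down one other strand inside the
annulus. Then `α` is short for the second strand and `β` is short for the third. Short cycles have
intersection number zero, so the formula follows by writing `α = D - β` on the third strand. -/
theorem link_first {i j : ℕ} (hi : i < C.size) (hj : j < C.size) :
    C.diagram.link (C.first i) (C.first j) =
      4 * if C.kind i then (if C.kind j then 0 else C.level i)
        else (if C.kind j then -C.level j else C.level i - C.level j) := by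
  have hpq : ∀ {i j : ℕ}, i < C.size → j < C.size → C.kind i = true → C.kind j = false →
      C.diagram.link (C.first i) (C.first j) = 4 * C.level i := by
    intro i j hi hj ki kj
    rw [← C.rot_first hi, GaussDiagram.rot, GaussDiagram.link, C.turnSign_first hi,
      C.turnSign_first hj, one_mul, one_mul, one_mul, ← sub_eq_zero, ← wordPairing_sub_right,
      wordPairing_code]
    have hij : i ≠ j := by rintro rfl; simp [ki] at kj
    -- The summands of `α_i · (α_j - D)` have the same shape for both kinds of `l`, because the flat
    -- signs of the two kinds are opposite.
    rw [← sum_alternating hij hj]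
    refine Finset.sum_congr rfl fun l hl => ?_
    have hl := Finset.mem_range.1 hl
    rw [C.chordMult_first_first hi hl, C.chordMult_first_partner hi hl,
      C.chordMult_first_first hj hl, C.chordMult_first_partner hj hl, ki, kj]
    unfold flat
    cases C.kind l <;> simp <;> ring
  cases ki : C.kind i <;> cases kj : C.kind j
  · have h1 := C.rot_first hi
    have h2 := C.rot_first hj
    simp only [Bool.false_eq_true, if_false]
    rw [mul_sub, ← h1, ← h2, GaussDiagram.rot, GaussDiagram.rot, GaussDiagram.link,
      C.turnSign_first hi, C.turnSign_first hj, one_mul, one_mul, one_mul, one_mul,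
      wordPairing_code, wordPairing_code, wordPairing_code, ← Finset.sum_sub_distrib]
    refine Finset.sum_congr rfl fun l hl => ?_
    have hl := Finset.mem_range.1 hl
    rw [C.chordMult_first_first hi hl, C.chordMult_first_partner hi hl,
      C.chordMult_first_first hj hl, C.chordMult_first_partner hj hl, ki, kj]
    cases C.kind l <;> simp <;> ring
  · rw [GaussDiagram.link_swap, hpq hj hi kj ki]
    simp
  · rw [hpq hi hj ki kj]
    simp
  · rw [GaussDiagram.link, wordPairing_code]
    simp only [if_true, mul_zero]
    rw [Finset.sum_eq_zero, mul_zero]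
    intro l hl
    have hl := Finset.mem_range.1 hl
    rw [C.chordMult_first_first hi hl, C.chordMult_first_partner hi hl,
      C.chordMult_first_first hj hl, C.chordMult_first_partner hj hl, ki, kj]
    cases C.kind l <;> simp

/-- The over-passage of a crossing. -/
def upper (i : ℕ) : GaussLetter := if C.type i = 0 then C.first i else (C.first i).partner

end ThreeStrandCode

theorem chordMult_partner (w : List GaussLetter) (x z : GaussLetter) :
    chordMult w x.partner z = -1 * chordMult w x z := by
  rw [chordMult, chordMult, GaussLetter.partner_partner]
  ring

namespace GaussDiagram

variable (D : GaussDiagram) (x y : GaussLetter)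

theorem turnSign_partner : D.turnSign x.partner = -D.turnSign x := by
  rw [turnSign, turnSign, GaussLetter.partner_partner, wordOrder_swap]

theorem rot_partner : D.rot x.partner = D.rot x := by
  have h := wordPairing_mul D.word (-1) 1 (chordMult D.word x) (fun _ => 2)
  simp only [one_mul] at h
  rw [rot, rot, turnSign_partner, funext (chordMult_partner D.word x), h]
  ring

theorem link_partner_left : D.link x.partner y = D.link x y := by
  have h := wordPairing_mul D.word (-1) 1 (chordMult D.word x) (chordMult D.word y)
  simp only [one_mul] at h
  rw [link, link, turnSign_partner, funext (chordMult_partner D.word x), h]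
  ring

theorem link_partner_right : D.link x y.partner = D.link x y := by
  rw [link_swap, link_partner_left, ← link_swap]

end GaussDiagram

namespace ThreeStrandCode

variable (C : ThreeStrandCode)

theorem upper_injective : Function.Injective C.upper := by
  intro i j h
  have := congrArg GaussLetter.label h
  unfold upper at this
  split_ifs at this <;> exact this

theorem crossingsOfType_diagram (c : Fin 2) : C.diagram.crossingsOfType c =
    ((Finset.range C.size).filter fun i => C.type i = c).image C.upper := by
  ext x
  rw [GaussDiagram.mem_crossingsOfType, GaussDiagram.mem_crossings, Finset.mem_image]
  have hc : ∀ d : Fin 2, d = 0 ∨ d = 1 := by decide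
  constructor
  · rintro ⟨⟨hx, ho⟩, ht⟩
    obtain ⟨i, hi, rfl | rfl⟩ := C.mem_code.1 hx
    · have h0 : C.type i = 0 := by simpa [first] using ho
      rw [C.turnSign_first hi] at ht
      refine ⟨i, ?_, by simp [upper, h0]⟩
      rw [Finset.mem_filter, Finset.mem_range, h0]
      refine ⟨hi, ?_⟩
      rcases hc c with rfl | rfl
      · rfl
      · simp [GaussDiagram.typeSign] at ht
    · have h0 : C.type i ≠ 0 := by simpa [first] using ho
      rw [GaussDiagram.turnSign_partner, C.turnSign_first hi] at ht
      refine ⟨i, ?_, by simp [upper, h0]⟩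
      rw [Finset.mem_filter, Finset.mem_range]
      refine ⟨hi, ?_⟩
      rcases hc c with rfl | rfl
      · simp [GaussDiagram.typeSign] at ht
      · exact (hc _).resolve_left h0
  · rintro ⟨i, hi, rfl⟩
    rw [Finset.mem_filter, Finset.mem_range] at hi
    obtain ⟨hi, rfl⟩ := hi
    unfold upper
    split_ifs with h0
    · refine ⟨⟨C.first_mem hi, by simp [first, h0]⟩, ?_⟩
      rw [C.turnSign_first hi, h0]
      rfl
    · refine ⟨⟨C.diagram.partner_mem _ (C.first_mem hi), by simp [first, h0]⟩, ?_⟩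
      rw [GaussDiagram.turnSign_partner, C.turnSign_first hi]
      simp [GaussDiagram.typeSign, h0]

/-- The minus sign comes from `a ≠ b`: the first strand is over at exactly one of the two crossings,
so the product of the signs is minus the product of the flat signs. -/
theorem pairSum_diagram (φ : ℤ → ℤ → ℤ → ℤ[T;T⁻¹]) {a b : Fin 2} (hab : a ≠ b) :
    C.diagram.pairSum φ a b = ∑ i ∈ Finset.range C.size, ∑ j ∈ Finset.range C.size,
      if C.type i = a ∧ C.type j = b then
        -(((C.flat i : ℤ) * (C.flat j : ℤ)) • φ (4 * C.level i) (4 * C.level j)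
          (4 * if C.kind i then (if C.kind j then 0 else C.level i)
            else (if C.kind j then -C.level j else C.level i - C.level j))) else 0 := by
  rw [GaussDiagram.pairSum, crossingsOfType_diagram, crossingsOfType_diagram,
    Finset.sum_image (fun _ _ _ _ e => C.upper_injective e), Finset.sum_filter]
  refine Finset.sum_congr rfl fun i hi => ?_
  have hi := Finset.mem_range.1 hi
  by_cases ha : C.type i = a
  · simp only [ha, if_true, true_and]
    rw [Finset.sum_image (fun _ _ _ _ e => C.upper_injective e), Finset.sum_filter]
    refine Finset.sum_congr rfl fun j hj => ?_
    have hj := Finset.mem_range.1 hj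
    by_cases hb : C.type j = b
    · rw [if_pos hb, if_pos hb]
      have h1 : ∀ i < C.size, C.diagram.rot (C.upper i) = 4 * C.level i := by
        intro i hi
        rw [upper]
        split_ifs
        · exact C.rot_first hi
        · rw [GaussDiagram.rot_partner, C.rot_first hi]
      have h2 : C.diagram.link (C.upper i) (C.upper j) =
          C.diagram.link (C.first i) (C.first j) := by
        rw [upper, upper]
        split_ifs <;> simp only [GaussDiagram.link_partner_left, GaussDiagram.link_partner_right]
      have h3 : ((C.upper i).sign : ℤ) * ((C.upper j).sign : ℤ) =
          -((C.flat i : ℤ) * (C.flat j : ℤ)) := by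
        have hc : ∀ d : Fin 2, d = 0 ∨ d = 1 := by decide
        rcases hc a with rfl | rfl <;> rcases hc b with rfl | rfl
        · exact absurd rfl hab
        · simp [upper, ha, hb, first]
        · simp [upper, ha, hb, first]
        · exact absurd rfl hab
      rw [h1 i hi, h1 j hj, h2, C.link_first hi hj, h3, neg_smul]
    · rw [if_neg hb, if_neg hb]
  · simp [ha]

open LaurentPolynomial

/-- A signed sum over the crossings of the curve. -/
noncomputable def total (g : Bool → Fin 2 → ℤ → ℤ[T;T⁻¹]) : ℤ[T;T⁻¹] :=
  ∑ i ∈ Finset.range C.size, (C.flat i : ℤ) • g (C.kind i) (C.type i) (C.level i)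

theorem four_mul_ediv (m : ℤ) : 4 * m / 4 = m := Int.mul_ediv_cancel_left m (by norm_num)

theorem neg_total_mul_total (g g' : Bool → Fin 2 → ℤ → ℤ[T;T⁻¹]) :
    -(C.total g * C.total g') = ∑ i ∈ Finset.range C.size, ∑ j ∈ Finset.range C.size,
      -(((C.flat i : ℤ) * (C.flat j : ℤ)) • (g (C.kind i) (C.type i) (C.level i) *
        g' (C.kind j) (C.type j) (C.level j))) := by
  rw [total, total, Finset.sum_mul_sum]
  simp only [Finset.sum_neg_distrib]
  congr 1
  refine Finset.sum_congr rfl fun i _ => Finset.sum_congr rfl fun j _ => ?_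
  rw [smul_mul_smul_comm]

/-- With `j` on the second strand, `α_i · α_j` is `0` or `-level j` according to the kind of `i`.
The summand depends on `j` only through its level, and the double sum splits. -/
theorem pairSum_termF {a b : Fin 2} (hab : a ≠ b)
    (hb : ∀ i < C.size, C.type i = b → C.kind i = true) :
    C.diagram.pairSum GaussDiagram.termF a b =
      -(C.total (fun k t _ => if t = a ∧ k = false then 1 else 0) *
        C.total (fun _ t m => if t = b then T (-m) - 1 else 0)) := by
  rw [pairSum_diagram C _ hab, neg_total_mul_total]
  refine Finset.sum_congr rfl fun i hi => Finset.sum_congr rfl fun j hj => ?_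
  have hj := hb j (Finset.mem_range.1 hj)
  by_cases ta : C.type i = a <;> by_cases tb : C.type j = b
  · rw [if_pos ⟨ta, tb⟩, GaussDiagram.termF, four_mul_ediv]
    cases hk : C.kind i <;> simp [ta, tb, hj tb]
  · simp [ta, tb]
  · simp [ta, tb]
  · simp [ta, tb]

/-- For `i` on the third and `j` on the second strand, the term is `T (level i) * (T (level j) -
1)`; for `i` on the second strand it is zero. -/
theorem pairSum_termG {a b : Fin 2} (hab : a ≠ b)
    (hb : ∀ i < C.size, C.type i = b → C.kind i = true) :
    C.diagram.pairSum GaussDiagram.termG a b =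
      -(C.total (fun k t m => if t = a ∧ k = false then T m else 0) *
        C.total (fun _ t m => if t = b then T m - 1 else 0)) := by
  rw [pairSum_diagram C _ hab, neg_total_mul_total]
  refine Finset.sum_congr rfl fun i hi => Finset.sum_congr rfl fun j hj => ?_
  have hj := hb j (Finset.mem_range.1 hj)
  by_cases ta : C.type i = a <;> by_cases tb : C.type j = b
  · rw [if_pos ⟨ta, tb⟩, GaussDiagram.termG, ← mul_sub, four_mul_ediv, four_mul_ediv]
    cases hk : C.kind i
    · simp [ta, tb, hj tb]
      rw [T_add]
      left
      ring
    · simp [ta, tb, hj tb]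
  · simp [ta, tb]
  · simp [ta, tb]
  · simp [ta, tb]

/-- With `i` on the third strand, the term is `1 - T (level j)`, and `1 - T (-level i)` is added
when `j` is also on the third strand. -/
theorem pairSum_termH {a b : Fin 2} (hab : a ≠ b)
    (ha : ∀ i < C.size, C.type i = a → C.kind i = false) :
    C.diagram.pairSum GaussDiagram.termH a b =
      -(C.total (fun _ t _ => if t = a then 1 else 0) *
        C.total (fun _ t m => if t = b then 1 - T m else 0)) +
      -(C.total (fun _ t m => if t = a then 1 - T (-m) else 0) *
        C.total (fun k t _ => if t = b ∧ k = false then 1 else 0)) := by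
  rw [pairSum_diagram C _ hab, neg_total_mul_total, neg_total_mul_total,
    ← Finset.sum_add_distrib]
  refine Finset.sum_congr rfl fun i hi => ?_
  rw [← Finset.sum_add_distrib]
  refine Finset.sum_congr rfl fun j hj => ?_
  have hi := ha i (Finset.mem_range.1 hi)
  by_cases ta : C.type i = a <;> by_cases tb : C.type j = b
  · rw [if_pos ⟨ta, tb⟩, GaussDiagram.termH, ← mul_sub, ← mul_add, four_mul_ediv, four_mul_ediv,
      four_mul_ediv, ← neg_add, ← smul_add, hi ta]
    cases hk : C.kind j
    · have e : C.level j - C.level i + (C.level i - C.level j) = 0 := by ring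
      simp only [ta, tb, e, T_zero, if_true, and_self, Bool.false_eq_true, if_false]
      congr 2
      ring
    · have e : C.level j - C.level i + -C.level j = -C.level i := by ring
      simp only [ta, tb, e, if_true, Bool.false_eq_true, if_false, and_false, Bool.true_eq_false]
      congr 2
      ring
  · simp [ta, tb]
  · simp [ta, tb]
  · simp [ta, tb]

end ThreeStrandCode

/-! ### Generators of the polynomials that vanish at 1 -/

/-- By additivity `f - f(1)` is a sum of terms `a (T n - 1)`. Both signs of the generators are
available, so a submonoid suffices. -/
theorem LaurentPolynomial.mem_of_eval₂_one_eq_zero (S : AddSubmonoid ℤ[T;T⁻¹])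
    (hS : ∀ (k : ℤ) (c : ℤˣ), (c : ℤ) • (LaurentPolynomial.T k - 1 : ℤ[T;T⁻¹]) ∈ S)
    {f : ℤ[T;T⁻¹]} (hf : LaurentPolynomial.eval₂ (RingHom.id ℤ) 1 f = 0) : f ∈ S := by
  have key : ∀ f : ℤ[T;T⁻¹],
      f - LaurentPolynomial.C (LaurentPolynomial.eval₂ (RingHom.id ℤ) 1 f) ∈ S := by
    intro f
    induction f using LaurentPolynomial.induction_on' with
    | add f g hf hg =>
      have := S.add_mem hf hg
      rw [map_add, map_add]
      convert this using 1
      ring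
    | C_mul_T n a =>
      have h1 : ∀ m : ℕ, ∀ c : ℤˣ, ((m : ℤ) * c) • (LaurentPolynomial.T n - 1 : ℤ[T;T⁻¹]) ∈ S := by
        intro m c
        have := S.nsmul_mem (hS n c) m
        rwa [← natCast_zsmul, smul_smul] at this
      have h2 : LaurentPolynomial.C a * LaurentPolynomial.T n -
          LaurentPolynomial.C (LaurentPolynomial.eval₂ (RingHom.id ℤ) 1
            (LaurentPolynomial.C a * LaurentPolynomial.T n)) =
          a • (LaurentPolynomial.T n - 1 : ℤ[T;T⁻¹]) := by
        rw [map_mul]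
        simp [mul_sub, zsmul_eq_mul]
      rw [h2]
      rcases Int.le_total 0 a with ha | ha
      · have := h1 a.natAbs 1
        rwa [Units.val_one, mul_one, Int.natAbs_of_nonneg ha] at this
      · have := h1 a.natAbs (-1)
        rwa [Units.val_neg, Units.val_one, Int.ofNat_natAbs_of_nonpos ha, mul_neg, mul_one,
          neg_neg] at this
  have := key f
  rwa [hf, map_zero, sub_zero] at this

/-! ### Lists of crossings as walks on states -/

namespace ThreeStrandCode

/-- The sign of the next crossing with the second strand, and the levels of the next crossings with
the second and the third strand. -/
abbrev State : Type := ℤˣ × ℤ × ℤ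

/-- The state after a crossing of a given kind. -/
def step (k : Bool) (s : State) : State :=
  if k then (-s.1, s.2.1, s.2.2 - s.1) else (-s.1, s.2.1 + s.1, s.2.2)

@[simp] theorem step_step (k : Bool) (s : State) : step k (step k s) = s := by
  cases k <;> simp [step]

/-- The state after a list of crossings. -/
def run : List (Bool × Fin 2) → State → State
  | [], s => s
  | e :: L, s => run L (step e.1 s)

theorem run_append (L L' : List (Bool × Fin 2)) (s : State) :
    run (L ++ L') s = run L' (run L s) := by
  induction L generalizing s with
  | nil => rfl
  | cons e L ih => exact ih _

/-- The contribution of a crossing. -/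
noncomputable def weight (g : Bool → Fin 2 → ℤ → ℤ[T;T⁻¹]) (e : Bool × Fin 2) (s : State) :
    ℤ[T;T⁻¹] :=
  ((if e.1 then s.1 else -s.1 : ℤˣ) : ℤ) • g e.1 e.2 (if e.1 then s.2.1 else s.2.2)

/-- The sum of the contributions of a list of crossings. -/
noncomputable def listTotal (g : Bool → Fin 2 → ℤ → ℤ[T;T⁻¹]) :
    List (Bool × Fin 2) → State → ℤ[T;T⁻¹]
  | [], _ => 0
  | e :: L, s => weight g e s + listTotal g L (step e.1 s)

theorem weight_step (g : Bool → Fin 2 → ℤ → ℤ[T;T⁻¹]) (e : Bool × Fin 2) (s : State) :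
    weight g e (step e.1 s) = -weight g e s := by
  obtain ⟨k, t⟩ := e
  cases k <;> simp [weight, step]

theorem listTotal_append (g : Bool → Fin 2 → ℤ → ℤ[T;T⁻¹]) (L L' : List (Bool × Fin 2))
    (s : State) : listTotal g (L ++ L') s = listTotal g L s + listTotal g L' (run L s) := by
  induction L generalizing s with
  | nil => simp [listTotal, run]
  | cons e L ih =>
    rw [List.cons_append, listTotal, listTotal, ih, run, add_assoc]

/-- The code with a given list of crossings. -/
def ofList (L : List (Bool × Fin 2)) : ThreeStrandCode where
  size := L.length
  kind i := (L.getD i (true, 0)).1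
  type i := (L.getD i (true, 0)).2

theorem run_take (L : List (Bool × Fin 2)) (a : ℤ) {i : ℕ} (hi : i ≤ L.length) :
    run (L.take i) (1, a, 0) =
      ((-1) ^ i, a - (ofList L).flatSum false i, -(ofList L).flatSum true i) := by
  induction i with
  | zero => simp [run, flatSum]
  | succ i ih =>
    have hi' : i < L.length := hi
    rw [List.take_add_one, List.getElem?_eq_getElem hi', run_append, ih hi'.le]
    have hk : (ofList L).kind i = L[i].1 := by simp [ofList, hi']
    have hf : ∀ b, (ofList L).flatSum b (i + 1) = (ofList L).flatSum b i +
        if (ofList L).kind i = b then ((ofList L).flat i : ℤ) else 0 :=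
      fun b => Finset.sum_range_succ _ _
    rw [hf, hf]
    simp only [flat, hk, Option.toList_some, run, step]
    cases L[i].1 <;> simp [pow_succ] <;> ring

theorem listTotal_eq_sum (g : Bool → Fin 2 → ℤ → ℤ[T;T⁻¹]) (L : List (Bool × Fin 2)) (s : State) :
    listTotal g L s = ∑ i ∈ Finset.range L.length,
      weight g (L.getD i (true, 0)) (run (L.take i) s) := by
  induction L generalizing s with
  | nil => simp [listTotal]
  | cons e L ih =>
    rw [List.length_cons, Finset.sum_range_succ', listTotal, ih, add_comm]
    simp [run]

/-- The level on the second strand counts the third-strand crossings still ahead, so the walk has to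
start with their total. -/
theorem total_ofList (g : Bool → Fin 2 → ℤ → ℤ[T;T⁻¹]) (L : List (Bool × Fin 2)) :
    (ofList L).total g = listTotal g L (1, (ofList L).flatSum false L.length, 0) := by
  rw [total, listTotal_eq_sum]
  refine Finset.sum_congr rfl fun i hi => ?_
  have hi : i < L.length := Finset.mem_range.1 hi
  rw [run_take L _ hi.le]
  change _ = ((if (ofList L).kind i then _ else _ : ℤˣ) : ℤ) •
    g ((ofList L).kind i) ((ofList L).type i) (if (ofList L).kind i then _ else _)
  rfl

/-- A list of crossings that leaves every state unchanged. -/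
def Balanced (M : List (Bool × Fin 2)) : Prop := ∀ s, run M s = s

theorem Balanced.nil : Balanced [] := fun _ => rfl

theorem Balanced.append {M M' : List (Bool × Fin 2)} (h : Balanced M) (h' : Balanced M') :
    Balanced (M ++ M') := by
  intro s
  rw [run_append, h, h']

/-- Every step is an involution, so the reversed list retraces the walk. -/
theorem Balanced.conj {M : List (Bool × Fin 2)} (h : Balanced M) (v : List (Bool × Fin 2)) :
    Balanced (v ++ M ++ v.reverse) := by
  induction v with
  | nil => simpa using h
  | cons e v ih =>
    intro s
    have : e :: v ++ M ++ (e :: v).reverse = e :: ((v ++ M ++ v.reverse) ++ [e]) := by simp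
    rw [this, run, run_append, ih, run, step_step, run]

/-- A retraced crossing has the same level and the opposite sign, so the way there and the way back
cancel. -/
theorem listTotal_conj {M : List (Bool × Fin 2)} (h : Balanced M) (v : List (Bool × Fin 2))
    (g : Bool → Fin 2 → ℤ → ℤ[T;T⁻¹]) (s : State) :
    listTotal g (v ++ M ++ v.reverse) s = listTotal g M (run v s) := by
  induction v generalizing s with
  | nil => simp [run]
  | cons e v ih =>
    have : e :: v ++ M ++ (e :: v).reverse = e :: ((v ++ M ++ v.reverse) ++ [e]) := by simp
    rw [this, listTotal, listTotal_append, ih, h.conj v, listTotal, listTotal, weight_step, run]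
    ring

/-- Two successive crossings of the same kind and of different types. -/
theorem exists_pair (a b : Fin 2) (k : Bool) (c : ℤˣ) (s : State) :
    ∃ M : List (Bool × Fin 2), Balanced M ∧ M.length = 2 ∧ (∀ e ∈ M, e = (k, a) ∨ e = (k, b)) ∧
      ∀ g, listTotal g M s = (c : ℤ) • (g k b (if k then s.2.1 else s.2.2) -
        g k a (if k then s.2.1 else s.2.2)) := by
  have hb : ∀ t t', Balanced [(k, t), (k, t')] := by
    intro t t' s
    simp [run]
  -- The second of the two crossings has the opposite sign at the same level; the sign `c` is
  -- obtained by choosing which type comes first.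
  by_cases hc : c = if k then s.1 else -s.1
  · refine ⟨[(k, b), (k, a)], hb _ _, rfl, by simp, fun g => ?_⟩
    have h := weight_step g (k, a) s
    simp only at h
    simp only [listTotal, h]
    rw [weight, weight, ← hc, smul_sub]
    simp [sub_eq_add_neg]
  · have hc' : -c = if k then s.1 else -s.1 := by
      rcases Int.units_eq_one_or c with rfl | rfl <;>
        rcases Int.units_eq_one_or s.1 with h | h <;> rw [h] at hc ⊢ <;> cases k <;> simp_all
    refine ⟨[(k, a), (k, b)], hb _ _, rfl, by simp, fun g => ?_⟩
    have h := weight_step g (k, b) s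
    simp only at h
    simp only [listTotal, h]
    rw [weight, weight, ← hc', Units.val_neg, neg_smul, neg_smul, smul_sub]
    simp [sub_eq_add_neg, add_comm]

theorem exists_run {p : State → ℤ} (d : Bool → Fin 2)
    (h : ∀ (s : State) (c : ℤˣ), ∃ v : List (Bool × Fin 2), (∀ e ∈ v, e.2 = d e.1) ∧
      p (run v s) = p s + c) (s : State) (n : ℤ) :
    ∃ v : List (Bool × Fin 2), (∀ e ∈ v, e.2 = d e.1) ∧ p (run v s) = p s + n := by
  have hstep : ∀ (n : ℤ) (c : ℤˣ),
      (∃ v : List (Bool × Fin 2), (∀ e ∈ v, e.2 = d e.1) ∧ p (run v s) = p s + n) →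
      ∃ v : List (Bool × Fin 2), (∀ e ∈ v, e.2 = d e.1) ∧ p (run v s) = p s + (n + c) := by
    rintro n c ⟨v, hv, hp⟩
    obtain ⟨v', hv', hp'⟩ := h (run v s) c
    refine ⟨v ++ v', ?_, ?_⟩
    · intro e he
      rcases List.mem_append.1 he with he | he
      · exact hv e he
      · exact hv' e he
    · rw [run_append, hp', hp, add_assoc]
  induction n using Int.induction_on with
  | zero => exact ⟨[], by simp, by simp [run]⟩
  | succ n ih => simpa using hstep _ 1 ih
  | pred n ih => simpa [sub_eq_add_neg] using hstep _ (-1) ih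

/-- A crossing of the other kind moves the level by one, in the direction of the current sign; a
preliminary crossing of kind `k` reverses that sign without moving the level. -/
theorem exists_run_level (k : Bool) (d : Bool → Fin 2) (s : State) (n : ℤ) :
    ∃ v : List (Bool × Fin 2), (∀ e ∈ v, e.2 = d e.1) ∧
      (if k then (run v s).2.1 else (run v s).2.2) = (if k then s.2.1 else s.2.2) + n := by
  refine exists_run (p := fun s => if k then s.2.1 else s.2.2) d ?_ s n
  intro s c
  by_cases hc : c = if k then s.1 else -s.1
  · refine ⟨[(!k, d (!k))], by simp, ?_⟩
    cases k <;> simp [run, step, hc] <;> ring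
  · refine ⟨[(k, d k), (!k, d (!k))], by simp, ?_⟩
    rcases Int.units_eq_one_or c with rfl | rfl <;>
        rcases Int.units_eq_one_or s.1 with h | h <;> rw [h] at hc <;>
        cases k <;> simp_all [run, step] <;> ring

/-- The list of crossings of the diagrams that realize the intersection polynomials. -/
def frame (a t : Fin 2) (M : List (Bool × Fin 2)) : List (Bool × Fin 2) :=
  (false, a) :: ([(true, t), (true, t)] ++ M ++ [(false, a), (true, t), (true, t), (false, a)])

/-- The state after the first crossing. -/
def base : State := (-1, 0, 0)

/-- Apart from `M` and the first crossing, the frame consists of palindromes, which contribute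
nothing. They are there only to give the first and the last crossings the kinds required by
`IsFramed`. -/
theorem total_frame {M : List (Bool × Fin 2)} (hM : Balanced M) (a t : Fin 2)
    (g : Bool → Fin 2 → ℤ → ℤ[T;T⁻¹]) :
    (ofList (frame a t M)).total g = -g false a 0 + listTotal g M base := by
  have h1 : Balanced [(true, t), (true, t)] := Balanced.nil.conj [(true, t)]
  have h2 : Balanced [(false, a), (true, t), (true, t), (false, a)] :=
    Balanced.nil.conj [(false, a), (true, t)]
  -- Everything after the first crossing is balanced, so that crossing, of flat sign `-1`, is the
  -- whole sum.
  have h3 : (ofList (frame a t M)).flatSum false (frame a t M).length = -1 := by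
    have h := run_take (frame a t M) 0 le_rfl
    rw [List.take_length, frame, run, (h1.append hM).append h2] at h
    have := congrArg (fun s => s.2.1) h
    simp only [step, frame] at this ⊢
    simp at this ⊢
    omega
  rw [total_ofList, h3, frame, listTotal, listTotal_append, listTotal_append, h1, run_append, h1, hM]
  have e1 : listTotal g [(true, t), (true, t)] (step false (1, -1, 0)) = 0 :=
    listTotal_conj Balanced.nil [(true, t)] g _
  have e2 : listTotal g [(false, a), (true, t), (true, t), (false, a)]
      (step false (1, -1, 0)) = 0 :=
    listTotal_conj Balanced.nil [(false, a), (true, t)] g _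
  simp only [e1, e2]
  simp [weight, step, base]

end ThreeStrandCode

/-! ### Realization of all admissible polynomials -/

namespace ThreeStrandCode

open LaurentPolynomial

/-- The values of a signed sum on lists of crossings on which some other sums vanish. -/
noncomputable def values (p : Bool × Fin 2 → Prop) (Z : Set (Bool → Fin 2 → ℤ → ℤ[T;T⁻¹]))
    (g : Bool → Fin 2 → ℤ → ℤ[T;T⁻¹]) : AddSubmonoid ℤ[T;T⁻¹] where
  carrier := {f | ∃ M : List (Bool × Fin 2), Balanced M ∧ Even M.length ∧ (∀ e ∈ M, p e) ∧
    (∀ z ∈ Z, listTotal z M base = 0) ∧ listTotal g M base = f}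
  zero_mem' := ⟨[], Balanced.nil, by simp, by simp, fun _ _ => rfl, rfl⟩
  add_mem' := by
    rintro _ _ ⟨M, h1, h2, h3, h4, rfl⟩ ⟨M', h1', h2', h3', h4', rfl⟩
    refine ⟨M ++ M', h1.append h1', ?_, ?_, ?_, ?_⟩
    · rw [List.length_append]
      exact h2.add h2'
    · intro e he
      exact (List.mem_append.1 he).elim (h3 e) (h3' e)
    · intro z hz
      rw [listTotal_append, h1, h4 z hz, h4' z hz, add_zero]
    · rw [listTotal_append, h1]

theorem even_length_conj {M : List (Bool × Fin 2)} (h : M.length = 2)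
    (v : List (Bool × Fin 2)) : Even (v ++ M ++ v.reverse).length := by
  simp only [List.length_append, List.length_reverse, h]
  exact ⟨v.length + 1, by ring⟩

/-- The walk uses type `a` only, which `g` ignores, and the pair on the second strand supplies `c (T
k - 1)`. Sums supported on the third strand vanish: the walk cancels and the pair is on the second
strand. The sign `e` serves `F` and `G` at once. -/
theorem mem_values_inner {a b : Fin 2} (hab : a ≠ b) (e : ℤˣ) {f : ℤ[T;T⁻¹]}
    (hf : eval₂ (RingHom.id ℤ) 1 f = 0) :
    f ∈ values (fun x => x.2 = b → x.1 = true) {g | ∀ t m, g true t m = 0}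
      (fun _ t m => if t = b then T (e * m) - 1 else 0) := by
  refine mem_of_eval₂_one_eq_zero _ (fun k c => ?_) hf
  obtain ⟨v, hv, hk⟩ := exists_run_level true (fun _ => a) base (e * k)
  obtain ⟨M, hM, hl, hm, hg⟩ := exists_pair a b true c (run v base)
  simp only [if_true, base, zero_add] at hk hg
  refine ⟨v ++ M ++ v.reverse, hM.conj v, even_length_conj hl v, ?_, ?_, ?_⟩
  · intro x hx hxb
    simp only [List.mem_append, List.mem_reverse] at hx
    rcases hx with (hx | hx) | hx
    · exact absurd ((hv x hx).symm.trans hxb) hab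
    · rcases hm x hx with rfl | rfl <;> rfl
    · exact absurd ((hv x hx).symm.trans hxb) hab
  · intro g hz
    have hz : ∀ t m, g true t m = 0 := hz
    rw [listTotal_conj hM]
    refine (hg g).trans ?_
    rw [hz, hz, sub_zero, smul_zero]
  · rw [listTotal_conj hM]
    refine (hg _).trans ?_
    have he : (e : ℤ) * (e * k) = k := by
      rcases Int.units_eq_one_or e with rfl | rfl <;> simp
    change _ • ((if b = b then T (e * (run v base).2.1) - 1 else 0) - (if a = b then _ else 0)) = _
    rw [if_pos rfl, if_neg hab, sub_zero]
    have hk' : (run v base).2.1 = e * k := hk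
    rw [hk', he]

/-- Two pairs on the third strand, at level `k` and at level `0` with opposite signs, cancel in
every sum that ignores levels. What remains of `1 - T m` is `c (T k - 1)`. -/
theorem mem_values_outer {a b : Fin 2} (hab : a ≠ b) {f : ℤ[T;T⁻¹]}
    (hf : eval₂ (RingHom.id ℤ) 1 f = 0) :
    f ∈ values (fun x => x.2 = a → x.1 = false)
      {fun _ t _ => if t = a then 1 else 0, fun k t _ => if t = b ∧ k = false then 1 else 0}
      (fun _ t m => if t = b then 1 - T m else 0) := by
  refine mem_of_eval₂_one_eq_zero _ (fun k c => ?_) hf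
  -- The types of the walk are chosen so that type `a` occurs on the third strand only.
  obtain ⟨v, hv, hk⟩ := exists_run_level false (fun k => if k then b else a) base k
  obtain ⟨M, hM, hl, hm, hg⟩ := exists_pair a b false (-c) (run v base)
  obtain ⟨M', hM', hl', hm', hg'⟩ := exists_pair a b false c base
  have hk : (run v base).2.2 = k := by simpa [base] using hk
  have htot : ∀ g, listTotal g (v ++ M ++ v.reverse ++ M') base =
      (c : ℤ) • ((g false b 0 - g false a 0) - (g false b k - g false a k)) := by
    intro g
    rw [listTotal_append, listTotal_conj hM, hM.conj, hg, hg']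
    have hb : base.2.2 = 0 := rfl
    simp only [Bool.false_eq_true, if_false, hk, hb, Units.val_neg, neg_smul, smul_sub]
    ring
  refine ⟨v ++ M ++ v.reverse ++ M', (hM.conj v).append hM', ?_, ?_, ?_, ?_⟩
  · rw [List.length_append, hl']
    exact (even_length_conj hl v).add even_two
  · have hva : ∀ x ∈ v, x.2 = a → x.1 = false := by
      intro x hx hxa
      have := hv x hx
      cases h : x.1
      · rfl
      · rw [hxa, h] at this
        exact absurd this hab
    intro x hx hxa
    simp only [List.mem_append, List.mem_reverse] at hx
    rcases hx with ((hx | hx) | hx) | hx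
    · exact hva x hx hxa
    · rcases hm x hx with rfl | rfl <;> rfl
    · exact hva x hx hxa
    · rcases hm' x hx with rfl | rfl <;> rfl
  · rintro g (rfl | rfl) <;> rw [htot] <;> simp
  · rw [htot]
    simp [hab]

theorem frame_forall {p : Bool × Fin 2 → Prop} {a t : Fin 2} {M : List (Bool × Fin 2)}
    (hM : ∀ e ∈ M, p e) (ha : p (false, a)) (ht : p (true, t)) :
    ∀ i < (ofList (frame a t M)).size, p ((ofList (frame a t M)).kind i,
      (ofList (frame a t M)).type i) := by
  intro i hi
  have hall : ∀ e ∈ frame a t M, p e := by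
    intro e he
    simp only [frame, List.mem_cons, List.mem_append, List.not_mem_nil, or_false] at he
    rcases he with rfl | ((rfl | rfl) | he) | rfl | rfl | rfl | rfl
    all_goals first | assumption | exact hM e he
  have hi' : i < (frame a t M).length := hi
  have := hall _ (List.getElem_mem hi')
  change p ((frame a t M).getD i (true, 0))
  rwa [List.getD_eq_getElem _ _ hi']

theorem exists_frame_F {a b : Fin 2} (hab : a ≠ b) {f : ℤ[T;T⁻¹]}
    (hf : eval₂ (RingHom.id ℤ) 1 f = 0) : ∃ (t : Fin 2) (M : List (Bool × Fin 2)), Even M.length ∧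
      (ofList (frame a t M)).diagram.pairSum GaussDiagram.termF a b = f := by
  obtain ⟨M, hM, he, hp, hz, hfM⟩ := mem_values_inner hab (-1) hf
  -- The crossings of the frame must all have type `a`, since type `b` carries the polynomial
  -- factor.
  refine ⟨a, M, he, ?_⟩
  rw [pairSum_termF _ hab (frame_forall hp (fun h => absurd h hab) (fun _ => rfl)),
    total_frame hM, total_frame hM, hz _ (by intro t m; simp)]
  simp only [Units.val_neg, Units.val_one, neg_mul, one_mul] at hfM
  rw [hfM]
  simp [hab]

theorem exists_frame_G {a b : Fin 2} (hab : a ≠ b) {f : ℤ[T;T⁻¹]}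
    (hf : eval₂ (RingHom.id ℤ) 1 f = 0) : ∃ (t : Fin 2) (M : List (Bool × Fin 2)), Even M.length ∧
      (ofList (frame a t M)).diagram.pairSum GaussDiagram.termG a b = f := by
  obtain ⟨M, hM, he, hp, hz, hfM⟩ := mem_values_inner hab 1 hf
  refine ⟨a, M, he, ?_⟩
  rw [pairSum_termG _ hab (frame_forall hp (fun h => absurd h hab) (fun _ => rfl)),
    total_frame hM, total_frame hM, hz _ (by intro t m; simp)]
  simp only [Units.val_one, one_mul] at hfM
  rw [hfM]
  simp [hab]

theorem exists_frame_H {a b : Fin 2} (hab : a ≠ b) {f : ℤ[T;T⁻¹]}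
    (hf : eval₂ (RingHom.id ℤ) 1 f = 0) : ∃ (t : Fin 2) (M : List (Bool × Fin 2)), Even M.length ∧
      (ofList (frame a t M)).diagram.pairSum GaussDiagram.termH a b = f := by
  obtain ⟨M, hM, he, hp, hz, hfM⟩ := mem_values_outer hab hf
  -- Here type `a` is confined to the third strand, so the second-strand crossings of the frame get
  -- type `b`.
  refine ⟨b, M, he, ?_⟩
  rw [pairSum_termH _ hab (frame_forall hp (fun _ => rfl) (fun h => absurd h.symm hab)),
    total_frame hM, total_frame hM, total_frame hM, total_frame hM, hz _ (Or.inl rfl),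
    hz _ (Or.inr rfl), hfM]
  simp [hab]

end ThreeStrandCode

/-! ### Boundary circles and corners -/

theorem GaussLetter.flatSign_eq_or (x : GaussLetter) : x.flatSign = 1 ∨ x.flatSign = -1 := by
  unfold flatSign
  rcases Int.units_eq_one_or x.sign with hs | hs <;> cases x.isOver <;> simp [hs]

namespace GaussDiagram

variable (D : GaussDiagram)

instance : Finite D.BoundaryCircle := inferInstanceAs (Finite (Quot _))

/-- The surface realization all of whose regions are disks. -/
noncomputable def diskRealization : D.SurfaceRealization where
  numRegions := Nat.card D.BoundaryCircle
  region := Finite.equivFin D.BoundaryCircle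
  region_surjective := (Finite.equivFin D.BoundaryCircle).surjective
  regionGenus := 0

theorem eulerChar_diskRealization : D.diskRealization.eulerChar =
    D.crossings.card - D.word.length + Nat.card D.BoundaryCircle := by
  have h : ∀ R : Fin (Nat.card D.BoundaryCircle),
      Nat.card {c : D.BoundaryCircle // Finite.equivFin D.BoundaryCircle c = R} = 1 := by
    intro R
    rw [Nat.card_eq_one_iff_unique]
    refine ⟨⟨fun x y => Subtype.ext ?_⟩, ⟨⟨(Finite.equivFin D.BoundaryCircle).symm R, by simp⟩⟩⟩
    exact (Finite.equivFin D.BoundaryCircle).injective (x.2.trans y.2.symm)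
  rw [SurfaceRealization.eulerChar]
  simp only [diskRealization, h]
  simp
  exact Finset.card_fin _

theorem word_getElem?_pos {x : GaussLetter} (hx : x ∈ D.word) : D.word[D.pos x]? = some x := by
  have h : D.word.idxOf x < D.word.length := List.idxOf_lt_length_of_mem hx
  rw [pos, List.getElem?_eq_getElem h, List.getElem_idxOf]

theorem nextEdge_pos {x : GaussLetter} (hx : x ∈ D.word) :
    D.nextEdge (D.pos x, true) = D.turnLeft x true := by
  rw [nextEdge, word_getElem?_pos D hx]
  rfl

theorem nextEdge_pos_succ {x : GaussLetter} (hx : x ∈ D.word) :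
    D.nextEdge (D.pos x + 1, false) = D.turnLeft x false := by
  rw [nextEdge, word_getElem?_pos D hx]
  rfl

theorem turnLeft_eq (x : GaussLetter) (d : Bool) : D.turnLeft x d =
    if (if x.flatSign = 1 then d else !d) = true then (D.pos x.partner + 1, true)
      else (D.pos x.partner, false) := by
  have h : x.isOver = decide (x.sign = 1) ↔ x.flatSign = 1 := by
    unfold GaussLetter.flatSign
    rcases Int.units_eq_one_or x.sign with hs | hs <;> cases x.isOver <;> simp [hs]
  simp only [turnLeft, h]

/-- A function of the directed edges that is constant on the boundary circles. -/
def IsBoundaryInvariant {Y : Type*} (s : ℕ × Bool → Y) : Prop :=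
  ∀ e ≤ D.word.length, ∀ d, s (D.nextEdge (e, d)) = s (e, d)

/-- A function of the directed edges takes the same value on the two sides of each of the four
corners at a crossing. -/
def CornerInvariant {Y : Type*} (s : ℕ × Bool → Y) (x : GaussLetter) (d : Bool) : Prop :=
  s (D.pos x, d) = s (D.pos x.partner + 1, d) ∧
  s (D.pos x + 1, !d) = s (D.pos x.partner, !d) ∧
  s (D.pos x, !d) = s (D.pos x.partner, d) ∧
  s (D.pos x + 1, d) = s (D.pos x.partner + 1, !d)

theorem CornerInvariant.partner {Y : Type*} {s : ℕ × Bool → Y} {x : GaussLetter} {d : Bool}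
    (h : D.CornerInvariant s x d) : D.CornerInvariant s x.partner (!d) := by
  obtain ⟨h1, h2, h3, h4⟩ := h
  refine ⟨?_, ?_, ?_, ?_⟩ <;> simp [GaussLetter.partner_partner, h1, h2, h3, h4]

theorem cornerInvariant_of_isBoundaryInvariant {Y : Type*} {s : ℕ × Bool → Y}
    (hs : D.IsBoundaryInvariant s) {x : GaussLetter} (hx : x ∈ D.word) :
    D.CornerInvariant s x (decide (x.flatSign = 1)) := by
  have hx' := D.partner_mem x hx
  have h : ∀ z ∈ D.word, D.pos z < D.word.length := fun z hz => List.idxOf_lt_length_of_mem hz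
  have h1 := hs _ (h x hx).le true
  have h2 := hs _ (h x hx) false
  have h3 := hs _ (h _ hx').le true
  have h4 := hs _ (h _ hx') false
  rw [nextEdge_pos D hx, turnLeft_eq] at h1
  rw [nextEdge_pos_succ D hx, turnLeft_eq] at h2
  rw [nextEdge_pos D hx', turnLeft_eq, GaussLetter.partner_partner,
    GaussLetter.flatSign_partner] at h3
  rw [nextEdge_pos_succ D hx', turnLeft_eq, GaussLetter.partner_partner,
    GaussLetter.flatSign_partner] at h4
  rcases x.flatSign_eq_or with e | e <;> rw [e] at h1 h2 h3 h4 ⊢ <;>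
    simp at h1 h2 h3 h4 <;> simp [CornerInvariant, *]

/-- Away from the basepoint, each left turn goes round one of the four corners of a crossing. Corner
conditions are symmetric in the two strands and therefore easier to check than `nextEdge`. -/
theorem isBoundaryInvariant_of_cornerInvariant {Y : Type*} {s : ℕ × Bool → Y}
    (h0 : s (0, true) = s (D.word.length, true)) (h0' : s (D.word.length, false) = s (0, false))
    (hs : ∀ x ∈ D.word, D.CornerInvariant s x (decide (x.flatSign = 1))) :
    D.IsBoundaryInvariant s := by
  have hw : ∀ e < D.word.length, ∃ x ∈ D.word, D.pos x = e := by
    intro e he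
    refine ⟨D.word[e], List.getElem_mem he, ?_⟩
    exact (D.nodup.of_map).idxOf_getElem _ _
  intro e he d
  cases d
  · cases e with
    | zero => exact h0'
    | succ e =>
      obtain ⟨x, hx, rfl⟩ := hw e he
      obtain ⟨h1, h2, h3, h4⟩ := hs x hx
      rw [nextEdge_pos_succ D hx, turnLeft_eq]
      rcases x.flatSign_eq_or with e | e <;> rw [e] at h1 h2 h3 h4 ⊢ <;>
        simp at h1 h2 h3 h4 ⊢ <;> simp [*]
  · rcases he.eq_or_lt with rfl | he
    · simpa [nextEdge] using h0
    · obtain ⟨x, hx, rfl⟩ := hw e he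
      obtain ⟨h1, h2, h3, h4⟩ := hs x hx
      rw [nextEdge_pos D hx, turnLeft_eq]
      rcases x.flatSign_eq_or with e | e <;> rw [e] at h1 h2 h3 h4 ⊢ <;>
        simp at h1 h2 h3 h4 ⊢ <;> simp [*]

theorem nextEdge_le {e : ℕ} (he : e ≤ D.word.length) (d : Bool) :
    (D.nextEdge (e, d)).1 ≤ D.word.length := by
  have h : ∀ x ∈ D.word, ∀ d, (D.turnLeft x d).1 ≤ D.word.length := by
    intro x hx d
    have : D.pos x.partner < D.word.length := List.idxOf_lt_length_of_mem (D.partner_mem x hx)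
    rw [turnLeft]
    split_ifs <;> simp only <;> omega
  have h' : ∀ (n : ℕ) (b c : Bool), (((D.word[n]?).elim (0, b)
      fun x => D.turnLeft x c) : ℕ × Bool).1 ≤ D.word.length := by
    intro n b c
    cases hn : D.word[n]? with
    | none => exact Nat.zero_le _
    | some x => exact h x (List.mem_of_getElem? hn) c
  cases d
  · cases e with
    | zero => exact le_rfl
    | succ e => exact h' _ _ _
  · exact h' _ _ _

/-- The boundary circle at a directed edge. -/
def circle (d : ℕ × Bool) : D.BoundaryCircle := Quot.mk _ (Fin.ofNat (D.word.length + 1) d.1, d.2)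

theorem isBoundaryInvariant_circle : D.IsBoundaryInvariant D.circle := by
  intro e he d
  symm
  apply Quot.sound
  have h1 : e % (D.word.length + 1) = e := Nat.mod_eq_of_lt (by omega)
  have h2 := Nat.mod_eq_of_lt (Nat.lt_succ_of_le (D.nextEdge_le he d))
  simp only [Fin.val_ofNat, h1, Nat.succ_eq_add_one] at h2 ⊢
  rw [h2]

theorem circle_surjective (c : D.BoundaryCircle) : ∃ e ≤ D.word.length, ∃ d, D.circle (e, d) = c := by
  obtain ⟨⟨e, d⟩, rfl⟩ := Quot.exists_rep c
  refine ⟨e, by omega, d, ?_⟩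
  simp [circle]
  rfl

theorem exists_lift {Y : Type*} {s : ℕ × Bool → Y} (hs : D.IsBoundaryInvariant s) :
    ∃ q : D.BoundaryCircle → Y, ∀ e ≤ D.word.length, ∀ d, q (D.circle (e, d)) = s (e, d) := by
  refine ⟨Quot.lift (fun d => s (d.1.val, d.2)) ?_, ?_⟩
  · intro d d' h
    rw [← h]
    exact (hs _ (by omega) _).symm
  · intro e he d
    simp [circle, Nat.mod_eq_of_lt (Nat.lt_succ_of_le he)]

end GaussDiagram

/-! ### Corners along the three strands -/

namespace ThreeStrandCode

variable (C : ThreeStrandCode)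

/-- The edge of the second (`b = true`) or the third strand between the crossings `k - 1` and `k`
of the first strand. -/
def strand : Bool → ℕ → ℕ
  | true, k => C.size + C.cnt true C.size - C.cnt true k
  | false, k => C.size + C.size - C.cnt false k

theorem card_crossings : C.diagram.crossings.card = C.size := by
  have h : C.diagram.crossings = (Finset.range C.size).image C.upper := by
    ext x
    rw [GaussDiagram.mem_crossings, Finset.mem_image]
    constructor
    · rintro ⟨hx, ho⟩
      obtain ⟨i, hi, rfl | rfl⟩ := C.mem_code.1 hx
      · exact ⟨i, Finset.mem_range.2 hi, if_pos (by simpa [first] using ho)⟩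
      · exact ⟨i, Finset.mem_range.2 hi, if_neg (by simpa [first] using ho)⟩
    · rintro ⟨i, hi, rfl⟩
      have hi := Finset.mem_range.1 hi
      unfold upper
      split_ifs with h0
      · exact ⟨C.first_mem hi, by simp [first, h0]⟩
      · exact ⟨C.diagram.partner_mem _ (C.first_mem hi), by simp [first, h0]⟩
  rw [h, Finset.card_image_of_injective _ C.upper_injective, Finset.card_range]

theorem pos_partner {k : ℕ} (hk : k < C.size) :
    C.diagram.pos (C.first k).partner = C.strand (C.kind k) (k + 1) ∧
      C.diagram.pos (C.first k).partner + 1 = C.strand (C.kind k) k := by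
  have h := C.cnt_add C.size
  cases hb : C.kind k
  · have h1 := C.pos_partner_false hk hb
    have h2 := C.cnt_mono false (show k + 1 ≤ C.size from hk)
    have h3 := C.cnt_succ false k
    rw [if_pos hb] at h3
    unfold strand
    constructor <;> simp only <;> omega
  · have h1 := C.pos_partner_true hk hb
    have h2 := C.cnt_mono true (show k + 1 ≤ C.size from hk)
    have h3 := C.cnt_succ true k
    rw [if_pos hb] at h3
    unfold strand
    constructor <;> simp only <;> omega

theorem strand_succ {b : Bool} {k : ℕ} (h : C.kind k ≠ b) : C.strand b (k + 1) = C.strand b k := by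
  have := C.cnt_succ b k
  rw [if_neg h, add_zero] at this
  cases b <;> simp [strand, this]

theorem strand_true_zero : C.strand true 0 = C.strand false C.size := by
  have h := C.cnt_add C.size
  have h' := C.cnt_zero true
  simp only [strand]
  omega

theorem strand_true_size : C.strand true C.size = C.size := by
  simp [strand]

theorem strand_false_zero : C.strand false 0 = C.diagram.word.length := by
  rw [C.length_code, strand, C.cnt_zero, Nat.sub_zero]

theorem exists_cnt_eq {b : Bool} {m n : ℕ} (h : m ≤ C.cnt b n) : ∃ k ≤ n, C.cnt b k = m := by
  induction n with
  | zero =>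
    rw [C.cnt_zero] at h
    exact ⟨0, le_rfl, by rw [C.cnt_zero]; omega⟩
  | succ n ih =>
    rcases h.eq_or_lt with rfl | h
    · exact ⟨n + 1, le_rfl, rfl⟩
    · rw [C.cnt_succ] at h
      obtain ⟨k, hk, e⟩ := ih (by split_ifs at h <;> omega)
      exact ⟨k, by omega, e⟩

theorem exists_level {e : ℕ} (he : e ≤ C.diagram.word.length) :
    ∃ k ≤ C.size, e = k ∨ e = C.strand true k ∨ e = C.strand false k := by
  rw [C.length_code] at he
  have h := C.cnt_add C.size
  rcases le_total e C.size with h1 | h1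
  · exact ⟨e, h1, Or.inl rfl⟩
  rcases le_total e (C.size + C.cnt true C.size) with h2 | h2
  · obtain ⟨k, hk, hc⟩ := C.exists_cnt_eq (b := true) (m := C.size + C.cnt true C.size - e)
      (n := C.size) (by omega)
    exact ⟨k, hk, Or.inr (Or.inl (by rw [strand]; omega))⟩
  · obtain ⟨k, hk, hc⟩ := C.exists_cnt_eq (b := false) (m := C.size + C.size - e)
      (n := C.size) (by omega)
    exact ⟨k, hk, Or.inr (Or.inr (by rw [strand]; omega))⟩

theorem decide_flatSign_first (k : ℕ) :
    decide ((C.first k).flatSign = 1) = (k.bodd != C.kind k) := by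
  have h : ∀ k : ℕ, (-1 : ℤˣ) ^ k = if k.bodd then -1 else 1 := by
    intro k
    induction k with
    | zero => rfl
    | succ k ih => rw [pow_succ, ih, Nat.bodd_succ]; cases k.bodd <;> rfl
  rw [flatSign_first, flat, h]
  cases k.bodd <;> cases C.kind k <;> rfl

/-- One passage per crossing suffices, since the corner conditions at the partner are the same. The
direction `d` encodes the flat sign, that is, the parity of `k` corrected by the kind. -/
theorem isBoundaryInvariant_iff {Y : Type*} (s : ℕ × Bool → Y) :
    C.diagram.IsBoundaryInvariant s ↔
      (s (0, true) = s (C.strand false 0, true) ∧ s (C.strand false 0, false) = s (0, false)) ∧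
      ∀ k < C.size, ∀ d, d = (k.bodd != C.kind k) →
        s (k, d) = s (C.strand (C.kind k) k, d) ∧
        s (k + 1, !d) = s (C.strand (C.kind k) (k + 1), !d) ∧
        s (k, !d) = s (C.strand (C.kind k) (k + 1), d) ∧
        s (k + 1, d) = s (C.strand (C.kind k) k, !d) := by
  have hc : ∀ k < C.size, C.diagram.CornerInvariant s (C.first k)
      (decide ((C.first k).flatSign = 1)) ↔ ∀ d, d = (k.bodd != C.kind k) →
        s (k, d) = s (C.strand (C.kind k) k, d) ∧
        s (k + 1, !d) = s (C.strand (C.kind k) (k + 1), !d) ∧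
        s (k, !d) = s (C.strand (C.kind k) (k + 1), d) ∧
        s (k + 1, d) = s (C.strand (C.kind k) k, !d) := by
    intro k hk
    rw [GaussDiagram.CornerInvariant, decide_flatSign_first, C.pos_first hk,
      (C.pos_partner hk).2, (C.pos_partner hk).1]
    simp only [forall_eq]
  rw [strand_false_zero]
  constructor
  · intro h
    refine ⟨⟨?_, h 0 (Nat.zero_le _) false⟩, fun k hk => (hc k hk).1 ?_⟩
    · simpa [GaussDiagram.nextEdge] using h _ le_rfl true
    · exact C.diagram.cornerInvariant_of_isBoundaryInvariant h (C.first_mem hk)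
  · rintro ⟨⟨h1, h2⟩, h⟩
    refine C.diagram.isBoundaryInvariant_of_cornerInvariant h1 h2 ?_
    intro x hx
    obtain ⟨k, hk, rfl | rfl⟩ := C.mem_code.1 hx
    · exact (hc k hk).2 (h k hk)
    · have := ((hc k hk).2 (h k hk)).partner
      convert this using 1
      rw [GaussLetter.flatSign_partner]
      rcases (C.first k).flatSign_eq_or with e | e <;> rw [e] <;> rfl

end ThreeStrandCode

/-! ### Counting the boundary circles -/

namespace ThreeStrandCode

variable (C : ThreeStrandCode)

/-- Going up the strands, three corners of each crossing touch edges already treated; only the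
corner above the crossing can open a new circle. -/
theorem forall_mem_of_isBoundaryInvariant {Y : Type*} {s : ℕ × Bool → Y}
    (hs : C.diagram.IsBoundaryInvariant s) (T : Set Y) (hv : ∀ d, s (0, d) ∈ T)
    (h0 : ∀ b d, s (C.strand b 0, d) ∈ T)
    (h1 : ∀ k < C.size, s (k + 1, !(k.bodd != C.kind k)) ∈ T) {e : ℕ}
    (he : e ≤ C.diagram.word.length) (d : Bool) : s (e, d) ∈ T := by
  have key : ∀ k ≤ C.size, (∀ d, s (k, d) ∈ T) ∧ ∀ b d, s (C.strand b k, d) ∈ T := by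
    intro k
    induction k with
    | zero => exact fun _ => ⟨hv, h0⟩
    | succ k ih =>
      intro hk
      obtain ⟨iv, ih⟩ := ih (by omega)
      obtain ⟨-, e2, e3, e4⟩ := ((C.isBoundaryInvariant_iff s).1 hs).2 k hk _ rfl
      have hn := h1 k hk
      revert e2 e3 e4 hn
      generalize (k.bodd != C.kind k) = c
      intro e2 e3 e4 hn
      have hc : ∀ d : Bool, d = c ∨ d = !c := by cases c <;> decide
      refine ⟨fun d => ?_, fun b d => ?_⟩
      · rcases hc d with rfl | rfl
        · rw [e4]
          exact ih _ _
        · exact hn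
      · by_cases hb : C.kind k = b
        · subst hb
          rcases hc d with rfl | rfl
          · rw [← e3]
            exact iv _
          · rw [← e2]
            exact hn
        · rw [C.strand_succ hb]
          exact ih _ _
  obtain ⟨k, hk, rfl | rfl | rfl⟩ := C.exists_level he
  · exact (key _ hk).1 d
  · exact (key k hk).2 _ d
  · exact (key k hk).2 _ d

/-- The number of the boundary circle that starts after a crossing. -/
def newLabel (m k : ℕ) : ℕ := if k < m then k + 1 else 0

/-- The numbers of the boundary circles between the first and the second, the first and the third,
and the second and the third strand. -/
def gap (m : ℕ) : ℕ → ℕ × ℕ × ℕ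
  | 0 => (0, m + 1, 0)
  | k + 1 =>
    if C.kind k then (newLabel m k, (gap m k).2.2, (gap m k).2.1)
    else ((gap m k).2.2, newLabel m k, (gap m k).1)

/-- The number of the boundary circle on a side of the first strand. -/
def firstLabel (m k : ℕ) (d : Bool) : ℕ := if d = k.bodd then (C.gap m k).2.1 else (C.gap m k).1

/-- The number of the boundary circle on a side of the second or the third strand. -/
def strandLabel (m : ℕ) (b : Bool) (k : ℕ) (d : Bool) : ℕ :=
  if d = (k.bodd != b) then (if b then (C.gap m k).1 else (C.gap m k).2.1) else (C.gap m k).2.2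

/-- When the first strand crosses the other strand, the two gaps beside strand `b` are interchanged
in `gap`, and the change of parity interchanges the sides. -/
theorem strandLabel_succ (m : ℕ) {b : Bool} {k : ℕ} (h : C.kind k ≠ b) :
    C.strandLabel m b (k + 1) = C.strandLabel m b k := by
  funext d
  unfold strandLabel
  rw [gap, Nat.bodd_succ]
  cases b <;> cases hk : C.kind k <;> simp [hk] at h ⊢ <;> cases d <;> cases k.bodd <;> rfl

theorem strandLabel_congr (m : ℕ) {b : Bool} {j k : ℕ} (h : C.strand b j = C.strand b k)
    (hj : j ≤ C.size) (hk : k ≤ C.size) : C.strandLabel m b j = C.strandLabel m b k := by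
  have hc : C.cnt b j = C.cnt b k := by
    have h1 := C.cnt_mono b hj
    have h2 := C.cnt_mono b hk
    have := C.cnt_add C.size
    cases b <;> simp only [strand] at h <;> omega
  clear h hj hk
  wlog hjk : j ≤ k generalizing j k
  · exact (this hc.symm (by omega)).symm
  induction k, hjk using Nat.le_induction with
  | base => rfl
  | succ k hjk ih =>
    have h1 := C.cnt_mono b hjk
    have h2 := C.cnt_succ b k
    have hb : C.kind k ≠ b := by
      intro hb
      rw [if_pos hb] at h2
      omega
    rw [if_neg hb] at h2
    rw [C.strandLabel_succ m hb, ih (by omega)]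

open Classical in
/-- The number of the boundary circle at a directed edge. -/
noncomputable def edgeLabel (m : ℕ) (e : ℕ × Bool) : ℕ :=
  if e.1 ≤ C.size then C.firstLabel m e.1 e.2
  else if h : ∃ k ≤ C.size, C.strand true k = e.1 then C.strandLabel m true h.choose e.2
  else if h : ∃ k ≤ C.size, C.strand false k = e.1 then C.strandLabel m false h.choose e.2
  else 0

/-- The conditions on the first and the last crossings under which the curve bounds the maximal
number of regions on the torus. -/
structure IsFramed (m : ℕ) : Prop where
  size_eq : C.size = m + 2
  bodd_eq : m.bodd = true
  kind_zero : C.kind 0 = false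
  kind_one : C.kind 1 = true
  kind_penultimate : C.kind m = true
  kind_last : C.kind (m + 1) = false

variable {C} {m : ℕ}

namespace IsFramed

theorem gap_size (h : C.IsFramed m) : (C.gap m C.size).2 = (0, 0) := by
  rw [h.size_eq, gap, gap, h.kind_last, h.kind_penultimate]
  simp [newLabel]

theorem edgeLabel_first (k : ℕ) (hk : k ≤ C.size) (d : Bool) :
    C.edgeLabel m (k, d) = C.firstLabel m k d := if_pos hk

/-- Two edges belong to two strands each: the top of the first and second strands, and the passage
from the second to the third. The framing conditions make the two labels agree there, so the choices
in `edgeLabel` are harmless. -/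
theorem edgeLabel_strand (h : C.IsFramed m) (b : Bool) {k : ℕ} (hk : k ≤ C.size) (d : Bool) :
    C.edgeLabel m (C.strand b k, d) = C.strandLabel m b k d := by
  have hg := h.gap_size
  have hbodd : C.size.bodd = true := by simp [h.size_eq, h.bodd_eq]
  have hc := C.cnt_add C.size
  have hmono := fun b => C.cnt_mono b hk
  have hmt := hmono true
  have hmf := hmono false
  have hend : C.strandLabel m true 0 = C.strandLabel m false C.size := by
    funext d
    simp [strandLabel, hg, gap]
  cases b
  · have hpos : 0 < C.cnt true C.size :=
      lt_of_le_of_lt (Nat.zero_le _) (C.cnt_lt true (by rw [h.size_eq]; omega) h.kind_one)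
    unfold edgeLabel
    rw [if_neg (by simp only [strand]; omega)]
    split_ifs with h1 h2
    · obtain ⟨hj, e⟩ := h1.choose_spec
      have hj' : C.strand true h1.choose ≤ C.strand true 0 := by
        simp only [strand, C.cnt_zero]; omega
      have hk' : C.strand false C.size ≤ C.strand false k := by
        simp only [strand]; omega
      have e0 := C.strand_true_zero
      have e1 : C.strand true h1.choose = C.strand true 0 := by simp only at e; omega
      have e2 : C.strand false C.size = C.strand false k := by simp only at e; omega
      rw [C.strandLabel_congr m e1 hj (Nat.zero_le _), hend,
        C.strandLabel_congr m e2 le_rfl hk]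
    · obtain ⟨hj, e⟩ := h2.choose_spec
      rw [C.strandLabel_congr m e hj hk]
    · exact absurd ⟨k, hk, rfl⟩ h2
  · unfold edgeLabel
    split_ifs with h0 h1
    · have h2 : C.strand true k = C.size := by
        simp only [strand] at h0 ⊢; omega
      have h3 := C.strandLabel_congr m (h2.trans C.strand_true_size.symm) hk le_rfl
      rw [h3, h2]
      simp [strandLabel, firstLabel, hg, hbodd]
      cases d <;> rfl
    · obtain ⟨hj, e⟩ := h1.choose_spec
      rw [C.strandLabel_congr m e hj hk]
    · exact absurd ⟨k, hk, rfl⟩ h1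
    · exact absurd ⟨k, hk, rfl⟩ h1

theorem isBoundaryInvariant_edgeLabel (h : C.IsFramed m) :
    C.diagram.IsBoundaryInvariant (C.edgeLabel m) := by
  rw [isBoundaryInvariant_iff]
  simp only [h.edgeLabel_strand _ (Nat.zero_le _), edgeLabel_first _ (Nat.zero_le _)]
  refine ⟨by simp [firstLabel, strandLabel, gap], ?_⟩
  rintro k hk d rfl
  rw [h.edgeLabel_strand _ hk.le, h.edgeLabel_strand _ hk.le, h.edgeLabel_strand _ hk,
    h.edgeLabel_strand _ hk, edgeLabel_first _ hk.le, edgeLabel_first _ hk.le,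
    edgeLabel_first _ hk, edgeLabel_first _ hk]
  unfold firstLabel strandLabel
  rw [gap, Nat.bodd_succ]
  cases C.kind k <;> cases k.bodd <;> simp

end IsFramed

/-- Directed edges on the boundary circles. -/
def boundaryEdge (C : ThreeStrandCode) (m : ℕ) : ℕ → ℕ × Bool
  | 0 => (0, true)
  | j + 1 => if j < m then (j + 1, !(j.bodd != C.kind j)) else (0, false)

namespace IsFramed

theorem boundaryEdge_le (h : C.IsFramed m) (j : ℕ) :
    (C.boundaryEdge m j).1 ≤ C.size := by
  cases j with
  | zero => exact Nat.zero_le _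
  | succ j =>
    have := h.size_eq
    rw [boundaryEdge]
    split_ifs <;> simp only <;> omega

theorem edgeLabel_boundaryEdge (h : C.IsFramed m) {j : ℕ} (hj : j < m + 2) :
    C.edgeLabel m (C.boundaryEdge m j) = j := by
  rw [edgeLabel, if_pos (h.boundaryEdge_le j)]
  cases j with
  | zero => simp [boundaryEdge, firstLabel, gap]
  | succ j =>
    rw [boundaryEdge]
    split_ifs with hjm
    · simp only [firstLabel]
      rw [gap, Nat.bodd_succ]
      cases C.kind j <;> cases j.bodd <;> simp [newLabel, hjm]
    · have : j = m := by omega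
      subst this
      simp [firstLabel, gap]

/-- The first `m` crossings open at most one circle each, in addition to the two sides of the
basepoint. The corners above the last two crossings lie on the circle of `(0, true)`. -/
theorem exists_boundaryEdge (h : C.IsFramed m) {Y : Type*} {s : ℕ × Bool → Y}
    (hs : C.diagram.IsBoundaryInvariant s) {e : ℕ} (he : e ≤ C.diagram.word.length) (d : Bool) :
    s (e, d) ∈ (fun j => s (C.boundaryEdge m j)) '' Set.Iio (m + 2) := by
  obtain ⟨⟨b1, b2⟩, hs'⟩ := (C.isBoundaryInvariant_iff s).1 hs
  have hN := h.size_eq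
  have m0 : 0 < m := by
    rcases Nat.eq_zero_or_pos m with rfl | h0
    · have := h.bodd_eq
      simp at this
    · exact h0
  obtain ⟨-, -, -, a4⟩ := hs' 0 (by omega) false (by rw [h.kind_zero]; rfl)
  obtain ⟨c1, -, -, -⟩ := hs' 1 (by omega) false (by rw [h.kind_one]; rfl)
  obtain ⟨-, p2, -, -⟩ := hs' m (by omega) false (by rw [h.kind_penultimate, h.bodd_eq]; rfl)
  obtain ⟨-, l2, l3, -⟩ := hs' (m + 1) (by omega) false (by
    rw [h.kind_last, Nat.bodd_succ, h.bodd_eq]; rfl)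
  rw [h.kind_zero] at a4
  rw [h.kind_one] at c1
  rw [h.kind_penultimate] at p2
  rw [h.kind_last, ← hN, ← C.strand_true_zero] at l3 l2
  rw [C.strand_succ (by rw [h.kind_zero]; decide)] at c1
  have q1 : C.strand true C.size = C.strand true (m + 1) := by
    rw [hN]
    exact C.strand_succ (by rw [h.kind_last]; decide)
  rw [C.strand_true_size] at q1
  -- The corners at the first two crossings connect the lower end of the second strand with the
  -- basepoint.
  have x2 : s (C.strand true 0, false) = s (0, true) := by
    rw [← c1, b1]
    exact a4
  have rm : s (m + 1, true) = s (0, true) := by rw [← x2]; exact l3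
  have rl : s (C.size, true) = s (0, true) := by rw [q1, ← rm]; exact p2.symm
  have x1 : s (C.strand true 0, true) = s (0, true) := by rw [← rl]; exact l2.symm
  have o1 : s (0, true) ∈ (fun j => s (C.boundaryEdge m j)) '' Set.Iio (m + 2) :=
    ⟨0, by simp, rfl⟩
  have o2 : s (0, false) ∈ (fun j => s (C.boundaryEdge m j)) '' Set.Iio (m + 2) :=
    ⟨m + 1, by simp, by simp [boundaryEdge]⟩
  refine C.forall_mem_of_isBoundaryInvariant hs _ ?_ ?_ ?_ he d
  · rintro (_ | _)
    exacts [o2, o1]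
  · rintro (_ | _) (_ | _)
    · rwa [b2]
    · rwa [← b1]
    · rwa [x2]
    · rwa [x1]
  · intro k hk
    rcases lt_or_ge k m with hkm | hkm
    · exact ⟨k + 1, by simp; omega, by simp [boundaryEdge, hkm]⟩
    · obtain rfl | rfl : k = m ∨ k = m + 1 := by omega
      · rw [h.kind_penultimate, h.bodd_eq]
        change s (k + 1, true) ∈ _
        rwa [rm]
      · rw [h.kind_last, Nat.bodd_succ, h.bodd_eq]
        change s (m + 2, true) ∈ _
        rwa [← hN, rl, hN]

/-- The chosen directed edges meet every circle, and the invariant labels tell their circles apart.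
-/
theorem card_boundaryCircle (h : C.IsFramed m) :
    Nat.card C.diagram.BoundaryCircle = C.size := by
  obtain ⟨q, hq⟩ := C.diagram.exists_lift h.isBoundaryInvariant_edgeLabel
  rw [← Nat.card_fin C.size]
  refine (Nat.card_eq_of_bijective
    (fun j : Fin C.size => C.diagram.circle (C.boundaryEdge m j)) ⟨?_, ?_⟩).symm
  · have hinj : ∀ j : Fin C.size, q (C.diagram.circle (C.boundaryEdge m j)) = j := by
      intro j
      have := h.boundaryEdge_le j
      refine (hq (C.boundaryEdge m j).1 ?_ (C.boundaryEdge m j).2).trans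
        (h.edgeLabel_boundaryEdge (h.size_eq ▸ j.2))
      rw [C.length_code]
      omega
    intro i j hij
    have := congrArg q hij
    simp only [hinj] at this
    exact Fin.ext this
  · intro c
    obtain ⟨e, he, d, rfl⟩ := C.diagram.circle_surjective c
    obtain ⟨j, hj, e⟩ := h.exists_boundaryEdge C.diagram.isBoundaryInvariant_circle he d
    exact ⟨⟨j, h.size_eq ▸ hj⟩, e⟩

/-- With `N` crossings there are `2N` passages and `N` disks, so the Euler characteristic is `N - 2N
+ N = 0`. -/
theorem hasGenus_diskRealization (h : C.IsFramed m) : C.diagram.diskRealization.HasGenus 1 := by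
  rw [GaussDiagram.SurfaceRealization.HasGenus, GaussDiagram.eulerChar_diskRealization,
    h.card_boundaryCircle, card_crossings, length_code]
  push_cast
  ring

end IsFramed

/-- The frame has seven crossings of its own; an even `M` therefore gives an odd total, as the
closing of the strands requires. -/
theorem isFramed_frame (a t : Fin 2) {M : List (Bool × Fin 2)} (hM : Even M.length) :
    (ofList (frame a t M)).IsFramed (M.length + 5) := by
  have hk : ∀ i, (ofList (frame a t M)).kind i = ((frame a t M).getD i (true, 0)).1 := fun _ => rfl
  refine ⟨?_, ?_, rfl, rfl, ?_, ?_⟩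
  · simp [ofList, frame]
  · have : M.length.bodd = false := by
      have h2 := Nat.mod_two_of_bodd M.length
      rw [Nat.even_iff.1 hM] at h2
      cases h : M.length.bodd
      · rfl
      · simp [h] at h2
    simp [this]
  · rw [hk]
    simp [frame, List.getD_eq_getElem?_getD]
  · rw [hk]
    simp [frame, List.getD_eq_getElem?_getD]

end ThreeStrandCode

/-! ### Vanishing at 1 and the equivalence -/

namespace LongVirtualKnot

open LaurentPolynomial

theorem eval₂_one_zsmul_T_sub (n k : ℤ) :
    eval₂ (RingHom.id ℤ) 1 (n • (T k - 1 : ℤ[T;T⁻¹])) = 0 := by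
  rw [map_zsmul, map_sub, map_one]
  simp

theorem eval₂_one_zsmul_invert_T_sub (n k : ℤ) :
    eval₂ (RingHom.id ℤ) 1 (n • invert (T k - 1 : ℤ[T;T⁻¹])) = 0 := by
  rw [map_sub, map_one, invert_T]
  exact eval₂_one_zsmul_T_sub n (-k)

theorem eval₂_one_W (D : GaussDiagram) (a : Fin 2) :
    eval₂ (RingHom.id ℤ) 1 (D.W a) = 0 := by
  rw [GaussDiagram.W, map_sum]
  exact Finset.sum_eq_zero fun x _ => eval₂_one_zsmul_T_sub _ _

theorem eval₂_one_invert_W (D : GaussDiagram) (a : Fin 2) :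
    eval₂ (RingHom.id ℤ) 1 (invert (D.W a)) = 0 := by
  rw [GaussDiagram.W, map_sum, map_sum]
  refine Finset.sum_eq_zero fun x _ => ?_
  rw [map_zsmul]
  exact eval₂_one_zsmul_invert_T_sub _ _

theorem eval₂_one_F (D : GaussDiagram) (a b : Fin 2) :
    eval₂ (RingHom.id ℤ) 1 (GaussDiagram.F a b D) = 0 := by
  rw [GaussDiagram.F, map_sum]
  refine Finset.sum_eq_zero fun x _ => ?_
  rw [map_sum]
  exact Finset.sum_eq_zero fun y _ => eval₂_one_zsmul_T_sub _ _

theorem eval₂_one_G (D : GaussDiagram) (a b : Fin 2) :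
    eval₂ (RingHom.id ℤ) 1 (GaussDiagram.G a b D) = 0 := by
  rw [GaussDiagram.G, map_sub, map_zsmul, eval₂_one_W, map_sum, smul_zero, sub_zero]
  refine Finset.sum_eq_zero fun x _ => ?_
  rw [map_sum]
  exact Finset.sum_eq_zero fun y _ => eval₂_one_zsmul_T_sub _ _

theorem eval₂_one_H (D : GaussDiagram) (a b : Fin 2) :
    eval₂ (RingHom.id ℤ) 1 (GaussDiagram.H a b D) = 0 := by
  rw [GaussDiagram.H, map_sub, map_sub, map_zsmul, map_zsmul, eval₂_one_W, eval₂_one_invert_W,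
    map_sum, smul_zero, smul_zero, sub_zero, sub_zero]
  refine Finset.sum_eq_zero fun x _ => ?_
  rw [map_sum]
  exact Finset.sum_eq_zero fun y _ => eval₂_one_zsmul_T_sub _ _

/-- One framed diagram with the right pair sum is enough: invariance carries its value to all
diagrams of the knot, and its disk realization bounds the genus. -/
theorem exists_hasPolynomial_iff {φ : ℤ → ℤ → ℤ → ℤ[T;T⁻¹]} {a b : Fin 2} (hab : a ≠ b)
    (hφ : (∀ s, φ 0 s 0 = 0) ∧ ∀ r, 4 ∣ r → φ r 0 0 = 0) {P : GaussDiagram → ℤ[T;T⁻¹]}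
    (hP : ∀ D, P D = D.pairSum φ a b) (h0 : ∀ D, eval₂ (RingHom.id ℤ) 1 (P D) = 0)
    {f : ℤ[T;T⁻¹]} (h1 : eval₂ (RingHom.id ℤ) 1 f = 0 → ∃ (t : Fin 2) (M : List (Bool × Fin 2)),
      Even M.length ∧
        (ThreeStrandCode.ofList (ThreeStrandCode.frame a t M)).diagram.pairSum φ a b = f) :
    List.TFAE [
      ∃ K : LongVirtualKnot, K.HasPolynomial P f,
      ∃ K : LongVirtualKnot, K.HasPolynomial P f ∧ K.sg1 ≤ 1,
      eval₂ (RingHom.id ℤ) 1 f = 0] := by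
  tfae_have 1 → 3 := by
    rintro ⟨K, hK⟩
    obtain ⟨D, hD⟩ := Quotient.exists_rep K
    rw [← hK D hD]
    exact h0 D
  tfae_have 2 → 1 := by
    rintro ⟨K, hK, -⟩
    exact ⟨K, hK⟩
  tfae_have 3 → 2 := by
    intro hf
    obtain ⟨t, M, hM, h⟩ := h1 hf
    refine ⟨Quotient.mk _ (ThreeStrandCode.ofList (ThreeStrandCode.frame a t M)).diagram, ?_, ?_⟩
    · intro D hD
      rw [hP, ← h]
      exact GaussDiagram.pairSum_of_equiv (Quotient.exact hD) hab hφ.1 hφ.2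
    · exact sInf_le ⟨1, _, _, rfl, (ThreeStrandCode.isFramed_frame _ t hM).hasGenus_diskRealization,
        rfl⟩
  tfae_finish

end LongVirtualKnot

theorem theorem7p4 (f : LaurentPolynomial ℤ) (P : GaussDiagram → LaurentPolynomial ℤ)
    (hP : P = GaussDiagram.F 0 1 ∨ P = GaussDiagram.F 1 0 ∨
      P = GaussDiagram.G 0 1 ∨ P = GaussDiagram.G 1 0 ∨
      P = GaussDiagram.H 0 1 ∨ P = GaussDiagram.H 1 0) :
    List.TFAE [
      ∃ K : LongVirtualKnot, K.HasPolynomial P f,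
      ∃ K : LongVirtualKnot, K.HasPolynomial P f ∧ K.sg1 ≤ 1,
      LaurentPolynomial.eval₂ (RingHom.id ℤ) 1 f = 0] := by
  have hF : ∀ a b : Fin 2, a ≠ b → P = GaussDiagram.F a b → List.TFAE [
      ∃ K : LongVirtualKnot, K.HasPolynomial P f,
      ∃ K : LongVirtualKnot, K.HasPolynomial P f ∧ K.sg1 ≤ 1,
      LaurentPolynomial.eval₂ (RingHom.id ℤ) 1 f = 0] := by
    rintro a b hab rfl
    exact LongVirtualKnot.exists_hasPolynomial_iff hab GaussDiagram.termF_kink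
      (GaussDiagram.F_eq_pairSum · a b) (LongVirtualKnot.eval₂_one_F · a b)
      (ThreeStrandCode.exists_frame_F hab)
  have hG : ∀ a b : Fin 2, a ≠ b → P = GaussDiagram.G a b → List.TFAE [
      ∃ K : LongVirtualKnot, K.HasPolynomial P f,
      ∃ K : LongVirtualKnot, K.HasPolynomial P f ∧ K.sg1 ≤ 1,
      LaurentPolynomial.eval₂ (RingHom.id ℤ) 1 f = 0] := by
    rintro a b hab rfl
    exact LongVirtualKnot.exists_hasPolynomial_iff hab GaussDiagram.termG_kink
      (GaussDiagram.G_eq_pairSum · a b) (LongVirtualKnot.eval₂_one_G · a b)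
      (ThreeStrandCode.exists_frame_G hab)
  have hH : ∀ a b : Fin 2, a ≠ b → P = GaussDiagram.H a b → List.TFAE [
      ∃ K : LongVirtualKnot, K.HasPolynomial P f,
      ∃ K : LongVirtualKnot, K.HasPolynomial P f ∧ K.sg1 ≤ 1,
      LaurentPolynomial.eval₂ (RingHom.id ℤ) 1 f = 0] := by
    rintro a b hab rfl
    exact LongVirtualKnot.exists_hasPolynomial_iff hab GaussDiagram.termH_kink
      (GaussDiagram.H_eq_pairSum · a b) (LongVirtualKnot.eval₂_one_H · a b)
      (ThreeStrandCode.exists_frame_H hab)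
  rcases hP with h | h | h | h | h | h
  · exact hF 0 1 (by decide) h
  · exact hF 1 0 (by decide) h
  · exact hG 0 1 (by decide) h
  · exact hG 1 0 (by decide) h
  · exact hH 0 1 (by decide) h
  · exact hH 1 0 (by decide) h
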